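/- Let $K$ be a field, let $m\ge 1$, and let $\mathbf q=(q_0,\dots,q_{m-1})\in (K^*)^m$ with $\zeta=q_0q_1\cdots q_{m-1}$; all indices are taken modulo $m$. Let $\mathcal Q$ be the quiver with vertices $0,\dots,m-1$ and arrows $a_i:i\to i+1$, $\bar a_i:i+1\to i$, with trivial paths $e_i$ and paths written from left to right. Let $\Lambda_{\mathbf q}=K\mathcal Q/I_{\mathbf q}$, where $I_{\mathbf q}$ is generated by $a_ia_{i+1}$, $\bar a_{i-1}\bar a_{i-2}$ and $q_ia_i\bar a_i-\bar a_{i-1}a_{i-1}$ for $i=0,\dots,m-1$. Let $E(\Lambda_{\mathbf q})=\bigoplus_{n\ge0}\operatorname{Ext}^n_{\Lambda_{\mathbf q}}(\Lambda_{\mathbf q}/\mathfrak r,\Lambda_{\mathbf q}/\mathfrak r)$ with the Yoneda product, where $\mathfrak r$ is the Jacobson radical of $\Lambda_{\mathbf q}$. The graded centre $Z_{\rm gr}(E(\Lambda_{\mathbf q}))$ is the subalgebra generated by the homogeneous elements $z$ of degree $n$ with $zg=(-1)^{kn}gz$ for all $k$ and all homogeneous $g$ of degree $k$. Theorem. There is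 an isomorphism of graded $K$-algebras $$E(\Lambda_{\mathbf q})\cong K\mathcal Q\big/\big\langle q_i^{-1}a_i\bar a_i+\bar a_{i-1}a_{i-1} : i=0,\dots,m-1\big\rangle$$ (the right-hand side graded by path length) such that, when the two algebras are identified along it, the following holds. Write $\gamma_i^n=a_ia_{i+1}\cdots a_{i+n-1}$, $\delta_i^n=\bar a_{i+n-1}\cdots\bar a_{i+1}\bar a_i$ (with $\gamma_i^0=\delta_i^0=e_i$) and $$x_n=\sum_{i=0}^{m-1}\gamma_i^n,\quad y_n=\sum_{i=0}^{m-1}\delta_i^n,\quad w_n=\sum_{i=0}^{m-1}(-1)^{in}\prod_{k=1}^i(q_k\cdots q_{k+n-1})^{-1}\gamma_i^n\delta_i^n .$$ If $\zeta$ is not a root of unity, then $Z_{\rm gr}(E(\Lambda_{\mathbf q}))=K$. Suppose that $\zeta$ is a primitive $d$-th root of unity, $d\ge1$. Then, in each of the following cases, the given elements $x,y,w$ lie in $Z_{\rm gr}(E(\Lambda_{\mathbf q}))$, and $$Z_{\rm gr}(E(\Lambda_{\mathbf q}))=K[x,y,w]/\langle w^p-\varepsilon xy\rangle ,$$ that is,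 sending the three variables to these elements induces an isomorphism of $K$-algebras from the quotient of the polynomial ring onto the graded centre. 1. If $m$ is even or $\operatorname{char}K=2$: $x=x_{dm}$, $y=y_{dm}$, $w=w_d$, $p=m$ and $\varepsilon=(-1)^{md/2}\prod_{l=1}^{m-1}\prod_{k=1}^{ld}(q_k\cdots q_{k+d-1})^{-1}$ (where the sign is $1$ if $\operatorname{char} K=2$). 2. If $m$ is odd and $\operatorname{char}K\ne2$: - if $d\equiv0\pmod 4$: $x=x_{dm}$, $y=y_{dm}$, $w=w_d$, $p=m$ and $\varepsilon=\prod_{l=1}^{m-1}\prod_{k=1}^{ld}(q_k\cdots q_{k+d-1})^{-1}$; - if $d$ is odd: $x=x_{2dm}$, $y=y_{2dm}$, $w=w_{2d}$, $p=m$ and $\varepsilon=\prod_{l=1}^{m-1}\prod_{k=1}^{2ld}(q_k\cdots q_{k+2d-1})^{-1}$; - if $d\equiv2\pmod 4$: $x=x_{dm}$, $y=y_{dm}$, $w=w_{d/2}$, $p=2m$ and $\varepsilon=-\prod_{l=1}^{2m-1}\prod_{k=1}^{ld/2}(q_k\cdots q_{k+d/2-1})^{-1}$. Moreover, for some $c\in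 K^*$, the same presentation holds with $x=c\,x_{dm}$, $y=y_{dm}$, $w=w_{d/2}$, $p=2m$ and $\varepsilon=\prod_{l=1}^{2m-1}\prod_{k=1}^{ld/2}(q_k\cdots q_{k+d-1})^{-1}$. -/

import Mathlib

open CategoryTheory

noncomputable section

/-! ### The path algebra of a quiver with finitely many vertices -/

/-- The path algebra `KQ`: the `K`-vector space with basis the paths of the quiver. The product of
two paths is their concatenation (written from left to right), or zero if they do not compose. -/
def PathAlgebra (K : Type*) [Field K] (V : Type*) [Quiver V] : Type _ :=
  (Σ i j : V, Quiver.Path i j) →₀ K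

namespace PathAlgebra

variable (K : Type*) [Field K] {V : Type*} [Quiver V]

instance : AddCommGroup (PathAlgebra K V) :=
  inferInstanceAs (AddCommGroup ((Σ i j : V, Quiver.Path i j) →₀ K))

instance : Module K (PathAlgebra K V) :=
  inferInstanceAs (Module K ((Σ i j : V, Quiver.Path i j) →₀ K))

/-- The coordinates of an element of the path algebra in the basis of paths. -/
def coord : PathAlgebra K V ≃ₗ[K] ((Σ i j : V, Quiver.Path i j) →₀ K) :=
  LinearEquiv.refl K _

/-- The basis element of the path algebra given by a path. -/
def ofPath {i j : V} (p : Quiver.Path i j) : PathAlgebra K V :=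
  (coord K).symm (Finsupp.single ⟨i, j, p⟩ 1)

open Classical in
/-- The product of two paths: their concatenation, or zero if they do not compose. -/
def pathMul (p q : Σ i j : V, Quiver.Path i j) : PathAlgebra K V :=
  if h : q.1 = p.2.1 then ofPath K (p.2.2.comp (h ▸ q.2.2 : Quiver.Path p.2.1 q.2.1)) else 0

/-- The product of the path algebra, as a bilinear map. -/
def mulLin : PathAlgebra K V →ₗ[K] PathAlgebra K V →ₗ[K] PathAlgebra K V :=
  (Finsupp.linearCombination K fun p =>
    (Finsupp.linearCombination K fun q => pathMul K p q) ∘ₗ (coord K).toLinearMap) ∘ₗ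
      (coord K).toLinearMap

instance : Mul (PathAlgebra K V) := ⟨fun x y => mulLin K x y⟩

theorem mul_def (x y : PathAlgebra K V) : x * y = mulLin K x y := rfl

theorem mulLin_ofPath {i j k l : V} (p : Quiver.Path i j) (q : Quiver.Path k l) :
    mulLin K (ofPath K p) (ofPath K q) = pathMul K ⟨i, j, p⟩ ⟨k, l, q⟩ := by
  unfold mulLin ofPath
  simp

theorem ofPath_mul_ofPath {i j k : V} (p : Quiver.Path i j) (q : Quiver.Path j k) :
    ofPath K p * ofPath K q = ofPath K (p.comp q) := by
  rw [mul_def, mulLin_ofPath]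
  simp [pathMul]

theorem ofPath_mul_ofPath_of_ne {i j k l : V} (p : Quiver.Path i j) (q : Quiver.Path k l)
    (h : k ≠ j) : ofPath K p * ofPath K q = 0 := by
  rw [mul_def, mulLin_ofPath]
  simp [pathMul, h]

variable {K} in
theorem induction {P : PathAlgebra K V → Prop} (x : PathAlgebra K V) (zero : P 0)
    (add : ∀ y z, P y → P z → P (y + z))
    (smul : ∀ (c : K) {i j : V} (p : Quiver.Path i j), P (c • ofPath K p)) : P x := by
  obtain ⟨f, rfl⟩ := (coord K).symm.surjective x
  induction f using Finsupp.induction_linear with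
  | zero => rwa [map_zero]
  | add f g hf hg =>
    rw [map_add]
    exact add _ _ hf hg
  | single p c =>
    obtain ⟨i, j, p⟩ := p
    have h := smul c p
    rwa [ofPath, ← map_smul, Finsupp.smul_single, smul_eq_mul, mul_one] at h

theorem mul_assoc' (x y z : PathAlgebra K V) : x * y * z = x * (y * z) := by
  simp only [mul_def]
  induction x using induction with
  | zero => simp
  | add a b ha hb => simp [ha, hb]
  | smul c p =>
    induction y using induction with
    | zero => simp
    | add a b ha hb => simp only [map_add, LinearMap.add_apply, ha, hb]
    | smul c' q =>
      induction z using induction with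
      | zero => simp
      | add a b ha hb => simp only [map_add, ha, hb]
      | smul c'' r =>
        simp only [map_smul, LinearMap.smul_apply]
        congr 3
        simp only [← mul_def]
        rename_i i j i' j' i'' j''
        by_cases h : i' = j
        · subst h
          by_cases h' : i'' = j'
          · subst h'
            simp only [ofPath_mul_ofPath, Quiver.Path.comp_assoc]
          · rw [ofPath_mul_ofPath, ofPath_mul_ofPath_of_ne K _ _ h',
              ofPath_mul_ofPath_of_ne K _ _ h']
            simp [mul_def]
        · rw [ofPath_mul_ofPath_of_ne K _ _ h]
          by_cases h' : i'' = j'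
          · subst h'
            rw [ofPath_mul_ofPath, ofPath_mul_ofPath_of_ne K _ _ h]
            simp [mul_def]
          · rw [ofPath_mul_ofPath_of_ne K _ _ h']
            simp [mul_def]

variable [Fintype V]

instance : One (PathAlgebra K V) := ⟨∑ i : V, ofPath K (Quiver.Path.nil : Quiver.Path i i)⟩

theorem one_def : (1 : PathAlgebra K V) =
    ∑ i : V, ofPath K (Quiver.Path.nil : Quiver.Path i i) := rfl

theorem one_mul' (x : PathAlgebra K V) : 1 * x = x := by
  simp only [mul_def]
  induction x using induction with
  | zero => simp
  | add a b ha hb => simp only [map_add, ha, hb]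
  | smul c p =>
    rename_i i j
    rw [map_smul]
    congr 1
    rw [one_def, map_sum, LinearMap.sum_apply, Finset.sum_eq_single i]
    · rw [← mul_def, ofPath_mul_ofPath, Quiver.Path.nil_comp]
    · intro k _ hk
      rw [← mul_def, ofPath_mul_ofPath_of_ne K _ _ hk.symm]
    · simp

theorem mul_one' (x : PathAlgebra K V) : x * 1 = x := by
  simp only [mul_def]
  induction x using induction with
  | zero => simp
  | add a b ha hb => simp only [map_add, LinearMap.add_apply, ha, hb]
  | smul c p =>
    rename_i i j
    rw [map_smul, LinearMap.smul_apply]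
    congr 1
    rw [one_def, map_sum, Finset.sum_eq_single j]
    · rw [← mul_def, ofPath_mul_ofPath, Quiver.Path.comp_nil]
    · intro k _ hk
      rw [← mul_def, ofPath_mul_ofPath_of_ne K _ _ hk]
    · simp

instance : Ring (PathAlgebra K V) where
  __ := (inferInstance : AddCommGroup (PathAlgebra K V))
  mul_assoc := mul_assoc' K
  one_mul := one_mul' K
  mul_one := mul_one' K
  left_distrib x y z := map_add (mulLin K x) y z
  right_distrib x y z := by simp only [mul_def, map_add, LinearMap.add_apply]
  zero_mul x := by simp only [mul_def, map_zero, LinearMap.zero_apply]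
  mul_zero x := map_zero (mulLin K x)

instance : Algebra K (PathAlgebra K V) :=
  Algebra.ofModule
    (fun c x y => by simp only [mul_def, map_smul, LinearMap.smul_apply])
    (fun c x y => map_smul (mulLin K x) c y)

end PathAlgebra

/-! ### The quiver and the algebras `Λ_q` -/

/-- The vertices `0, 1, …, m - 1` of the quiver, taken modulo `m`. -/
def CycleVertex (m : ℕ) : Type := ZMod m

instance (m : ℕ) [NeZero m] : Fintype (CycleVertex m) := inferInstanceAs (Fintype (ZMod m))

/-- The `2m` arrows: `a i` from `i` to `i + 1` and `abar i` from `i + 1` to `i`. -/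
inductive CycleArrow (m : ℕ) : ZMod m → ZMod m → Type
  | a (i : ZMod m) : CycleArrow m i (i + 1)
  | abar (i : ZMod m) : CycleArrow m (i + 1) i

instance (m : ℕ) : Quiver (CycleVertex m) := ⟨CycleArrow m⟩

namespace SocleDeformation

variable (K : Type*) [Field K] (m : ℕ)

/-- The trivial path at the vertex `i`. -/
def e (i : ZMod m) : PathAlgebra K (CycleVertex m) :=
  PathAlgebra.ofPath K (Quiver.Path.nil : Quiver.Path (V := CycleVertex m) i i)

/-- The arrow `a_i`, as an element of the path algebra. -/
def a (i : ZMod m) : PathAlgebra K (CycleVertex m) :=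
  PathAlgebra.ofPath K (Quiver.Hom.toPath (V := CycleVertex m) (CycleArrow.a i))

/-- The arrow `ā_i`, as an element of the path algebra. -/
def abar (i : ZMod m) : PathAlgebra K (CycleVertex m) :=
  PathAlgebra.ofPath K (Quiver.Hom.toPath (V := CycleVertex m) (CycleArrow.abar i))

variable {K m} [NeZero m] (q : ZMod m → Kˣ)

/-- The generators of the ideal `I_q` (each is set equal to zero). -/
inductive Rel : PathAlgebra K (CycleVertex m) → PathAlgebra K (CycleVertex m) → Prop
  | aa (i : ZMod m) : Rel (a K m i * a K m (i + 1)) 0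
  | abar_abar (i : ZMod m) : Rel (abar K m (i - 1) * abar K m (i - 2)) 0
  | comm (i : ZMod m) :
      Rel ((q i : K) • (a K m i * abar K m i) - abar K m (i - 1) * a K m (i - 1)) 0

/-- The algebra `Λ_q = KQ / I_q`. -/
abbrev Lam : Type _ := RingQuot (Rel q)

/-- The generators of the orthogonal ideal `I_q^⊥` (each is set equal to zero). -/
inductive DualRel : PathAlgebra K (CycleVertex m) → PathAlgebra K (CycleVertex m) → Prop
  | comm (i : ZMod m) :
      DualRel (((q i)⁻¹ : K) • (a K m i * abar K m i) + abar K m (i - 1) * a K m (i - 1)) 0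

/-- The Koszul dual `KQ / I_q^⊥`. -/
abbrev LamDual : Type _ := RingQuot (DualRel q)

variable (K m) in
/-- The path `γ_i^n = a_i a_{i+1} ⋯ a_{i+n-1}`. -/
def gam : ℕ → ZMod m → PathAlgebra K (CycleVertex m)
  | 0, i => e K m i
  | n + 1, i => a K m i * gam n (i + 1)

variable (K m) in
/-- The path `δ_i^n = ā_{i+n-1} ⋯ ā_{i+1} ā_i`. -/
def del : ℕ → ZMod m → PathAlgebra K (CycleVertex m)
  | 0, i => e K m i
  | n + 1, i => del n (i + 1) * abar K m i

/-- `(q_k q_{k+1} ⋯ q_{k+n-1})⁻¹`, with indices modulo `m`. -/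
def qInv (n k : ℕ) : K := (∏ u ∈ Finset.range n, (q ((k + u : ℕ) : ZMod m) : K))⁻¹

/-- The class of `∑_{i=0}^{m-1} γ_i^n` in `KQ / I_q^⊥`. -/
def xElt (n : ℕ) : LamDual q :=
  RingQuot.mkAlgHom K (DualRel q) (∑ i ∈ Finset.range m, gam K m n (i : ZMod m))

/-- The class of `∑_{i=0}^{m-1} δ_i^n` in `KQ / I_q^⊥`. -/
def yElt (n : ℕ) : LamDual q :=
  RingQuot.mkAlgHom K (DualRel q) (∑ i ∈ Finset.range m, del K m n (i : ZMod m))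

/-- The class of `∑_{i=0}^{m-1} (-1)^{in} ∏_{k=1}^i (q_k ⋯ q_{k+n-1})⁻¹ γ_i^n δ_i^n`
in `KQ / I_q^⊥`. -/
def wElt (n : ℕ) : LamDual q :=
  RingQuot.mkAlgHom K (DualRel q) (∑ i ∈ Finset.range m,
    ((-1 : K) ^ (i * n) * ∏ k ∈ Finset.Icc 1 i, qInv q n k) •
      (gam K m n (i : ZMod m) * del K m n (i : ZMod m)))

/-- `∏_{l=1}^{p-1} ∏_{k=1}^{ls} (q_k ⋯ q_{k+n-1})⁻¹`. -/
def epsProd (p s n : ℕ) : K :=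
  ∏ l ∈ Finset.Icc 1 (p - 1), ∏ k ∈ Finset.Icc 1 (l * s), qInv q n k

end SocleDeformation

/-! ### The Ext algebra and the graded centre -/

namespace ExtAlg

universe w v u t

variable {R : Type t} [CommRing R] {C : Type u} [Category.{v} C] [Abelian C]
  [HasExt.{w} C] (X : C)

open Abelian

instance : GradedMonoid.GMul (fun n : ℕ => Ext.{w} X X n) where
  mul x y := x.comp y rfl

instance : GradedMonoid.GOne (fun n : ℕ => Ext.{w} X X n) where
  one := Ext.mk₀ (𝟙 X)

theorem mk_comp {a b c : ℕ} (h : a + b = c) (x : Ext.{w} X X a) (y : Ext.{w} X X b) :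
    (GradedMonoid.mk (a + b) (x.comp y rfl) : GradedMonoid (fun n : ℕ => Ext.{w} X X n)) =
      GradedMonoid.mk c (x.comp y h) := by
  subst h
  rfl

/-- The Yoneda product on `Ext^*(X, X)`. -/
instance : DirectSum.GRing (fun n : ℕ => Ext.{w} X X n) where
  mul_zero x := Ext.comp_zero ..
  zero_mul y := Ext.zero_comp ..
  mul_add x y z := Ext.comp_add ..
  add_mul x y z := Ext.add_comp ..
  one_mul := by
    rintro ⟨n, x⟩
    exact (mk_comp X (zero_add n) (Ext.mk₀ (𝟙 X)) x).trans (by rw [Ext.mk₀_id_comp]; rfl)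
  mul_one := by
    rintro ⟨n, x⟩
    exact (mk_comp X (add_zero n) x (Ext.mk₀ (𝟙 X))).trans (by rw [Ext.comp_mk₀_id]; rfl)
  mul_assoc := by
    rintro ⟨a, x⟩ ⟨b, y⟩ ⟨c, z⟩
    exact (mk_comp X (add_assoc a b c) (x.comp y rfl) z).trans
      (congrArg (GradedMonoid.mk _) (Ext.comp_assoc x y z rfl rfl (add_assoc a b c)))
  natCast n := n • Ext.mk₀ (𝟙 X)
  natCast_zero := zero_smul _ _
  natCast_succ n := succ_nsmul _ _
  intCast n := n • Ext.mk₀ (𝟙 X)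
  intCast_ofNat n := natCast_zsmul _ _
  intCast_negSucc_ofNat n := negSucc_zsmul _ _

variable [Linear R C]

instance : DirectSum.GAlgebra R (fun n : ℕ => Ext.{w} X X n) where
  toFun :=
    { toFun := fun r => r • Ext.mk₀ (𝟙 X)
      map_zero' := zero_smul _ _
      map_add' := fun r s => add_smul r s _ }
  map_one := one_smul _ _
  map_mul r s := by
    refine Eq.trans ?_
      (mk_comp X (add_zero 0) (r • Ext.mk₀ (𝟙 X)) (s • Ext.mk₀ (𝟙 X))).symm
    refine congrArg (GradedMonoid.mk 0) ?_
    change (r * s) • Ext.mk₀ (𝟙 X) = _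
    rw [Ext.smul_comp, Ext.comp_smul, Ext.comp_mk₀_id, mul_smul]
  commutes r := by
    rintro ⟨n, x⟩
    refine (mk_comp X (zero_add n) (r • Ext.mk₀ (𝟙 X)) x).trans
      (Eq.trans ?_ (mk_comp X (add_zero n) x (r • Ext.mk₀ (𝟙 X))).symm)
    rw [Ext.smul_comp, Ext.comp_smul, Ext.mk₀_id_comp, Ext.comp_mk₀_id]
  smul_def r := by
    rintro ⟨n, x⟩
    refine Eq.trans ?_ (mk_comp X (zero_add n) (r • Ext.mk₀ (𝟙 X)) x).symm
    rw [Ext.smul_comp, Ext.mk₀_id_comp]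
    rfl

end ExtAlg

universe u

/-- The Ext algebra `E(Γ) = ⨁_n Ext^n_Γ(Γ/𝔯, Γ/𝔯)` with the Yoneda product, where `𝔯` is the
Jacobson radical of `Γ`. -/
abbrev ExtAlgebra (Γ : Type u) [Ring Γ] : Type u :=
  DirectSum ℕ fun n : ℕ => Abelian.Ext.{u} (ModuleCat.of Γ (Γ ⧸ Ring.jacobson Γ))
    (ModuleCat.of Γ (Γ ⧸ Ring.jacobson Γ)) n

/-- The homogeneous component `Ext^n_Γ(Γ/𝔯, Γ/𝔯)` of the Ext algebra. -/
def extPart (K Γ : Type u) [Field K] [Ring Γ] [Algebra K Γ] (n : ℕ) :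
    Submodule K (ExtAlgebra Γ) :=
  LinearMap.range (DirectSum.lof K ℕ (fun n : ℕ =>
    Abelian.Ext.{u} (ModuleCat.of Γ (Γ ⧸ Ring.jacobson Γ))
      (ModuleCat.of Γ (Γ ⧸ Ring.jacobson Γ)) n) n)

/-- The graded centre of an algebra `A` with homogeneous components `𝒜 n`: the subalgebra generated
by the homogeneous elements `z` of degree `n` with `z g = (-1)^{kn} g z` for all `k` and all `g`
homogeneous of degree `k`. -/
def gradedCentre {K A : Type u} [Field K] [Ring A] [Algebra K A] (𝒜 : ℕ → Submodule K A) :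
    Subalgebra K A :=
  Algebra.adjoin K {z | ∃ n, z ∈ 𝒜 n ∧ ∀ k, ∀ g ∈ 𝒜 k, z * g = (-1) ^ (k * n) * (g * z)}

/-- The graded centre `Z_gr(E(Γ))` of the Ext algebra of `Γ`. -/
abbrev gradedCentreExt (K Γ : Type u) [Field K] [Ring Γ] [Algebra K Γ] :
    Subalgebra K (ExtAlgebra Γ) :=
  gradedCentre (extPart K Γ)

/-- `Z = K[x, y, w]/⟨w^p - ε x y⟩` for the given elements `x, y, w`: they lie in `Z`, and there is
an isomorphism of `K`-algebras from the quotient of the polynomial ring in three variables onto `Z`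
that sends the classes of the variables to `x`, `y` and `w`. -/
def IsPresentedBy {K A : Type u} [Field K] [Ring A] [Algebra K A] (Z : Subalgebra K A)
    (x y w : A) (p : ℕ) (ε : K) : Prop :=
  ∃ f : (MvPolynomial (Fin 3) K ⧸ Ideal.span {(MvPolynomial.X 2 ^ p -
      MvPolynomial.C ε * (MvPolynomial.X 0 * MvPolynomial.X 1) : MvPolynomial (Fin 3) K)}) ≃ₐ[K] Z,
    (f (Ideal.Quotient.mk _ (MvPolynomial.X 0)) : A) = x ∧
    (f (Ideal.Quotient.mk _ (MvPolynomial.X 1)) : A) = y ∧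
    (f (Ideal.Quotient.mk _ (MvPolynomial.X 2)) : A) = w

end

open CategoryTheory

noncomputable section

namespace PathAlgebra

variable {K : Type*} [Field K] {V : Type*} [Quiver V] {T : Type*} [Ring T] [Algebra K T]

/-- The value of a path under an assignment of algebra elements to vertices and arrows. -/
def pathValue (e : V → T) (f : ∀ {i j : V}, (i ⟶ j) → T) {i : V} :
    ∀ {j : V}, Quiver.Path i j → T
  | _, .nil => e i
  | _, .cons p a => pathValue e f p * f a

section
variable (e : V → T) (f : ∀ {i j : V}, (i ⟶ j) → T)

theorem pathValue_mul_vertex (he : ∀ i, e i * e i = e i)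
    (hr : ∀ {i j : V} (a : i ⟶ j), f a * e j = f a) {i j : V} (p : Quiver.Path i j) :
    pathValue e f p * e j = pathValue e f p := by
  cases p with
  | nil => exact he i
  | cons p a => rw [pathValue, mul_assoc, hr]

theorem vertex_mul_pathValue (he : ∀ i, e i * e i = e i) {i j : V} (p : Quiver.Path i j) :
    e i * pathValue e f p = pathValue e f p := by
  induction p with
  | nil => exact he i
  | cons p a ih => rw [pathValue, ← mul_assoc, ih]

theorem pathValue_comp (he : ∀ i, e i * e i = e i)
    (hr : ∀ {i j : V} (a : i ⟶ j), f a * e j = f a) {i j k : V} (p : Quiver.Path i j)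
    (r : Quiver.Path j k) :
    pathValue e f (p.comp r) = pathValue e f p * pathValue e f r := by
  induction r with
  | nil => exact (pathValue_mul_vertex e f he hr p).symm
  | cons r a ih => rw [Quiver.Path.comp_cons, pathValue, ih, pathValue, mul_assoc]

/-- The linear extension of `pathValue` to the path algebra. -/
def liftLinear : PathAlgebra K V →ₗ[K] T :=
  (Finsupp.linearCombination K fun p : Σ i j : V, Quiver.Path i j => pathValue e f p.2.2) ∘ₗ
    (coord K).toLinearMap

theorem liftLinear_ofPath {i j : V} (p : Quiver.Path i j) :
    liftLinear (K := K) e f (ofPath K p) = pathValue e f p := by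
  simp [liftLinear, ofPath]

/-- The universal property of the path algebra of a quiver with finitely many vertices. -/
def lift [Fintype V] (he : ∀ i, e i * e i = e i) (ho : ∀ i j, i ≠ j → e i * e j = 0)
    (h1 : ∑ i, e i = 1) (hr : ∀ {i j : V} (a : i ⟶ j), f a * e j = f a) :
    PathAlgebra K V →ₐ[K] T :=
  AlgHom.ofLinearMap (liftLinear e f)
    (by
      rw [one_def, map_sum, ← h1]
      exact Finset.sum_congr rfl fun i _ => liftLinear_ofPath e f _)
    (by
      intro x y
      induction x using induction with
      | zero => simp
      | add x x' hx hx' => rw [add_mul, map_add, hx, hx', map_add, add_mul]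
      | smul c p =>
        induction y using induction with
        | zero => simp
        | add y y' hy hy' => rw [mul_add, map_add, hy, hy', map_add, mul_add]
        | smul c' r =>
          rename_i i j k l
          simp only [smul_mul_assoc, mul_smul_comm, map_smul]
          congr 2
          by_cases h : k = j
          · subst h
            rw [ofPath_mul_ofPath]
            simp only [liftLinear_ofPath]
            exact pathValue_comp e f he hr p r
          · rw [ofPath_mul_ofPath_of_ne K p r h]
            simp only [liftLinear_ofPath]
            rw [← pathValue_mul_vertex e f he hr p, ← vertex_mul_pathValue e f he r, map_zero,
              mul_assoc, ← mul_assoc (e j), ho j k (Ne.symm h), zero_mul, mul_zero])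

theorem lift_ofPath [Fintype V] (he : ∀ i, e i * e i = e i) (ho : ∀ i j, i ≠ j → e i * e j = 0)
    (h1 : ∑ i, e i = 1) (hr : ∀ {i j : V} (a : i ⟶ j), f a * e j = f a) {i j : V}
    (p : Quiver.Path i j) : lift (K := K) e f he ho h1 hr (ofPath K p) = pathValue e f p :=
  liftLinear_ofPath e f p

end

end PathAlgebra

/-- Elements `X` and `Y` of a `K`-algebra `T` that commute with the image of a commutative algebra
`R` up to a given automorphism of `R` and its inverse. -/
structure SkewRep {K R : Type*} [Field K] [CommRing R] [Algebra K R] (sh : R ≃ₐ[K] R)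
    (T : Type*) [Ring T] [Algebra K T] where
  /-- The coefficients. -/
  ι : R →ₐ[K] T
  /-- The variable that moves forward. -/
  X : T
  /-- The variable that moves backward. -/
  Y : T
  X_mul_ι : ∀ c, X * ι c = ι (sh c) * X
  Y_mul_ι_sh : ∀ c, Y * ι (sh c) = ι c * Y

namespace SkewRep

variable {K R : Type*} [Field K] [CommRing R] [Algebra K R] {sh : R ≃ₐ[K] R}
  {T : Type*} [Ring T] [Algebra K T] {T' : Type*} [Ring T'] [Algebra K T'] (ρ : SkewRep sh T)

/-- The image under an algebra homomorphism. -/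
@[simps]
def map (φ : T →ₐ[K] T') : SkewRep sh T' where
  ι := φ.comp ρ.ι
  X := φ ρ.X
  Y := φ ρ.Y
  X_mul_ι c := by simp only [AlgHom.comp_apply, ← map_mul, ρ.X_mul_ι]
  Y_mul_ι_sh c := by simp only [AlgHom.comp_apply, ← map_mul, ρ.Y_mul_ι_sh]

theorem Y_mul_ι (c : R) : ρ.Y * ρ.ι c = ρ.ι (sh.symm c) * ρ.Y := by
  rw [← ρ.Y_mul_ι_sh, AlgEquiv.apply_symm_apply]

end SkewRep

namespace SocleDeformation

variable (K : Type*) [Field K] (m : ℕ)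

/-- The rotation of functions on `ℤ/m`. -/
@[simps]
def cycShift : (ZMod m → K) ≃ₐ[K] (ZMod m → K) where
  toFun c i := c (i + 1)
  invFun c i := c (i - 1)
  left_inv c := by funext i; simp
  right_inv c := by funext i; simp
  map_mul' _ _ := rfl
  map_add' _ _ := rfl
  commutes' _ := rfl

variable {K m}

theorem cycShift_single (i : ZMod m) (x : K) :
    cycShift K m (Pi.single (i + 1) x) = Pi.single i x := by
  funext j
  simp [Pi.single_apply]

theorem cycShift_symm_single (i : ZMod m) (x : K) :
    (cycShift K m).symm (Pi.single i x) = Pi.single (i + 1) x := by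
  rw [← cycShift_single, AlgEquiv.symm_apply_apply]

variable {T : Type*} [Ring T] [Algebra K T]

/-- The image of an arrow of the cyclic quiver. -/
def arrowValue (ρ : SkewRep (cycShift K m) T) {i j : ZMod m} : CycleArrow m i j → T
  | .a i => ρ.ι (Pi.single i 1) * ρ.X
  | .abar i => ρ.ι (Pi.single (i + 1) 1) * ρ.Y

theorem single_mul_single (i j : ZMod m) :
    (Pi.single i 1 * Pi.single j 1 : ZMod m → K) = if i = j then Pi.single i 1 else 0 := by
  funext k
  by_cases h : i = j
  · subst h
    by_cases hk : k = i <;> simp [hk]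
  · by_cases hk : k = i <;> simp [Pi.single_apply, hk, h]

theorem arrowValue_mul_single (ρ : SkewRep (cycShift K m) T) {i j : ZMod m}
    (α : CycleArrow m i j) :
    arrowValue ρ α * ρ.ι (Pi.single j 1) = arrowValue ρ α := by
  cases α with
  | a i =>
    simp only [arrowValue]
    rw [mul_assoc, ρ.X_mul_ι, cycShift_single, ← mul_assoc, ← map_mul, single_mul_single,
      if_pos rfl]
  | abar i =>
    simp only [arrowValue]
    rw [mul_assoc, ρ.Y_mul_ι, cycShift_symm_single, ← mul_assoc, ← map_mul, single_mul_single,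
      if_pos rfl]

variable [NeZero m]

/-- The homomorphism from the path algebra of the cyclic quiver. -/
def pathLift (ρ : SkewRep (cycShift K m) T) : PathAlgebra K (CycleVertex m) →ₐ[K] T :=
  PathAlgebra.lift (V := CycleVertex m) (fun i : ZMod m => ρ.ι (Pi.single i 1))
    (fun {_ _} α => arrowValue ρ α)
    (fun i : ZMod m => by
      rw [← map_mul, single_mul_single, if_pos rfl])
    (fun (i j : ZMod m) h => by
      rw [← map_mul, single_mul_single, if_neg (show ¬(i : ZMod m) = j from h), map_zero])
    (by
      refine (map_sum ρ.ι (fun i : ZMod m => Pi.single i (1 : K)) Finset.univ).symm.trans ?_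
      rw [← map_one ρ.ι]
      exact congrArg _ (Finset.univ_sum_single (1 : ZMod m → K)))
    (fun α => arrowValue_mul_single ρ α)

theorem pathLift_e (ρ : SkewRep (cycShift K m) T) (i : ZMod m) :
    pathLift ρ (e K m i) = ρ.ι (Pi.single i 1) :=
  PathAlgebra.lift_ofPath ..

theorem pathLift_a (ρ : SkewRep (cycShift K m) T) (i : ZMod m) :
    pathLift ρ (a K m i) = ρ.ι (Pi.single i 1) * ρ.X := by
  refine (PathAlgebra.lift_ofPath ..).trans ?_
  change ρ.ι (Pi.single i 1) * (ρ.ι (Pi.single i 1) * ρ.X) = _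
  rw [← mul_assoc, ← map_mul, single_mul_single, if_pos rfl]

theorem pathLift_abar (ρ : SkewRep (cycShift K m) T) (i : ZMod m) :
    pathLift ρ (abar K m i) = ρ.ι (Pi.single (i + 1) 1) * ρ.Y := by
  refine (PathAlgebra.lift_ofPath ..).trans ?_
  change ρ.ι (Pi.single (i + 1) 1) * (ρ.ι (Pi.single (i + 1) 1) * ρ.Y) = _
  rw [← mul_assoc, ← map_mul, single_mul_single, if_pos rfl]

/-! ### The path algebra of the cyclic quiver -/

theorem e_mul_e (i j : ZMod m) : e K m i * e K m j = if i = j then e K m i else 0 := by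
  split_ifs with h
  · subst h
    exact PathAlgebra.ofPath_mul_ofPath ..
  · exact PathAlgebra.ofPath_mul_ofPath_of_ne K _ _ (Ne.symm h)

theorem e_mul_a (i j : ZMod m) : e K m i * a K m j = if i = j then a K m j else 0 := by
  split_ifs with h
  · subst h
    exact PathAlgebra.ofPath_mul_ofPath ..
  · exact PathAlgebra.ofPath_mul_ofPath_of_ne K _ _ (Ne.symm h)

theorem a_mul_e (i j : ZMod m) : a K m j * e K m i = if i = j + 1 then a K m j else 0 := by
  split_ifs with h
  · subst h
    exact PathAlgebra.ofPath_mul_ofPath ..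
  · exact PathAlgebra.ofPath_mul_ofPath_of_ne K _ _ h

theorem e_mul_abar (i j : ZMod m) :
    e K m i * abar K m j = if i = j + 1 then abar K m j else 0 := by
  split_ifs with h
  · subst h
    exact PathAlgebra.ofPath_mul_ofPath ..
  · exact PathAlgebra.ofPath_mul_ofPath_of_ne K _ _ (Ne.symm h)

theorem abar_mul_e (i j : ZMod m) : abar K m j * e K m i = if i = j then abar K m j else 0 := by
  split_ifs with h
  · subst h
    exact PathAlgebra.ofPath_mul_ofPath ..
  · exact PathAlgebra.ofPath_mul_ofPath_of_ne K _ _ h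

theorem sum_e : ∑ i, e K m i = 1 := rfl

variable (K m) in
/-- The coefficients and the sums of the arrows, inside the path algebra. -/
def pathRep : SkewRep (cycShift K m) (PathAlgebra K (CycleVertex m)) where
  ι := AlgHom.ofLinearMap
    (∑ i, (LinearMap.proj i : (ZMod m → K) →ₗ[K] K).smulRight (e K m i))
    (by simp [sum_e])
    (by
      intro c d
      simp [Finset.sum_mul_sum, e_mul_e, smul_smul, mul_comm])
  X := ∑ i, a K m i
  Y := ∑ i, abar K m i
  X_mul_ι c := by
    simp only [AlgHom.ofLinearMap_apply, LinearMap.sum_apply, LinearMap.smulRight_apply,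
      LinearMap.proj_apply, Finset.sum_mul_sum, smul_mul_assoc, mul_smul_comm, e_mul_a, a_mul_e]
    simp
  Y_mul_ι_sh c := by
    simp only [AlgHom.ofLinearMap_apply, LinearMap.sum_apply, LinearMap.smulRight_apply,
      LinearMap.proj_apply, Finset.sum_mul_sum, smul_mul_assoc, mul_smul_comm, e_mul_abar,
      abar_mul_e]
    rw [Finset.sum_comm (γ := ZMod m)]
    rw [Finset.sum_comm (γ := ZMod m)]
    simp [Finset.sum_comm (γ := ZMod m)]

theorem pathRep_ι_apply (c : ZMod m → K) : (pathRep K m).ι c = ∑ i, c i • e K m i := by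
  simp [pathRep]

theorem pathRep_ι_single (i : ZMod m) : (pathRep K m).ι (Pi.single i 1) = e K m i := by
  simp [pathRep_ι_apply, Pi.single_apply]

theorem e_mul_pathRep_X (i : ZMod m) : e K m i * (pathRep K m).X = a K m i := by
  simp [pathRep, Finset.mul_sum, e_mul_a]

theorem e_mul_pathRep_Y (i : ZMod m) : e K m (i + 1) * (pathRep K m).Y = abar K m i := by
  simp [pathRep, Finset.mul_sum, e_mul_abar]

theorem pathLift_pathRep_ι (ρ : SkewRep (cycShift K m) T) (c : ZMod m → K) :
    pathLift ρ ((pathRep K m).ι c) = ρ.ι c := by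
  rw [pathRep_ι_apply, map_sum]
  simp only [map_smul, pathLift_e]
  simp only [← map_smul, ← map_sum]
  congr 1
  funext j
  simp [Pi.single_apply]

theorem sum_ι_single_mul (ρ : SkewRep (cycShift K m) T) (x : T) :
    ∑ i, ρ.ι (Pi.single i 1) * x = x := by
  have h : ∑ i : ZMod m, Pi.single i (1 : K) = 1 := Finset.univ_sum_single (1 : ZMod m → K)
  rw [← Finset.sum_mul, ← map_sum, h, map_one, one_mul]

theorem pathLift_pathRep_X (ρ : SkewRep (cycShift K m) T) :
    pathLift ρ (pathRep K m).X = ρ.X := by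
  simp only [pathRep, map_sum, pathLift_a, sum_ι_single_mul]

theorem pathLift_pathRep_Y (ρ : SkewRep (cycShift K m) T) :
    pathLift ρ (pathRep K m).Y = ρ.Y := by
  simp only [pathRep, map_sum, pathLift_abar]
  exact (Equiv.sum_comp (Equiv.addRight (1 : ZMod m)) fun i => ρ.ι (Pi.single i 1) * ρ.Y).trans
    (sum_ι_single_mul ρ ρ.Y)

/-- A subspace that contains `1` and is stable under right multiplication by the coefficients and
the two variables is the whole path algebra. -/
theorem pathAlgebra_submodule_eq_top (N : Submodule K (PathAlgebra K (CycleVertex m)))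
    (h1 : 1 ∈ N) (hι : ∀ x ∈ N, ∀ c, x * (pathRep K m).ι c ∈ N)
    (hX : ∀ x ∈ N, x * (pathRep K m).X ∈ N) (hY : ∀ x ∈ N, x * (pathRep K m).Y ∈ N) :
    N = ⊤ := by
  have he : ∀ x ∈ N, ∀ i : ZMod m, x * e K m i ∈ N := fun x hx i => by
    rw [← pathRep_ι_single]
    exact hι x hx _
  have ha : ∀ x ∈ N, ∀ i j : ZMod m, ∀ α : CycleArrow m i j,
      x * PathAlgebra.ofPath K (Quiver.Hom.toPath (V := CycleVertex m) α) ∈ N := by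
    intro x hx i j α
    cases α with
    | a i =>
      change x * a K m _ ∈ N
      rw [← e_mul_pathRep_X, ← mul_assoc]
      exact hX _ (he x hx _)
    | abar i =>
      change x * abar K m _ ∈ N
      rw [← e_mul_pathRep_Y, ← mul_assoc]
      exact hY _ (he x hx _)
  refine eq_top_iff.2 fun x _ => ?_
  induction x using PathAlgebra.induction with
  | zero => exact N.zero_mem
  | add y z hy hz => exact N.add_mem (hy trivial) (hz trivial)
  | smul c p =>
    refine N.smul_mem c ?_
    induction p with
    | nil =>
      have h := he 1 h1
      simp only [one_mul] at h
      exact h _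
    | cons p α ih =>
      have := ha _ (ih trivial) _ _ α
      rwa [PathAlgebra.ofPath_mul_ofPath] at this

end SocleDeformation

/-! ### Dimension shifting along a sequence of syzygies -/

namespace Syzygy

universe w v u

open Abelian

variable {C : Type u} [Category.{v} C] [Abelian C] [HasExt.{w} C] {Ω P : ℕ → C}
  {i : ∀ n, Ω (n + 1) ⟶ P n} {π : ∀ n, P n ⟶ Ω n} {h0 : ∀ n, i n ≫ π n = 0}
  (hS : ∀ n, (ShortComplex.mk (i n) (π n) (h0 n)).ShortExact)
  {X : C} (s : X ⟶ Ω 0)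

/-- The class in `Ext^n(X, Ω n)` of the spliced extensions. -/
def cls : ∀ n, Ext.{w} X (Ω n) n
  | 0 => Ext.mk₀ s
  | n + 1 => (cls n).comp (hS n).extClass rfl

/-- The class in `Ext^n(X, Y)` given by a morphism from the `n`-th syzygy. -/
def toExt (n : ℕ) {Y : C} (f : Ω n ⟶ Y) : Ext.{w} X Y n :=
  (cls hS s n).comp (Ext.mk₀ f) (add_zero n)

theorem toExt_add (n : ℕ) {Y : C} (f g : Ω n ⟶ Y) :
    toExt hS s n (f + g) = toExt hS s n f + toExt hS s n g := by
  simp only [toExt, Ext.mk₀_add, Ext.comp_add]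

theorem toExt_smul {R : Type*} [CommRing R] [Linear R C] (n : ℕ) {Y : C} (r : R) (f : Ω n ⟶ Y) :
    toExt hS s n (r • f) = r • toExt hS s n f := by
  simp only [toExt, Ext.mk₀_smul, Ext.comp_smul]

variable {Y : C}

theorem extClass_comp_injective (hP : ∀ n, Projective (P n))
    (hY : ∀ n (φ : P n ⟶ Y), i n ≫ φ = 0) (n k : ℕ) (x : Ext.{w} (Ω (n + 1)) Y k)
    (hx : (hS n).extClass.comp x (add_comm 1 k) = 0) : x = 0 := by
  obtain ⟨y, rfl⟩ := Ext.contravariant_sequence_exact₁ (hS n) Y x (add_comm 1 k) hx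
  dsimp only at y ⊢
  cases k with
  | zero =>
    obtain ⟨φ, rfl⟩ := (Ext.mk₀_bijective _ _).2 y
    rw [Ext.mk₀_comp_mk₀, hY, Ext.mk₀_zero]
  | succ k =>
    have := hP n
    rw [Ext.eq_zero_of_projective y, Ext.comp_zero]

theorem extClass_comp_surjective (hP : ∀ n, Projective (P n)) (n k : ℕ)
    (x : Ext.{w} (Ω n) Y (k + 1)) :
    ∃ y : Ext.{w} (Ω (n + 1)) Y k, (hS n).extClass.comp y (add_comm 1 k) = x := by
  have := hP n
  exact Ext.contravariant_sequence_exact₃ (hS n) Y x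
    (Ext.eq_zero_of_projective ((Ext.mk₀ (π n)).comp x (zero_add _))) (add_comm 1 k)

theorem cls_succ_comp (n k : ℕ) (x : Ext.{w} (Ω (n + 1)) Y k) {j : ℕ} (hj : n + 1 + k = j) :
    (cls hS s (n + 1)).comp x hj =
      (cls hS s n).comp ((hS n).extClass.comp x (add_comm 1 k)) (by omega) :=
  Ext.comp_assoc _ _ _ _ _ (by omega)

theorem cls_comp_injective [IsIso s] (hP : ∀ n, Projective (P n))
    (hY : ∀ n (φ : P n ⟶ Y), i n ≫ φ = 0) (n k j : ℕ) (hj : n + k = j) (x : Ext.{w} (Ω n) Y k)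
    (hx : (cls hS s n).comp x hj = 0) : x = 0 := by
  induction n generalizing k j with
  | zero =>
    have h := congrArg (fun z => (Ext.mk₀ (inv s)).comp z (zero_add j)) hx
    simp only [cls, Ext.comp_zero] at h
    obtain rfl : k = j := by omega
    simpa using h
  | succ n ih =>
    rw [cls_succ_comp] at hx
    exact extClass_comp_injective hS hP hY n k x (ih _ _ _ _ hx)

theorem cls_comp_surjective [IsIso s] (hP : ∀ n, Projective (P n)) (n k j : ℕ) (hj : n + k = j)
    (x : Ext.{w} X Y j) : ∃ y : Ext.{w} (Ω n) Y k, (cls hS s n).comp y hj = x := by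
  induction n generalizing k j with
  | zero =>
    obtain rfl : k = j := by omega
    refine ⟨(Ext.mk₀ (inv s)).comp x (zero_add k), ?_⟩
    simp [cls]
  | succ n ih =>
    obtain ⟨y, rfl⟩ := ih (k + 1) j (by omega) x
    obtain ⟨z, rfl⟩ := extClass_comp_surjective hS hP n k y
    exact ⟨z, cls_succ_comp ..⟩

theorem toExt_injective [IsIso s] (hP : ∀ n, Projective (P n))
    (hY : ∀ n (φ : P n ⟶ Y), i n ≫ φ = 0) (n : ℕ) (f : Ω n ⟶ Y) (hf : toExt hS s n f = 0) :
    f = 0 := by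
  have h := cls_comp_injective hS s hP hY n 0 n (add_zero n) (Ext.mk₀ f) hf
  rwa [← Ext.mk₀_zero, Ext.mk₀_bijective _ _ |>.1.eq_iff] at h

theorem toExt_surjective [IsIso s] (hP : ∀ n, Projective (P n)) (n : ℕ) (x : Ext.{w} X Y n) :
    ∃ f, toExt hS s n f = x := by
  obtain ⟨y, rfl⟩ := cls_comp_surjective hS s hP n 0 n (add_zero n) x
  obtain ⟨f, rfl⟩ := (Ext.mk₀_bijective _ _).2 y
  exact ⟨f, rfl⟩

theorem toExt_comp_toExt_zero (n : ℕ) (f : Ω n ⟶ X) (g : Ω 0 ⟶ Y) :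
    (toExt hS s n f).comp (toExt hS s 0 g) (add_zero n) = toExt hS s n (f ≫ s ≫ g) := by
  simp [toExt, cls]

theorem toExt_comp_toExt_one (n : ℕ) (f : Ω n ⟶ X) (g : Ω 1 ⟶ Y) (φ : P n ⟶ P 0)
    (ψ : Ω (n + 1) ⟶ Ω 1) (h1 : ψ ≫ i 0 = i n ≫ φ) (h2 : φ ≫ π 0 = π n ≫ f ≫ s) :
    (toExt hS s n f).comp (toExt hS s 1 g) rfl = toExt hS s (n + 1) (ψ ≫ g) := by
  have h := ShortComplex.ShortExact.extClass_naturality (hS n) (hS 0)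
    { τ₁ := ψ, τ₂ := φ, τ₃ := f ≫ s, comm₁₂ := h1, comm₂₃ := h2 }
  dsimp only at h
  have h3 : (Ext.mk₀ f).comp (toExt hS s 1 g) (zero_add 1) =
      (hS n).extClass.comp (Ext.mk₀ (ψ ≫ g)) (add_zero 1) := by
    rw [← Ext.mk₀_comp_mk₀, ← Ext.comp_assoc _ _ _ (add_zero 1) (add_zero 0) (by omega), h]
    simp only [toExt, cls]
    rw [← Ext.comp_assoc _ _ _ (zero_add 1) (add_zero 1) (by omega),
      ← Ext.comp_assoc _ _ _ (zero_add 0) (zero_add 1) (by omega), Ext.mk₀_comp_mk₀]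
  change ((cls hS s n).comp (Ext.mk₀ f) (add_zero n)).comp (toExt hS s 1 g) rfl =
    ((cls hS s n).comp (hS n).extClass rfl).comp (Ext.mk₀ (ψ ≫ g)) (add_zero (n + 1))
  rw [Ext.comp_assoc _ _ _ (add_zero n) (zero_add 1) (by omega), h3,
    Ext.comp_assoc _ _ _ rfl (add_zero 1) (by omega)]

end Syzygy

/-! ### The Koszul resolution of a quantum exterior algebra -/

/-- The relations of a quantum exterior algebra in two variables. -/
structure SkewRep.ExteriorRel {K R : Type*} [Field K] [CommRing R] [Algebra K R] {sh : R ≃ₐ[K] R}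
    {Γ : Type*} [Ring Γ] [Algebra K Γ] (ρ : SkewRep sh Γ) (θ : Rˣ) : Prop where
  X_X : ρ.X * ρ.X = 0
  Y_Y : ρ.Y * ρ.Y = 0
  Y_X : ρ.Y * ρ.X = ρ.ι θ * (ρ.X * ρ.Y)

/-- The relations and the basis of a quantum exterior algebra in two variables. -/
structure SkewRep.IsExterior {K R : Type*} [Field K] [CommRing R] [Algebra K R] {sh : R ≃ₐ[K] R}
    {Γ : Type*} [Ring Γ] [Algebra K Γ] (ρ : SkewRep sh Γ) (θ : Rˣ) (aug : Γ →ₐ[K] R) : Prop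
    extends ρ.ExteriorRel θ where
  exists_coord : ∀ x, ∃ p q r z, x = ρ.ι p + ρ.ι q * ρ.X + ρ.ι r * ρ.Y + ρ.ι z * (ρ.X * ρ.Y)
  coord_unique : ∀ p q r z, ρ.ι p + ρ.ι q * ρ.X + ρ.ι r * ρ.Y + ρ.ι z * (ρ.X * ρ.Y) = 0 →
    p = 0 ∧ q = 0 ∧ r = 0 ∧ z = 0
  aug_ι : ∀ c, aug (ρ.ι c) = c
  aug_X : aug ρ.X = 0
  aug_Y : aug ρ.Y = 0

namespace SkewRep

variable {K R : Type*} [Field K] [CommRing R] [Algebra K R] {sh : R ≃ₐ[K] R}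
  {Γ : Type*} [Ring Γ] [Algebra K Γ] (ρ : SkewRep sh Γ)

/-- The element with the given coordinates. -/
def nf (p q r z : R) : Γ := ρ.ι p + ρ.ι q * ρ.X + ρ.ι r * ρ.Y + ρ.ι z * (ρ.X * ρ.Y)

theorem nf_add (p q r z p' q' r' z' : R) :
    ρ.nf p q r z + ρ.nf p' q' r' z' = ρ.nf (p + p') (q + q') (r + r') (z + z') := by
  simp only [nf, map_add, add_mul]
  abel

theorem nf_mul_ι (p q r z c : R) :
    ρ.nf p q r z * ρ.ι c = ρ.nf (p * c) (q * sh c) (r * sh.symm c) (z * c) := by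
  simp only [nf, add_mul, mul_assoc, ρ.X_mul_ι, ρ.Y_mul_ι, map_mul]
  rw [← mul_assoc ρ.X, ρ.X_mul_ι, AlgEquiv.apply_symm_apply, mul_assoc]

/-- The coefficients `g 0, g 1, …` that make the Koszul complex a complex. -/
def twist (sh : R ≃ₐ[K] R) (θ : Rˣ) : ℕ → R
  | 0 => 1
  | n + 1 => -(↑θ⁻¹ * sh (twist sh θ n))

theorem isUnit_twist (θ : Rˣ) (n : ℕ) : IsUnit (twist sh θ n) := by
  induction n with
  | zero => exact isUnit_one
  | succ n ih => exact (θ⁻¹.isUnit.mul (ih.map sh)).neg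

/-- The differential of the Koszul complex. -/
def koszulDiff (θ : Rˣ) (n : ℕ) : (Fin (n + 2) → Γ) →ₗ[Γ] (Fin (n + 1) → Γ) where
  toFun v t := v t.castSucc * (ρ.ι (twist sh θ t) * ρ.Y) + v t.succ * ρ.X
  map_add' v w := by
    funext t
    simp only [Pi.add_apply, add_mul]
    abel
  map_smul' c v := by
    funext t
    simp only [Pi.smul_apply, smul_eq_mul, mul_add, mul_assoc, RingHom.id_apply]

theorem koszulDiff_apply (θ : Rˣ) (n : ℕ) (v : Fin (n + 2) → Γ) (t : Fin (n + 1)) :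
    ρ.koszulDiff θ n v t = v t.castSucc * (ρ.ι (twist sh θ t) * ρ.Y) + v t.succ * ρ.X :=
  rfl

namespace ExteriorRel

variable {ρ} {θ : Rˣ} (h : ρ.ExteriorRel θ)

include h

theorem nf_mul_X (p q r z : R) : ρ.nf p q r z * ρ.X = ρ.nf 0 p 0 (r * θ) := by
  have h1 : ρ.X * (ρ.ι θ * (ρ.X * ρ.Y)) = 0 := by
    rw [← mul_assoc, ρ.X_mul_ι, mul_assoc, ← mul_assoc ρ.X, h.X_X, zero_mul, mul_zero]
  simp only [nf, add_mul, mul_assoc, h.X_X, h.Y_X, map_zero, zero_mul, mul_zero, add_zero,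
    zero_add, map_mul, h1]

theorem nf_mul_ι_Y (p q r z c : R) :
    ρ.nf p q r z * (ρ.ι c * ρ.Y) = ρ.nf 0 0 (p * c) (q * sh c) := by
  have h1 : ρ.Y * (ρ.ι c * ρ.Y) = 0 := by
    rw [← mul_assoc, ρ.Y_mul_ι, mul_assoc, h.Y_Y, mul_zero]
  have h2 : ρ.X * (ρ.ι c * ρ.Y) = ρ.ι (sh c) * (ρ.X * ρ.Y) := by
    rw [← mul_assoc, ρ.X_mul_ι, mul_assoc]
  simp only [nf, add_mul, mul_assoc, h1, h2, map_zero, zero_mul, mul_zero, add_zero, zero_add,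
    map_mul]

theorem nf_zero_mul_nf_zero (q r z q' r' z' : R) :
    ρ.nf 0 q' r' z' * ρ.nf 0 q r z = ρ.nf 0 0 0 (r' * sh.symm q * θ + q' * sh r) := by
  have h1 : ρ.nf 0 q' r' z' * (ρ.ι q * ρ.X) = ρ.nf 0 0 0 (r' * sh.symm q * θ) := by
    rw [← mul_assoc, nf_mul_ι, h.nf_mul_X, zero_mul]
  have h2 : ρ.nf 0 q' r' z' * (ρ.ι z * (ρ.X * ρ.Y)) = 0 := by
    rw [← mul_assoc, ← mul_assoc, nf_mul_ι, h.nf_mul_X, zero_mul,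
      ← one_mul ρ.Y, ← map_one ρ.ι, h.nf_mul_ι_Y]
    simp [nf]
  have h3 : ρ.nf 0 q r z = ρ.ι q * ρ.X + ρ.ι r * ρ.Y + ρ.ι z * (ρ.X * ρ.Y) := by
    rw [nf, map_zero, zero_add]
  rw [h3, mul_add, mul_add, h1, h2, h.nf_mul_ι_Y, nf_add]
  simp

end ExteriorRel

namespace IsExterior

variable {ρ} {θ : Rˣ} {aug : Γ →ₐ[K] R} (h : ρ.IsExterior θ aug)

include h

theorem nf_inj {p q r z p' q' r' z' : R} (e : ρ.nf p q r z = ρ.nf p' q' r' z') :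
    p = p' ∧ q = q' ∧ r = r' ∧ z = z' := by
  have := h.coord_unique (p - p') (q - q') (r - r') (z - z') (by
    rw [← sub_eq_zero] at e
    rw [← e]
    simp only [nf, map_sub, sub_mul]
    abel)
  simpa only [sub_eq_zero] using this

theorem aug_nf (p q r z : R) : aug (ρ.nf p q r z) = p := by
  simp [nf, h.aug_ι, h.aug_X, h.aug_Y]

theorem exists_nf (x : Γ) : ∃ p q r z, x = ρ.nf p q r z := h.exists_coord x

theorem koszulDiff_nf (n : ℕ) (p q r z : Fin (n + 2) → R) (t : Fin (n + 1)) :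
    ρ.koszulDiff θ n (fun t => ρ.nf (p t) (q t) (r t) (z t)) t =
      ρ.nf 0 (p t.succ) (p t.castSucc * twist sh θ t)
        (q t.castSucc * sh (twist sh θ t) + r t.succ * θ) := by
  rw [koszulDiff_apply, h.nf_mul_X, h.nf_mul_ι_Y, nf_add]
  simp

theorem exists_nf_fun {n : ℕ} (v : Fin n → Γ) :
    ∃ p q r z : Fin n → R, v = fun t => ρ.nf (p t) (q t) (r t) (z t) := by
  choose p q r z hv using fun t => h.exists_nf (v t)
  exact ⟨p, q, r, z, funext hv⟩

theorem koszulDiff_koszulDiff (n : ℕ) (v : Fin (n + 3) → Γ) :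
    ρ.koszulDiff θ n (ρ.koszulDiff θ (n + 1) v) = 0 := by
  obtain ⟨p, q, r, z, rfl⟩ := h.exists_nf_fun v
  funext t
  rw [funext (h.koszulDiff_nf (n + 1) p q r z), h.koszulDiff_nf]
  simp only [Fin.val_succ, twist, Fin.succ_castSucc]
  have : p t.succ.castSucc * sh (twist sh θ t) +
      p t.succ.castSucc * -(↑θ⁻¹ * sh (twist sh θ t)) * θ = 0 := by
    have h1 : (↑θ⁻¹ * θ : R) = 1 := θ.inv_mul
    linear_combination (-(p t.succ.castSucc * sh (twist sh θ t))) * h1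
  rw [this]
  simp [nf]

theorem koszulDiff_exact (n : ℕ) (v : Fin (n + 2) → Γ) (hv : ρ.koszulDiff θ n v = 0) :
    ∃ w, ρ.koszulDiff θ (n + 1) w = v := by
  obtain ⟨p, q, r, z, rfl⟩ := h.exists_nf_fun v
  have h0 : ∀ t : Fin (n + 1), p t.succ = 0 ∧ p t.castSucc * twist sh θ t = 0 ∧
      q t.castSucc * sh (twist sh θ t) + r t.succ * θ = 0 := by
    intro t
    have := congrFun hv t
    rw [h.koszulDiff_nf] at this
    have h0 : (0 : Γ) = ρ.nf 0 0 0 0 := by simp [nf]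
    exact (h.nf_inj (this.trans h0)).2
  have hp : p = 0 := by
    funext t
    refine Fin.cases ?_ (fun t => (h0 t).1) t
    exact ((isUnit_twist θ (0 : Fin (n + 1))).mul_left_eq_zero).1 (h0 0).2.1
  refine ⟨fun t => ρ.nf (Fin.cons (α := fun _ => R) (r 0) q t) ((fun _ => 0 : Fin (n + 3) → R) t)
    (Fin.cons (α := fun _ => R) 0 (fun t => z t * ↑θ⁻¹) t) ((fun _ => 0 : Fin (n + 3) → R) t), ?_⟩
  funext t
  rw [h.koszulDiff_nf]
  congr 1
  · simp [hp]
  · refine Fin.cases ?_ (fun t => ?_) t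
    · simp [twist]
    · rw [Fin.castSucc_succ, Fin.cons_succ, Fin.val_succ, twist]
      have h1 := (h0 t).2.2
      have h2 : (↑θ⁻¹ * θ : R) = 1 := θ.inv_mul
      linear_combination (-(↑θ⁻¹ : R)) * h1 + r t.succ * h2
  · simp [mul_assoc]

theorem mem_range_koszulDiff_zero (v : Fin 1 → Γ) :
    v ∈ LinearMap.range (ρ.koszulDiff θ 0) ↔ aug (v 0) = 0 := by
  constructor
  · rintro ⟨w, rfl⟩
    rw [koszulDiff_apply, map_add, map_mul, map_mul, map_mul, h.aug_X, h.aug_Y, mul_zero,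
      mul_zero, mul_zero, add_zero]
  · intro hv
    obtain ⟨p, q, r, z, hpq⟩ := h.exists_nf (v 0)
    rw [hpq, h.aug_nf] at hv
    refine ⟨fun t => ρ.nf (![r, q] t) ((fun _ => 0 : Fin 2 → R) t) (![0, z * ↑θ⁻¹] t)
      ((fun _ => 0 : Fin 2 → R) t), ?_⟩
    funext t
    obtain rfl : t = 0 := Subsingleton.elim (α := Fin 1) _ _
    rw [h.koszulDiff_nf, hpq, hv]
    simp [twist, mul_assoc]

theorem aug_eq_zero_iff_mem_jacobson (hR : Ring.jacobson R = ⊥) (x : Γ) :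
    x ∈ Ring.jacobson Γ ↔ aug x = 0 := by
  constructor
  · intro hx
    have hs : Function.Surjective aug := fun c => ⟨ρ.ι c, h.aug_ι c⟩
    have : RingHomSurjective aug.toRingHom := ⟨hs⟩
    have h1 := Ring.le_comap_jacobson aug.toRingHom hx
    rw [hR] at h1
    exact h1
  · intro hx
    rw [← Ideal.jacobson_bot, Ideal.mem_jacobson_iff]
    intro y
    obtain ⟨p, q, r, z, hyx⟩ := h.exists_nf (y * x)
    have hp : p = 0 := by
      rw [← h.aug_nf p q r z, ← hyx, map_mul, hx, mul_zero]
    subst hp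
    have h2 : y * x * (y * x) * (y * x) = 0 := by
      rw [hyx, h.nf_zero_mul_nf_zero, h.nf_zero_mul_nf_zero]
      simp [nf]
    refine ⟨1 - y * x + y * x * (y * x), ?_⟩
    rw [Ideal.mem_bot, mul_assoc _ y x, add_mul, sub_mul, one_mul, h2]
    abel

end IsExterior

end SkewRep

namespace SkewRep

universe u

variable {K R : Type*} {Γ : Type u} [Field K] [CommRing R] [Algebra K R] {sh : R ≃ₐ[K] R}
  [Ring Γ] [Algebra K Γ] (ρ : SkewRep sh Γ) (θ : Rˣ)

/-- The syzygies of the semisimple quotient, as cokernels of the Koszul differentials. -/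
abbrev syz (n : ℕ) : ModuleCat.{u} Γ :=
  ModuleCat.of Γ ((Fin (n + 1) → Γ) ⧸ LinearMap.range (ρ.koszulDiff θ n))

variable {ρ θ} in
theorem syz_hom_ext {n : ℕ} {M : ModuleCat.{u} Γ} {f g : ρ.syz θ n ⟶ M}
    (hfg : ∀ v : Fin (n + 1) → Γ, f.hom (Submodule.Quotient.mk v) =
      g.hom (Submodule.Quotient.mk v)) : f = g := by
  refine ModuleCat.hom_ext (LinearMap.ext fun x => ?_)
  obtain ⟨v, rfl⟩ := Submodule.Quotient.mk_surjective _ x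
  exact hfg v

/-- The terms of the Koszul resolution. -/
abbrev kos (Γ : Type u) [Ring Γ] (n : ℕ) : ModuleCat.{u} Γ := ModuleCat.of Γ (Fin (n + 1) → Γ)

/-- The projection of a term of the Koszul resolution onto a syzygy. -/
def syzProj (n : ℕ) : kos Γ n ⟶ ρ.syz θ n :=
  ModuleCat.ofHom (Submodule.mkQ _)

instance kos_projective (n : ℕ) : Projective (kos Γ n) :=
  inferInstance

namespace IsExterior

variable {ρ} {θ} {aug : Γ →ₐ[K] R} (h : ρ.IsExterior θ aug)

/-- The inclusion of a syzygy into a term of the Koszul resolution. -/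
def syzIncl (n : ℕ) : ρ.syz θ (n + 1) ⟶ kos Γ n :=
  ModuleCat.ofHom (Submodule.liftQ _ (ρ.koszulDiff θ n) (by
    rintro _ ⟨w, rfl⟩
    exact h.koszulDiff_koszulDiff n w))

theorem syzIncl_syzProj (n : ℕ) : h.syzIncl n ≫ ρ.syzProj θ n = 0 := by
  refine syz_hom_ext fun v => ?_
  exact (Submodule.Quotient.mk_eq_zero _).2 ⟨v, rfl⟩

theorem syz_shortExact (n : ℕ) :
    (ShortComplex.mk (h.syzIncl n) (ρ.syzProj θ n) (h.syzIncl_syzProj n)).ShortExact := by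
  refine ModuleCat.shortComplex_shortExact _ ?_ ?_ ?_
  · intro x
    constructor
    · intro hx
      obtain ⟨v, rfl⟩ := (Submodule.Quotient.mk_eq_zero _).1 hx
      exact ⟨Submodule.Quotient.mk v, rfl⟩
    · rintro ⟨y, rfl⟩
      obtain ⟨v, rfl⟩ := Submodule.Quotient.mk_surjective _ y
      exact (Submodule.Quotient.mk_eq_zero _).2 ⟨v, rfl⟩
  · refine (injective_iff_map_eq_zero _).2 fun x hx => ?_
    obtain ⟨v, rfl⟩ := Submodule.Quotient.mk_surjective _ x
    obtain ⟨w, rfl⟩ := h.koszulDiff_exact n v hx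
    exact (Submodule.Quotient.mk_eq_zero _).2 ⟨w, rfl⟩
  · exact Submodule.Quotient.mk_surjective _

end IsExterior

variable (Γ) in
/-- The semisimple quotient. -/
abbrev top : ModuleCat.{u} Γ := ModuleCat.of Γ (Γ ⧸ Ring.jacobson Γ)

/-- The morphism to the semisimple quotient given by a family of coefficients, before passing to
the syzygy. -/
def preForm (n : ℕ) (c : Fin (n + 1) → R) : (Fin (n + 1) → Γ) →ₗ[Γ] Γ :=
  Fintype.linearCombination Γ fun t => ρ.ι (c t)

theorem preForm_apply (n : ℕ) (c : Fin (n + 1) → R) (v : Fin (n + 1) → Γ) :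
    ρ.preForm n c v = ∑ t, v t * ρ.ι (c t) := rfl

namespace IsExterior

variable {ρ} {θ} {aug : Γ →ₐ[K] R} (h : ρ.IsExterior θ aug)
  (hJ : ∀ x, x ∈ Ring.jacobson Γ ↔ aug x = 0)

/-- The morphism from a syzygy to the semisimple quotient given by a family of coefficients. -/
def form (n : ℕ) (c : Fin (n + 1) → R) : ρ.syz θ n ⟶ top Γ :=
  ModuleCat.ofHom (Submodule.liftQ _ ((Submodule.mkQ (Ring.jacobson Γ)) ∘ₗ ρ.preForm n c) (by
    rintro _ ⟨w, rfl⟩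
    refine (Submodule.Quotient.mk_eq_zero _).2 ((hJ _).2 ?_)
    rw [preForm_apply, map_sum]
    refine Finset.sum_eq_zero fun t _ => ?_
    rw [koszulDiff_apply, map_mul, map_add, map_mul, map_mul, map_mul, h.aug_X, h.aug_Y,
      mul_zero, mul_zero, mul_zero, add_zero, zero_mul]))

theorem form_mk (n : ℕ) (c : Fin (n + 1) → R) (v : Fin (n + 1) → Γ) :
    (h.form hJ n c).hom (Submodule.Quotient.mk v) =
      Submodule.Quotient.mk (∑ t, v t * ρ.ι (c t)) := rfl

theorem form_add (n : ℕ) (c d : Fin (n + 1) → R) :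
    h.form hJ n (c + d) = h.form hJ n c + h.form hJ n d := by
  refine syz_hom_ext fun v => ?_
  change (Submodule.Quotient.mk (∑ t, v t * ρ.ι ((c + d) t)) : Γ ⧸ Ring.jacobson Γ) =
    Submodule.Quotient.mk (∑ t, v t * ρ.ι (c t)) + Submodule.Quotient.mk (∑ t, v t * ρ.ι (d t))
  simp only [← Submodule.Quotient.mk_add, Pi.add_apply, map_add, mul_add,
    Finset.sum_add_distrib]

include h hJ in
theorem mk_eq_mk_ι_aug (x : Γ) :
    (Submodule.Quotient.mk x : Γ ⧸ Ring.jacobson Γ) = Submodule.Quotient.mk (ρ.ι (aug x)) := by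
  rw [Submodule.Quotient.eq, hJ, map_sub, h.aug_ι, sub_self]

theorem form_surjective (n : ℕ) (f : ρ.syz θ n ⟶ top Γ) : ∃ c, h.form hJ n c = f := by
  have hx : ∀ t : Fin (n + 1), ∃ c : R,
      f.hom (Submodule.Quotient.mk (Pi.single t 1)) = Submodule.Quotient.mk (ρ.ι c) := by
    intro t
    obtain ⟨x, hx⟩ := Submodule.Quotient.mk_surjective _
      (f.hom (Submodule.Quotient.mk (Pi.single t 1)))
    exact ⟨aug x, hx.symm.trans (h.mk_eq_mk_ι_aug hJ x)⟩
  choose c hc using hx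
  refine ⟨c, syz_hom_ext fun v => ?_⟩
  have hv : v = ∑ t, v t • (Pi.single t 1 : Fin (n + 1) → Γ) := by
    simp only [← Pi.single_smul, smul_eq_mul, mul_one, Finset.univ_sum_single]
  have h2 : (Submodule.Quotient.mk v : (Fin (n + 1) → Γ) ⧸ LinearMap.range (ρ.koszulDiff θ n)) =
      ∑ t, v t • Submodule.Quotient.mk (Pi.single t 1) := by
    conv_lhs => rw [hv]
    exact map_sum (Submodule.mkQ _) _ _
  rw [form_mk, h2, map_sum]
  refine (map_sum (Submodule.mkQ (Ring.jacobson Γ)) _ _).trans ?_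
  refine Finset.sum_congr rfl fun t _ => ?_
  rw [map_smul, hc]
  rfl

theorem form_injective (n : ℕ) (c : Fin (n + 1) → R) (hc : h.form hJ n c = 0) : c = 0 := by
  funext t
  have h1 : (h.form hJ n c).hom (Submodule.Quotient.mk (Pi.single t 1)) = 0 := by
    rw [hc]
    rfl
  rw [form_mk] at h1
  have h2 := (hJ _).1 ((Submodule.Quotient.mk_eq_zero _).1 h1)
  simpa [Pi.single_apply, h.aug_ι] using h2

/-- The semisimple quotient is the zeroth syzygy. -/
def topIso : top Γ ≅ ρ.syz θ 0 :=
  (Submodule.Quotient.equiv (Ring.jacobson Γ) (LinearMap.range (ρ.koszulDiff θ 0))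
    (LinearEquiv.funUnique (Fin 1) Γ Γ).symm (by
      ext v
      rw [h.mem_range_koszulDiff_zero]
      constructor
      · rintro ⟨x, hx, rfl⟩
        exact (hJ x).1 hx
      · intro hv
        refine ⟨v 0, (hJ _).2 hv, ?_⟩
        funext t
        exact congrArg v (Subsingleton.elim (α := Fin 1) _ _))).toModuleIso

theorem topIso_mk (x : Γ) :
    (h.topIso hJ).hom.hom (Submodule.Quotient.mk x) = Submodule.Quotient.mk fun _ => x := rfl

include hJ in
theorem syzIncl_comp (n : ℕ) (φ : kos Γ n ⟶ top Γ) : h.syzIncl n ≫ φ = 0 := by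
  refine syz_hom_ext fun v => ?_
  change φ.hom (ρ.koszulDiff θ n v) = 0
  have hv : ρ.koszulDiff θ n v = ∑ t, ρ.koszulDiff θ n v t • (Pi.single t 1 : Fin (n + 1) → Γ) := by
    simp only [← Pi.single_smul, smul_eq_mul, mul_one, Finset.univ_sum_single]
  rw [hv, map_sum]
  refine Finset.sum_eq_zero fun t _ => ?_
  rw [map_smul]
  obtain ⟨x, hx⟩ := Submodule.Quotient.mk_surjective _ (φ.hom (Pi.single t 1 : Fin (n + 1) → Γ))
  rw [← hx]
  refine (Submodule.Quotient.mk_eq_zero _).2 ((hJ _).2 ?_)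
  change aug (ρ.koszulDiff θ n v t * x) = 0
  rw [koszulDiff_apply, map_mul, map_add, map_mul, map_mul, map_mul, h.aug_X,
    h.aug_Y, mul_zero, mul_zero, mul_zero, add_zero, zero_mul]

/-- The class in `Ext^n` given by a family of coefficients. -/
def extOf (n : ℕ) (c : Fin (n + 1) → R) : Abelian.Ext.{u} (top Γ) (top Γ) n :=
  Syzygy.toExt h.syz_shortExact (h.topIso hJ).hom n (h.form hJ n c)

theorem extOf_add (n : ℕ) (c d : Fin (n + 1) → R) :
    h.extOf hJ n (c + d) = h.extOf hJ n c + h.extOf hJ n d := by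
  rw [extOf, form_add, Syzygy.toExt_add]
  rfl

theorem extOf_smul (n : ℕ) (r : K) (c : Fin (n + 1) → R) :
    h.extOf hJ n (r • c) = r • h.extOf hJ n c := by
  refine (congrArg (Syzygy.toExt h.syz_shortExact (h.topIso hJ).hom n) ?_).trans
    (Syzygy.toExt_smul h.syz_shortExact (h.topIso hJ).hom n r (h.form hJ n c))
  refine syz_hom_ext fun v => ?_
  change (Submodule.Quotient.mk (∑ t, v t * ρ.ι ((r • c) t)) : Γ ⧸ Ring.jacobson Γ) =
    algebraMap K Γ r • Submodule.Quotient.mk (∑ t, v t * ρ.ι (c t))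
  simp only [← Submodule.Quotient.mk_smul, Pi.smul_apply, map_smul, mul_smul_comm,
    ← Finset.smul_sum, smul_eq_mul]
  rw [Algebra.smul_def]

theorem extOf_injective (n : ℕ) (c : Fin (n + 1) → R) (hc : h.extOf hJ n c = 0) : c = 0 :=
  h.form_injective hJ n c (Syzygy.toExt_injective h.syz_shortExact _ kos_projective
    (h.syzIncl_comp hJ) n _ hc)

theorem extOf_surjective (n : ℕ) (x : Abelian.Ext.{u} (top Γ) (top Γ) n) :
    ∃ c, h.extOf hJ n c = x := by
  obtain ⟨f, rfl⟩ := Syzygy.toExt_surjective h.syz_shortExact (h.topIso hJ).hom kos_projective n x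
  obtain ⟨c, rfl⟩ := h.form_surjective hJ n f
  exact ⟨c, rfl⟩

theorem extOf_zero_one : h.extOf hJ 0 1 = Abelian.Ext.mk₀ (𝟙 _) := by
  rw [extOf, Syzygy.toExt, Syzygy.cls, Abelian.Ext.mk₀_comp_mk₀]
  congr 1
  refine ModuleCat.hom_ext (LinearMap.ext fun x => ?_)
  obtain ⟨x, rfl⟩ := Submodule.Quotient.mk_surjective _ x
  change (h.form hJ 0 1).hom ((h.topIso hJ).hom.hom (Submodule.Quotient.mk x)) = _
  rw [topIso_mk, form_mk]
  simp

theorem extOf_comp_extOf_zero (n : ℕ) (c : Fin (n + 1) → R) (d : Fin 1 → R) :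
    (h.extOf hJ n c).comp (h.extOf hJ 0 d) (add_zero n) =
      h.extOf hJ n fun t => c t * d 0 := by
  rw [extOf, extOf, Syzygy.toExt_comp_toExt_zero, extOf]
  congr 1
  refine syz_hom_ext fun v => ?_
  change (h.form hJ 0 d).hom ((h.topIso hJ).hom.hom ((h.form hJ n c).hom
    (Submodule.Quotient.mk v))) = _
  rw [form_mk, topIso_mk, form_mk, form_mk]
  simp [Finset.sum_mul, mul_assoc]

/-- The coefficients of a lift of a morphism from a syzygy to the next syzygy. -/
def shiftCoeff (sh : R ≃ₐ[K] R) (θ : Rˣ) (n : ℕ) (c : Fin (n + 1) → R) :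
    Fin 2 → Fin (n + 2) → R :=
  ![Fin.snoc (α := fun _ => R) (fun t => twist sh θ t * sh.symm (c t)) 0,
    Fin.cons (α := fun _ => R) 0 fun t => sh (c t)]

variable (ρ θ) in
/-- A lift of a morphism from a syzygy to the next syzygy. -/
def shiftPre (n : ℕ) (c : Fin (n + 1) → R) : (Fin (n + 2) → Γ) →ₗ[Γ] (Fin 2 → Γ) :=
  LinearMap.pi fun j => ρ.preForm (n + 1) (shiftCoeff sh θ n c j)

theorem koszulDiff_shiftPre (n : ℕ) (c : Fin (n + 1) → R) (w : Fin (n + 2) → Γ) :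
    ρ.koszulDiff θ 0 (shiftPre ρ θ n c w) = fun _ => ρ.preForm n c (ρ.koszulDiff θ n w) := by
  funext u
  obtain rfl : u = 0 := Subsingleton.elim (α := Fin 1) _ _
  rw [koszulDiff_apply, preForm_apply]
  simp only [koszulDiff_apply]
  have hY : ρ.preForm (n + 1) (shiftCoeff sh θ n c 0) w =
      ∑ t : Fin (n + 1), w t.castSucc * ρ.ι (twist sh θ t * sh.symm (c t)) := by
    rw [preForm_apply, Fin.sum_univ_castSucc]
    simp [shiftCoeff]
  have hX : ρ.preForm (n + 1) (shiftCoeff sh θ n c 1) w =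
      ∑ t : Fin (n + 1), w t.succ * ρ.ι (sh (c t)) := by
    rw [preForm_apply, Fin.sum_univ_succ]
    simp [shiftCoeff]
  change ρ.preForm (n + 1) (shiftCoeff sh θ n c 0) w * (ρ.ι 1 * ρ.Y) +
    ρ.preForm (n + 1) (shiftCoeff sh θ n c 1) w * ρ.X = _
  rw [hX, hY]
  simp only [map_one, one_mul, Finset.sum_mul, add_mul, Finset.sum_add_distrib, mul_assoc, X_mul_ι,
    Y_mul_ι, map_mul]

/-- The induced morphism from a syzygy to the first syzygy. -/
def shiftHom (n : ℕ) (c : Fin (n + 1) → R) : ρ.syz θ (n + 1) ⟶ ρ.syz θ 1 :=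
  ModuleCat.ofHom (Submodule.mapQ _ _ (shiftPre ρ θ n c) (by
    rintro _ ⟨w, rfl⟩
    refine h.koszulDiff_exact 0 _ ?_
    rw [koszulDiff_shiftPre, h.koszulDiff_koszulDiff, map_zero]
    rfl))

theorem extOf_comp_extOf_one (n : ℕ) (c : Fin (n + 1) → R) (d : Fin 2 → R) :
    (h.extOf hJ n c).comp (h.extOf hJ 1 d) rfl =
      h.extOf hJ (n + 1) fun u => ∑ j, shiftCoeff sh θ n c j u * d j := by
  refine (Syzygy.toExt_comp_toExt_one h.syz_shortExact (h.topIso hJ).hom n (h.form hJ n c)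
    (h.form hJ 1 d) (ModuleCat.ofHom (LinearMap.pi fun _ => ρ.preForm n c))
    (h.shiftHom n c) ?_ ?_).trans ?_
  · exact syz_hom_ext fun w => koszulDiff_shiftPre n c w
  · refine ModuleCat.hom_ext (LinearMap.ext fun v => rfl)
  · rw [extOf]
    congr 1
    refine syz_hom_ext fun w => ?_
    change (Submodule.Quotient.mk (∑ j, ρ.preForm (n + 1) (shiftCoeff sh θ n c j) w * ρ.ι (d j)) :
      Γ ⧸ Ring.jacobson Γ) = Submodule.Quotient.mk (∑ u, w u * ρ.ι _)
    simp only [preForm_apply, map_sum, map_mul, Finset.mul_sum, Finset.sum_mul, mul_assoc]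
    rw [Finset.sum_comm]

end IsExterior

end SkewRep

namespace SkewRep

section Powers

variable {K R : Type*} [Field K] [CommRing R] [Algebra K R] {sh : R ≃ₐ[K] R}
  {T : Type*} [Ring T] [Algebra K T] (ρ : SkewRep sh T)

theorem X_pow_mul_ι (n : ℕ) (c : R) : ρ.X ^ n * ρ.ι c = ρ.ι ((sh ^ n) c) * ρ.X ^ n := by
  induction n generalizing c with
  | zero => simp
  | succ n ih => rw [pow_succ, mul_assoc, X_mul_ι, ← mul_assoc, ih, mul_assoc, pow_succ]; rfl

theorem Y_pow_mul_ι (n : ℕ) (c : R) : ρ.Y ^ n * ρ.ι c = ρ.ι ((sh.symm ^ n) c) * ρ.Y ^ n := by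
  induction n generalizing c with
  | zero => simp
  | succ n ih => rw [pow_succ, mul_assoc, Y_mul_ι, ← mul_assoc, ih, mul_assoc, pow_succ]; rfl

/-- The automorphism of the coefficients given by a monomial. -/
def monShift (sh : R ≃ₐ[K] R) (p : ℕ × ℕ) : R ≃ₐ[K] R := sh ^ p.1 * sh.symm ^ p.2

/-- The monomials `X ^ s * Y ^ t`. -/
def mon (p : ℕ × ℕ) : T := ρ.X ^ p.1 * ρ.Y ^ p.2

theorem mon_mul_ι (p : ℕ × ℕ) (c : R) : ρ.mon p * ρ.ι c = ρ.ι (monShift sh p c) * ρ.mon p := by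
  rw [mon, mul_assoc, Y_pow_mul_ι, ← mul_assoc, X_pow_mul_ι, mul_assoc]
  rfl

theorem ι_mul_mon (p : ℕ × ℕ) (c : R) :
    ρ.ι c * ρ.mon p = ρ.mon p * ρ.ι ((monShift sh p).symm c) := by
  rw [mon_mul_ι, AlgEquiv.apply_symm_apply]

/-- The linear map whose values are the noncommutative polynomials. -/
def polyMap : (ℕ × ℕ →₀ R) →ₗ[K] T :=
  Finsupp.lsum K fun p => LinearMap.mulRight K (ρ.mon p) ∘ₗ ρ.ι.toLinearMap

theorem polyMap_single (p : ℕ × ℕ) (c : R) :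
    ρ.polyMap (Finsupp.single p c) = ρ.ι c * ρ.mon p := by
  simp [polyMap]

end Powers

namespace IsExterior

universe u

variable {K R : Type*} {Γ : Type u} [Field K] [CommRing R] [Algebra K R] {sh : R ≃ₐ[K] R}
  [Ring Γ] [Algebra K Γ] {ρ : SkewRep sh Γ} {θ : Rˣ} {aug : Γ →ₐ[K] R}
  (h : ρ.IsExterior θ aug) (hJ : ∀ x, x ∈ Ring.jacobson Γ ↔ aug x = 0)

/-- The homogeneous element of the Ext algebra with the given coefficients. -/
def el (n : ℕ) (f : ℕ → R) : ExtAlgebra Γ :=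
  DirectSum.of (fun n : ℕ => Abelian.Ext.{u} (top Γ) (top Γ) n) n (h.extOf hJ n fun t => f t)

theorem el_add (n : ℕ) (f g : ℕ → R) : h.el hJ n (f + g) = h.el hJ n f + h.el hJ n g := by
  rw [el, el, el, ← map_add, ← extOf_add]
  rfl

theorem el_congr (n : ℕ) {f g : ℕ → R} (hfg : ∀ t ≤ n, f t = g t) : h.el hJ n f = h.el hJ n g := by
  rw [el, el]
  congr 2
  funext t
  exact hfg t (by omega)

theorem el_mul_el_zero (n : ℕ) (f g : ℕ → R) :
    h.el hJ n f * h.el hJ 0 g = h.el hJ n fun t => f t * g 0 := by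
  refine (DirectSum.of_mul_of _ _).trans ?_
  exact congrArg (DirectSum.of (fun n : ℕ => Abelian.Ext.{u} (top Γ) (top Γ) n) n)
    (h.extOf_comp_extOf_zero hJ n (fun t => f t) fun t => g t)

theorem el_mul_el_one (n : ℕ) (f g : ℕ → R) :
    h.el hJ n f * h.el hJ 1 g = h.el hJ (n + 1) fun t =>
      (if t = n + 1 then 0 else twist sh θ t * sh.symm (f t)) * g 0 +
        (if t = 0 then 0 else sh (f (t - 1))) * g 1 := by
  refine (DirectSum.of_mul_of _ _).trans ?_
  refine congrArg (DirectSum.of (fun n : ℕ => Abelian.Ext.{u} (top Γ) (top Γ) n) (n + 1))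
    ((h.extOf_comp_extOf_one hJ n (fun t => f t) fun t => g t).trans (congrArg _ ?_))
  funext t
  rw [Fin.sum_univ_two]
  change shiftCoeff sh θ n (fun t => f t) 0 t * g 0 + shiftCoeff sh θ n (fun t => f t) 1 t * g 1 = _
  congr 2
  · refine Fin.lastCases ?_ (fun t => ?_) t
    · simp [shiftCoeff]
    · have : (t : ℕ) ≠ n + 1 := by omega
      simp [shiftCoeff, this]
  · refine Fin.cases ?_ (fun t => ?_) t <;> simp [shiftCoeff]

theorem el_zero_one : h.el hJ 0 (fun _ => 1) = 1 := by
  change DirectSum.of (fun n : ℕ => Abelian.Ext.{u} (top Γ) (top Γ) n) 0 (h.extOf hJ 0 1) = _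
  rw [extOf_zero_one]
  rfl

theorem el_zero_algebraMap (r : K) :
    h.el hJ 0 (fun _ => algebraMap K R r) = algebraMap K (ExtAlgebra Γ) r := by
  have : (fun _ : Fin 1 => algebraMap K R r) = r • (1 : Fin 1 → R) := by
    funext t
    simp [Algebra.smul_def]
  change DirectSum.of (fun n : ℕ => Abelian.Ext.{u} (top Γ) (top Γ) n) 0
    (h.extOf hJ 0 fun _ => algebraMap K R r) = _
  rw [this, extOf_smul, extOf_zero_one]
  rfl

/-- The coefficients, inside the Ext algebra. -/
def extι : R →ₐ[K] ExtAlgebra Γ where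
  toFun c := h.el hJ 0 fun _ => c
  map_one' := h.el_zero_one hJ
  map_mul' c d := (h.el_mul_el_zero hJ 0 (fun _ => c) fun _ => d).symm
  map_zero' := by
    have := h.el_zero_algebraMap hJ 0
    rwa [map_zero, map_zero] at this
  map_add' c d := h.el_add hJ 0 (fun _ => c) fun _ => d
  commutes' r := h.el_zero_algebraMap hJ r

/-- The coefficients and the two generators of degree one of the Ext algebra. -/
def extRep : SkewRep sh (ExtAlgebra Γ) where
  ι := h.extι hJ
  X := h.el hJ 1 fun t => if t = 0 then 1 else 0
  Y := h.el hJ 1 fun t => if t = 1 then 1 else 0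
  X_mul_ι c := by
    change h.el hJ 1 _ * h.el hJ 0 (fun _ => c) = h.el hJ 0 (fun _ => sh c) * h.el hJ 1 _
    rw [el_mul_el_zero, el_mul_el_one]
    refine h.el_congr hJ 1 fun t ht => ?_
    interval_cases t <;> simp [twist]
  Y_mul_ι_sh c := by
    change h.el hJ 1 _ * h.el hJ 0 (fun _ => sh c) = h.el hJ 0 (fun _ => c) * h.el hJ 1 _
    rw [el_mul_el_zero, el_mul_el_one]
    refine h.el_congr hJ 1 fun t ht => ?_
    interval_cases t <;> simp

theorem extRep_ι (c : R) : (h.extRep hJ).ι c = h.el hJ 0 fun _ => c := rfl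

theorem extRep_X : (h.extRep hJ).X = h.el hJ 1 fun t => if t = 0 then 1 else 0 := rfl

theorem extRep_Y : (h.extRep hJ).Y = h.el hJ 1 fun t => if t = 1 then 1 else 0 := rfl

theorem extRep_X_pow (n : ℕ) :
    (h.extRep hJ).X ^ n = h.el hJ n fun t => if t = 0 then 1 else 0 := by
  induction n with
  | zero =>
    rw [pow_zero, ← h.el_zero_one hJ]
    refine h.el_congr hJ 0 fun t ht => ?_
    rw [if_pos (by omega)]
  | succ n ih =>
    rw [pow_succ, ih, extRep_X, el_mul_el_one]
    refine h.el_congr hJ (n + 1) fun t ht => ?_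
    by_cases h0 : t = 0
    · subst h0
      simp [twist]
    · simp [h0]

theorem extRep_mon (p : ℕ × ℕ) :
    (h.extRep hJ).mon p = h.el hJ (p.1 + p.2) fun t => if t = p.2 then 1 else 0 := by
  obtain ⟨s, t⟩ := p
  dsimp only [mon]
  induction t with
  | zero =>
    rw [pow_zero, mul_one]
    exact h.extRep_X_pow hJ s
  | succ t ih =>
    rw [pow_succ, ← mul_assoc, ih, extRep_Y, el_mul_el_one]
    refine h.el_congr hJ _ fun u hu => ?_
    rcases u with _ | u <;> simp

theorem extRep_mon_mul_ι (p : ℕ × ℕ) (c : R) : (h.extRep hJ).mon p * (h.extRep hJ).ι c =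
    h.el hJ (p.1 + p.2) fun t => if t = p.2 then c else 0 := by
  rw [extRep_mon, extRep_ι, el_mul_el_zero]
  simp

theorem extRep_Y_mul_X : (h.extRep hJ).Y * (h.extRep hJ).X =
    -((h.extRep hJ).ι ↑θ⁻¹ * ((h.extRep hJ).X * (h.extRep hJ).Y)) := by
  have h1 : (h.extRep hJ).X * (h.extRep hJ).Y = (h.extRep hJ).mon (1, 1) := by
    rw [mon, pow_one, pow_one]
  have h2 : monShift sh (1, 1) = 1 := by
    ext c
    simp [monShift]
  rw [h1, ι_mul_mon, h2, ← mul_neg, ← map_neg, extRep_mon_mul_ι, extRep_X, extRep_Y, el_mul_el_one]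
  refine h.el_congr hJ _ fun u hu => ?_
  interval_cases u
  · simp
  · simp [twist]
    rfl
  · simp

/-- The classes in `Ext^n` and their coefficients. -/
def extOfEquiv (n : ℕ) : (Fin (n + 1) → R) ≃+ Abelian.Ext.{u} (top Γ) (top Γ) n :=
  AddEquiv.ofBijective (AddMonoidHom.mk' (h.extOf hJ n) (h.extOf_add hJ n))
    ⟨(injective_iff_map_eq_zero _).2 (h.extOf_injective hJ n), h.extOf_surjective hJ n⟩

/-- A coefficient of an element of the Ext algebra. -/
def extCoeff (p : ℕ × ℕ) : ExtAlgebra Γ →+ R :=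
  ((Pi.evalAddMonoidHom (fun _ : Fin (p.1 + p.2 + 1) => R) ⟨p.2, by omega⟩).comp
    (h.extOfEquiv hJ (p.1 + p.2)).symm.toAddMonoidHom).comp
      (DFinsupp.evalAddMonoidHom (p.1 + p.2))

theorem extCoeff_el (p : ℕ × ℕ) (n : ℕ) (f : ℕ → R) :
    h.extCoeff hJ p (h.el hJ n f) = if n = p.1 + p.2 then f p.2 else 0 := by
  change (h.extOfEquiv hJ (p.1 + p.2)).symm (h.el hJ n f (p.1 + p.2)) _ = _
  split_ifs with hn
  · subst hn
    rw [el, DirectSum.of_eq_same]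
    exact congrFun ((h.extOfEquiv hJ (p.1 + p.2)).symm_apply_apply fun t => f t) _
  · rw [el, DirectSum.of_eq_of_ne _ _ _ (Ne.symm hn), map_zero]
    rfl

theorem extCoeff_polyMap (p : ℕ × ℕ) (F : ℕ × ℕ →₀ R) :
    h.extCoeff hJ p ((h.extRep hJ).polyMap F) = (monShift sh p).symm (F p) := by
  induction F using Finsupp.induction_linear with
  | zero => simp
  | add F G hF hG => simp [hF, hG]
  | single r c =>
    rw [polyMap_single, ι_mul_mon, extRep_mon_mul_ι, extCoeff_el, Finsupp.single_apply]
    by_cases hr : r = p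
    · subst hr
      simp
    · rw [if_neg hr, map_zero]
      split_ifs with h1 h2
      · exact absurd (Prod.ext (by omega) h2.symm) hr
      · rfl
      · rfl

theorem extRep_polyMap_injective : Function.Injective (h.extRep hJ).polyMap := by
  refine (injective_iff_map_eq_zero _).2 fun F hF => Finsupp.ext fun p => ?_
  have := h.extCoeff_polyMap hJ p F
  rw [hF, map_zero] at this
  exact (map_eq_zero_iff _ (monShift sh p).symm.injective).1 this.symm

theorem el_mem_range_lof (n : ℕ) (f : ℕ → R) :
    h.el hJ n f ∈ LinearMap.range (DirectSum.lof K ℕ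
      (fun n : ℕ => Abelian.Ext.{u} (top Γ) (top Γ) n) n) :=
  ⟨_, rfl⟩

theorem el_eq_sum (n : ℕ) (f : ℕ → R) : h.el hJ n f =
    ∑ t ∈ Finset.range (n + 1), (h.extRep hJ).mon (n - t, t) * (h.extRep hJ).ι (f t) := by
  have h1 : ∀ t ∈ Finset.range (n + 1), (h.extRep hJ).mon (n - t, t) * (h.extRep hJ).ι (f t) =
      h.el hJ n fun u => if u = t then f t else 0 := by
    intro t ht
    rw [extRep_mon_mul_ι]
    dsimp only
    rw [Nat.sub_add_cancel (by simpa [Nat.lt_succ_iff] using ht)]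
  rw [Finset.sum_congr rfl h1]
  have h2 := map_sum (AddMonoidHom.mk' (h.el hJ n) (h.el_add hJ n))
    (fun t => fun u => if u = t then f t else 0) (Finset.range (n + 1))
  refine Eq.trans (h.el_congr hJ n fun t ht => ?_) h2
  rw [Finset.sum_apply, Finset.sum_ite_eq, if_pos (by simpa [Nat.lt_succ_iff] using ht)]

theorem range_lof_eq_map_polyMap (n : ℕ) :
    LinearMap.range (DirectSum.lof K ℕ (fun n : ℕ => Abelian.Ext.{u} (top Γ) (top Γ) n) n) =
      (Finsupp.supported R K {p : ℕ × ℕ | p.1 + p.2 = n}).map (h.extRep hJ).polyMap := by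
  apply le_antisymm
  · rintro _ ⟨x, rfl⟩
    obtain ⟨c, rfl⟩ := h.extOf_surjective hJ n x
    have hc : DirectSum.lof K ℕ (fun n : ℕ => Abelian.Ext.{u} (top Γ) (top Γ) n) n
        (h.extOf hJ n c) = h.el hJ n fun t => if ht : t < n + 1 then c ⟨t, ht⟩ else 0 := by
      rw [el]
      refine congrArg (fun c => DirectSum.of (fun n : ℕ => Abelian.Ext.{u} (top Γ) (top Γ) n) n
        (h.extOf hJ n c)) ?_
      funext t
      have ht := t.2
      simp only [ht, dif_pos]
    rw [hc, el_eq_sum]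
    refine Submodule.sum_mem _ fun t ht => ?_
    rw [mon_mul_ι, ← polyMap_single]
    refine Submodule.mem_map_of_mem (Finsupp.single_mem_supported K _ ?_)
    have := Finset.mem_range.1 ht
    change n - t + t = n
    omega
  · rintro _ ⟨F, hF, rfl⟩
    rw [← F.sum_single, Finsupp.sum, map_sum]
    refine Submodule.sum_mem _ fun p hp => ?_
    have hpn : p.1 + p.2 = n := hF hp
    rw [polyMap_single, ι_mul_mon, extRep_mon_mul_ι, hpn]
    exact h.el_mem_range_lof hJ n _

end IsExterior

end SkewRep

namespace SocleDeformation

variable {K : Type*} [Field K] {m : ℕ} (q : ZMod m → Kˣ)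

/-- The deformation parameters, as a unit of the algebra of coefficients. -/
def theta : (ZMod m → K)ˣ := MulEquiv.piUnits.symm q

theorem theta_apply (i : ZMod m) : (theta q : ZMod m → K) i = q i := rfl

theorem theta_inv_apply (i : ZMod m) : (↑(theta q)⁻¹ : ZMod m → K) i = (q i : K)⁻¹ := by
  rw [← Units.val_inv_eq_inv_val]
  rfl

variable (K m) in
/-- The space of coordinates of `Λ_q`. -/
abbrev Coord : Type _ := (ZMod m → K) × (ZMod m → K) × (ZMod m → K) × (ZMod m → K)

/-- The left regular representation of `Λ_q` in coordinates. -/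
def coordRep : SkewRep (cycShift K m) (Module.End K (Coord K m)) where
  ι := Algebra.lsmul K K (Coord K m)
  X :=
    { toFun := fun v => (0, cycShift K m v.1, 0, cycShift K m v.2.2.1)
      map_add' := fun v w => by simp
      map_smul' := fun c v => by simp }
  Y :=
    { toFun := fun v => (0, 0, (cycShift K m).symm v.1,
        (theta q : ZMod m → K) * (cycShift K m).symm v.2.1)
      map_add' := fun v w => by simp [mul_add]
      map_smul' := fun c v => by simp }
  X_mul_ι c := by
    refine LinearMap.ext fun v => ?_
    simp
  Y_mul_ι_sh c := by
    refine LinearMap.ext fun v => ?_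
    simp [mul_left_comm]

theorem coordRep_X_apply (v : Coord K m) :
    (coordRep q).X v = (0, cycShift K m v.1, 0, cycShift K m v.2.2.1) := rfl

theorem coordRep_Y_apply (v : Coord K m) :
    (coordRep q).Y v = (0, 0, (cycShift K m).symm v.1,
        (theta q : ZMod m → K) * (cycShift K m).symm v.2.1) := rfl

theorem coordRep_ι_apply (c : ZMod m → K) (v : Coord K m) : (coordRep q).ι c v = c • v := rfl

variable [NeZero m]

theorem a_mul_abar (i : ZMod m) :
    a K m i * abar K m i = e K m i * ((pathRep K m).X * (pathRep K m).Y) := by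
  rw [← mul_assoc, e_mul_pathRep_X, ← e_mul_pathRep_Y, ← mul_assoc, a_mul_e, if_pos rfl]

theorem abar_mul_a (i : ZMod m) :
    abar K m i * a K m i = e K m (i + 1) * ((pathRep K m).Y * (pathRep K m).X) := by
  rw [← mul_assoc, e_mul_pathRep_Y, ← e_mul_pathRep_X, ← mul_assoc, abar_mul_e, if_pos rfl]

theorem a_mul_a (i : ZMod m) :
    a K m i * a K m (i + 1) = e K m i * ((pathRep K m).X * (pathRep K m).X) := by
  rw [← mul_assoc, e_mul_pathRep_X, ← e_mul_pathRep_X (i + 1), ← mul_assoc, a_mul_e, if_pos rfl]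

theorem abar_mul_abar (i : ZMod m) :
    abar K m (i + 1) * abar K m i = e K m (i + 2) * ((pathRep K m).Y * (pathRep K m).Y) := by
  have : i + 2 = i + 1 + 1 := by ring
  rw [this, ← mul_assoc, e_mul_pathRep_Y, ← e_mul_pathRep_Y i, ← mul_assoc, abar_mul_e, if_pos rfl]

/-- An element of an algebra vanishes if all its parts at the vertices do. -/
theorem eq_zero_of_e_mul {T : Type*} [Ring T] [Algebra K T]
    (φ : PathAlgebra K (CycleVertex m) →ₐ[K] T) (x : T) (hx : ∀ i, φ (e K m i) * x = 0) :
    x = 0 := by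
  rw [← one_mul x, ← map_one φ, ← sum_e, map_sum, Finset.sum_mul]
  exact Finset.sum_eq_zero fun i _ => hx i

theorem e_mul_pathRep_ι (c : ZMod m → K) (i : ZMod m) :
    e K m i * (pathRep K m).ι c = c i • e K m i := by
  rw [pathRep_ι_apply, Finset.mul_sum]
  simp [e_mul_e]

/-- The coefficients and the sums of the arrows in `Λ_q`. -/
abbrev lamRep : SkewRep (cycShift K m) (Lam q) :=
  (pathRep K m).map (RingQuot.mkAlgHom K (Rel q))

theorem lamRep_X_X : (lamRep q).X * (lamRep q).X = 0 := by
  refine eq_zero_of_e_mul (RingQuot.mkAlgHom K (Rel q)) _ fun i => ?_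
  have := RingQuot.mkAlgHom_rel K (Rel.aa (q := q) i)
  rwa [a_mul_a, map_mul, map_mul, map_zero] at this

theorem lamRep_Y_Y : (lamRep q).Y * (lamRep q).Y = 0 := by
  refine eq_zero_of_e_mul (RingQuot.mkAlgHom K (Rel q)) _ fun i => ?_
  have := RingQuot.mkAlgHom_rel K (Rel.abar_abar (q := q) i)
  have h1 : i - 1 = i - 2 + 1 := by ring
  rw [h1, abar_mul_abar, sub_add_cancel, map_mul, map_mul, map_zero] at this
  exact this

theorem lamRep_Y_X : (lamRep q).Y * (lamRep q).X =
    (lamRep q).ι (theta q) * ((lamRep q).X * (lamRep q).Y) := by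
  rw [← sub_eq_zero]
  refine eq_zero_of_e_mul (RingQuot.mkAlgHom K (Rel q)) _ fun i => ?_
  have := RingQuot.mkAlgHom_rel K (Rel.comm (q := q) i)
  rw [a_mul_abar, abar_mul_a, sub_add_cancel, map_zero] at this
  have h2 : e K m i * ((pathRep K m).Y * (pathRep K m).X -
      (pathRep K m).ι (theta q) * ((pathRep K m).X * (pathRep K m).Y)) =
      -((q i : K) • (e K m i * ((pathRep K m).X * (pathRep K m).Y)) -
        e K m i * ((pathRep K m).Y * (pathRep K m).X)) := by
    rw [mul_sub, ← mul_assoc _ ((pathRep K m).ι _), e_mul_pathRep_ι, theta_apply, smul_mul_assoc,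
      neg_sub]
  have h3 := congrArg (RingQuot.mkAlgHom K (Rel q)) h2
  rw [map_neg, this, neg_zero, map_mul, map_sub, map_mul, map_mul, map_mul] at h3
  exact h3

/-- The homomorphism from `Λ_q` given by elements that satisfy its relations. -/
def lamLift {T : Type*} [Ring T] [Algebra K T] (ρ : SkewRep (cycShift K m) T)
    (hXX : ρ.X * ρ.X = 0) (hYY : ρ.Y * ρ.Y = 0)
    (hYX : ρ.Y * ρ.X = ρ.ι (theta q) * (ρ.X * ρ.Y)) : Lam q →ₐ[K] T :=
  RingQuot.liftAlgHom K ⟨pathLift ρ, by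
    intro x y hxy
    cases hxy with
    | aa i =>
      rw [a_mul_a, map_mul, map_mul, pathLift_pathRep_X, hXX, mul_zero, map_zero]
    | abar_abar i =>
      have h1 : i - 1 = i - 2 + 1 := by ring
      rw [h1, abar_mul_abar, map_mul, map_mul, pathLift_pathRep_Y, hYY, mul_zero, map_zero]
    | comm i =>
      rw [a_mul_abar, abar_mul_a, sub_add_cancel, map_zero, map_sub, map_smul, map_mul, map_mul,
        map_mul, map_mul, pathLift_pathRep_X, pathLift_pathRep_Y, hYX, ← mul_assoc, pathLift_e,
        mul_assoc, ← mul_assoc, ← mul_assoc (ρ.ι _), ← map_mul]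
      have : Pi.single i 1 * (theta q : ZMod m → K) = (q i : K) • Pi.single i 1 := by
        funext j
        by_cases h : j = i
        · subst h
          simp [theta_apply]
        · simp [h]
      rw [this, map_smul, smul_mul_assoc, mul_assoc, sub_self]⟩

theorem lamLift_mk {T : Type*} [Ring T] [Algebra K T] (ρ : SkewRep (cycShift K m) T)
    (hXX : ρ.X * ρ.X = 0) (hYY : ρ.Y * ρ.Y = 0)
    (hYX : ρ.Y * ρ.X = ρ.ι (theta q) * (ρ.X * ρ.Y)) (x : PathAlgebra K (CycleVertex m)) :
    lamLift q ρ hXX hYY hYX (RingQuot.mkAlgHom K (Rel q) x) = pathLift ρ x :=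
  RingQuot.liftAlgHom_mkAlgHom_apply ..

/-- The augmentation of `Λ_q`. -/
def lamAug : Lam q →ₐ[K] (ZMod m → K) :=
  lamLift q { ι := AlgHom.id K _, X := 0, Y := 0, X_mul_ι := by simp, Y_mul_ι_sh := by simp }
    (zero_mul _) (zero_mul _) (by simp)

/-- The coordinates of an element of `Λ_q`. -/
def lamCoord : Lam q →ₐ[K] Module.End K (Coord K m) :=
  lamLift q (coordRep q)
    (LinearMap.ext fun v => by
      rw [Module.End.mul_apply, coordRep_X_apply, coordRep_X_apply]
      simp)
    (LinearMap.ext fun v => by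
      rw [Module.End.mul_apply, coordRep_Y_apply, coordRep_Y_apply]
      simp)
    (LinearMap.ext fun v => by
      rw [Module.End.mul_apply, Module.End.mul_apply, Module.End.mul_apply, coordRep_ι_apply,
        coordRep_X_apply, coordRep_Y_apply, coordRep_X_apply, coordRep_Y_apply]
      simp)

theorem lamCoord_nf (p r s z : ZMod m → K) :
    lamCoord q ((lamRep q).nf p r s z) (1, 0, 0, 0) = (p, r, s, z) := by
  have hι : ∀ c, lamCoord q ((lamRep q).ι c) = (coordRep q).ι c := fun c =>
    (lamLift_mk ..).trans (pathLift_pathRep_ι _ c)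
  have hX : lamCoord q (lamRep q).X = (coordRep q).X :=
    (lamLift_mk ..).trans (pathLift_pathRep_X _)
  have hY : lamCoord q (lamRep q).Y = (coordRep q).Y :=
    (lamLift_mk ..).trans (pathLift_pathRep_Y _)
  rw [SkewRep.nf]
  simp only [map_add, map_mul, hι, hX, hY, LinearMap.add_apply, Module.End.mul_apply,
    coordRep_ι_apply, coordRep_X_apply, coordRep_Y_apply]
  simp

/-- A subspace of an algebra generated by the quiver that contains `1` and is stable under right
multiplication by the coefficients and the two variables is the whole algebra. -/
theorem submodule_eq_top_of_stable {T : Type*} [Ring T] [Algebra K T]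
    (φ : PathAlgebra K (CycleVertex m) →ₐ[K] T) (hφ : Function.Surjective φ) (N : Submodule K T)
    (h1 : 1 ∈ N) (hι : ∀ x ∈ N, ∀ c, x * ((pathRep K m).map φ).ι c ∈ N)
    (hX : ∀ x ∈ N, x * ((pathRep K m).map φ).X ∈ N)
    (hY : ∀ x ∈ N, x * ((pathRep K m).map φ).Y ∈ N) : N = ⊤ := by
  have h := pathAlgebra_submodule_eq_top (N.comap φ.toLinearMap) (by simpa using h1)
    (fun x hx c => by
      have := hι _ hx c
      rwa [Submodule.mem_comap, AlgHom.toLinearMap_apply, map_mul])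
    (fun x hx => by
      have := hX _ hx
      rwa [Submodule.mem_comap, AlgHom.toLinearMap_apply, map_mul])
    (fun x hx => by
      have := hY _ hx
      rwa [Submodule.mem_comap, AlgHom.toLinearMap_apply, map_mul])
  refine eq_top_iff.2 fun y _ => ?_
  obtain ⟨x, rfl⟩ := hφ y
  have : x ∈ N.comap φ.toLinearMap := h ▸ Submodule.mem_top
  exact this

theorem lam_exteriorRel : (lamRep q).ExteriorRel (theta q) :=
  ⟨lamRep_X_X q, lamRep_Y_Y q, lamRep_Y_X q⟩

theorem lam_exists_nf (x : Lam q) : ∃ p r s z, x = (lamRep q).nf p r s z := by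
  have h := lam_exteriorRel q
  let N : Submodule K (Lam q) :=
    { carrier := {x | ∃ p r s z, x = (lamRep q).nf p r s z}
      add_mem' := by
        rintro _ _ ⟨p, r, s, z, rfl⟩ ⟨p', r', s', z', rfl⟩
        exact ⟨_, _, _, _, SkewRep.nf_add ..⟩
      zero_mem' := ⟨0, 0, 0, 0, by simp [SkewRep.nf]⟩
      smul_mem' := by
        rintro c _ ⟨p, r, s, z, rfl⟩
        exact ⟨c • p, c • r, c • s, c • z, by
          simp only [SkewRep.nf, map_smul, smul_add, smul_mul_assoc]⟩ }
  have hN : N = ⊤ := by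
    refine submodule_eq_top_of_stable (RingQuot.mkAlgHom K (Rel q))
      (RingQuot.mkAlgHom_surjective K (Rel q)) N ?_ ?_ ?_ ?_
    · exact ⟨1, 0, 0, 0, by simp [SkewRep.nf]⟩
    · rintro _ ⟨p, r, s, z, rfl⟩ c
      exact ⟨_, _, _, _, SkewRep.nf_mul_ι ..⟩
    · rintro _ ⟨p, r, s, z, rfl⟩
      exact ⟨_, _, _, _, h.nf_mul_X ..⟩
    · rintro _ ⟨p, r, s, z, rfl⟩
      have := h.nf_mul_ι_Y p r s z 1
      rw [map_one, one_mul] at this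
      exact ⟨_, _, _, _, this⟩
  have hx : x ∈ N := hN ▸ Submodule.mem_top
  exact hx

theorem lam_isExterior : (lamRep q).IsExterior (theta q) (lamAug q) where
  toExteriorRel := lam_exteriorRel q
  exists_coord := lam_exists_nf q
  coord_unique p r s z h0 := by
    have := lamCoord_nf q p r s z
    rw [SkewRep.nf, h0, map_zero, LinearMap.zero_apply] at this
    simpa [Prod.ext_iff, eq_comm] using this
  aug_ι c := (lamLift_mk ..).trans (pathLift_pathRep_ι _ c)
  aug_X := (lamLift_mk ..).trans (pathLift_pathRep_X _)
  aug_Y := (lamLift_mk ..).trans (pathLift_pathRep_Y _)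

theorem mem_jacobson_lam (x : Lam q) : x ∈ Ring.jacobson (Lam q) ↔ lamAug q x = 0 :=
  (lam_isExterior q).aug_eq_zero_iff_mem_jacobson (IsSemisimpleRing.jacobson_eq_bot _) x

end SocleDeformation

namespace SkewRep

variable {K R : Type*} [Field K] [CommRing R] [Algebra K R] {sh : R ≃ₐ[K] R}
  {T : Type*} [Ring T] [Algebra K T] (ρ : SkewRep sh T)

/-- The coefficients that appear when `X` is moved to the left of a power of `Y`. -/
def powX (sh : R ≃ₐ[K] R) (η : R) : ℕ → R
  | 0 => 1
  | n + 1 => sh.symm (powX sh η n) * η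

/-- The coefficients that appear when `Y` is moved to the right of a power of `X`. -/
def powY (sh : R ≃ₐ[K] R) (η : R) : ℕ → R
  | 0 => 1
  | n + 1 => powY sh η n * (sh ^ n) η

section
variable {ρ} {η : R} (hη : ρ.Y * ρ.X = ρ.ι η * (ρ.X * ρ.Y))
include hη

theorem Y_pow_mul_X (n : ℕ) : ρ.Y ^ n * ρ.X = ρ.ι (powX sh η n) * (ρ.X * ρ.Y ^ n) := by
  induction n with
  | zero => simp [powX]
  | succ n ih =>
    rw [pow_succ', mul_assoc, ih, ← mul_assoc, Y_mul_ι, mul_assoc, ← mul_assoc ρ.Y, hη, powX,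
      map_mul]
    simp only [mul_assoc]

theorem Y_mul_X_pow (n : ℕ) : ρ.Y * ρ.X ^ n = ρ.ι (powY sh η n) * (ρ.X ^ n * ρ.Y) := by
  induction n with
  | zero => simp [powY]
  | succ n ih =>
    rw [pow_succ, ← mul_assoc, ih, mul_assoc, mul_assoc, hη, ← mul_assoc (ρ.X ^ n), X_pow_mul_ι,
      powY, map_mul]
    simp only [mul_assoc]

theorem mon_mul_X (p : ℕ × ℕ) :
    ρ.mon p * ρ.X = ρ.ι ((sh ^ p.1) (powX sh η p.2)) * ρ.mon (p.1 + 1, p.2) := by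
  rw [mon, mul_assoc, Y_pow_mul_X hη, ← mul_assoc, X_pow_mul_ι, mon, pow_succ]
  simp only [mul_assoc]

theorem Y_mul_mon (p : ℕ × ℕ) :
    ρ.Y * ρ.mon p = ρ.ι (powY sh η p.1) * ρ.mon (p.1, p.2 + 1) := by
  rw [mon, ← mul_assoc, Y_mul_X_pow hη, mon, pow_succ']
  simp only [mul_assoc]

end

theorem X_mul_mon (p : ℕ × ℕ) : ρ.X * ρ.mon p = ρ.mon (p.1 + 1, p.2) := by
  rw [mon, ← mul_assoc, ← pow_succ', mon]

theorem mon_mul_Y (p : ℕ × ℕ) : ρ.mon p * ρ.Y = ρ.mon (p.1, p.2 + 1) := by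
  rw [mon, mul_assoc, ← pow_succ, mon]

end SkewRep

theorem range_lof_mul_mem {K : Type*} [Field K] {A : ℕ → Type*} [∀ n, AddCommGroup (A n)]
    [∀ n, Module K (A n)] [DirectSum.GSemiring A] {n k : ℕ} {x y : DirectSum ℕ A}
    (hx : x ∈ LinearMap.range (DirectSum.lof K ℕ A n))
    (hy : y ∈ LinearMap.range (DirectSum.lof K ℕ A k)) :
    x * y ∈ LinearMap.range (DirectSum.lof K ℕ A (n + k)) := by
  obtain ⟨x, rfl⟩ := hx
  obtain ⟨y, rfl⟩ := hy
  exact ⟨GradedMonoid.GMul.mul x y, (DirectSum.of_mul_of x y).symm⟩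

namespace SocleDeformation

section
variable {K : Type*} [Field K] {m : ℕ} [NeZero m] (q : ZMod m → Kˣ)

theorem pathLift_ofPath_mem {T : Type*} [Ring T] [Algebra K T] (ρ : SkewRep (cycShift K m) T)
    (𝒜 : ℕ → Submodule K T) (hmul : ∀ n k, ∀ x y : T, x ∈ 𝒜 n → y ∈ 𝒜 k → x * y ∈ 𝒜 (n + k))
    (hι : ∀ c, ρ.ι c ∈ 𝒜 0) (hX : ρ.X ∈ 𝒜 1) (hY : ρ.Y ∈ 𝒜 1) {i j : CycleVertex m}
    (p : Quiver.Path i j) : pathLift ρ (PathAlgebra.ofPath K p) ∈ 𝒜 p.length := by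
  have ha : ∀ {i j : ZMod m} (α : CycleArrow m i j), arrowValue ρ α ∈ 𝒜 1 := by
    intro i j α
    cases α with
    | a => simpa only [zero_add, arrowValue] using hmul 0 1 _ _ (hι _) hX
    | abar => simpa only [zero_add, arrowValue] using hmul 0 1 _ _ (hι _) hY
  have h : pathLift ρ (PathAlgebra.ofPath K p) =
      PathAlgebra.pathValue (V := CycleVertex m) (fun i : ZMod m => ρ.ι (Pi.single i 1))
        (fun {_ _} α => arrowValue ρ α) p := PathAlgebra.lift_ofPath ..
  rw [h]
  clear h
  induction p with
  | nil => exact hι _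
  | cons p α ih => exact hmul _ 1 _ _ ih (ha α)

/-- The coefficients and the sums of the arrows in the Koszul dual. -/
abbrev dualRep : SkewRep (cycShift K m) (LamDual q) :=
  (pathRep K m).map (RingQuot.mkAlgHom K (DualRel q))

theorem dualRep_Y_X : (dualRep q).Y * (dualRep q).X =
    -((dualRep q).ι ↑(theta q)⁻¹ * ((dualRep q).X * (dualRep q).Y)) := by
  rw [← add_eq_zero_iff_eq_neg]
  refine eq_zero_of_e_mul (RingQuot.mkAlgHom K (DualRel q)) _ fun i => ?_
  have := RingQuot.mkAlgHom_rel K (DualRel.comm (q := q) i)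
  rw [a_mul_abar, abar_mul_a, sub_add_cancel, map_zero] at this
  have h2 : e K m i * ((pathRep K m).Y * (pathRep K m).X +
      (pathRep K m).ι ↑(theta q)⁻¹ * ((pathRep K m).X * (pathRep K m).Y)) =
      ((q i)⁻¹ : K) • (e K m i * ((pathRep K m).X * (pathRep K m).Y)) +
        e K m i * ((pathRep K m).Y * (pathRep K m).X) := by
    rw [mul_add, ← mul_assoc _ ((pathRep K m).ι _), e_mul_pathRep_ι, theta_inv_apply,
      smul_mul_assoc, add_comm]
  have h3 := congrArg (RingQuot.mkAlgHom K (DualRel q)) h2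
  rw [this, map_mul, map_add, map_mul, map_mul, map_mul] at h3
  exact h3

/-- The homomorphism from the Koszul dual given by elements that satisfy its relations. -/
def dualLift {T : Type*} [Ring T] [Algebra K T] (ρ : SkewRep (cycShift K m) T)
    (hYX : ρ.Y * ρ.X = -(ρ.ι ↑(theta q)⁻¹ * (ρ.X * ρ.Y))) : LamDual q →ₐ[K] T :=
  RingQuot.liftAlgHom K ⟨pathLift ρ, by
    intro x y hxy
    cases hxy with
    | comm i =>
      rw [a_mul_abar, abar_mul_a, sub_add_cancel, map_zero, map_add, map_smul, map_mul, map_mul,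
        map_mul, map_mul, pathLift_pathRep_X, pathLift_pathRep_Y, hYX, pathLift_e, mul_neg,
        ← mul_assoc (ρ.ι _) (ρ.ι _), ← map_mul]
      have : Pi.single i 1 * (↑(theta q)⁻¹ : ZMod m → K) = (q i : K)⁻¹ • Pi.single i 1 := by
        funext j
        by_cases h : j = i
        · subst h
          simp [theta_apply]
        · simp [h]
      rw [this, map_smul, smul_mul_assoc, add_neg_cancel]⟩

theorem dualLift_mk {T : Type*} [Ring T] [Algebra K T] (ρ : SkewRep (cycShift K m) T)
    (hYX : ρ.Y * ρ.X = -(ρ.ι ↑(theta q)⁻¹ * (ρ.X * ρ.Y))) (x : PathAlgebra K (CycleVertex m)) :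
    dualLift q ρ hYX (RingQuot.mkAlgHom K (DualRel q) x) = pathLift ρ x :=
  RingQuot.liftAlgHom_mkAlgHom_apply ..

theorem dualRep_polyMap_surjective : Function.Surjective (dualRep q).polyMap := by
  have hη : (dualRep q).Y * (dualRep q).X =
      (dualRep q).ι (-↑(theta q)⁻¹) * ((dualRep q).X * (dualRep q).Y) := by
    rw [dualRep_Y_X, map_neg, neg_mul]
  rw [← LinearMap.range_eq_top]
  refine submodule_eq_top_of_stable (RingQuot.mkAlgHom K (DualRel q))
    (RingQuot.mkAlgHom_surjective K (DualRel q)) _ ?_ ?_ ?_ ?_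
  · exact ⟨Finsupp.single (0, 0) 1, by simp [SkewRep.polyMap_single, SkewRep.mon]⟩
  · rintro _ ⟨F, rfl⟩ c
    induction F using Finsupp.induction_linear with
    | zero => simp
    | add F G hF hG => simpa only [map_add, add_mul] using add_mem hF hG
    | single p d =>
      rw [SkewRep.polyMap_single, mul_assoc]
      exact ⟨Finsupp.single p (d * SkewRep.monShift (cycShift K m) p c), by
        rw [SkewRep.polyMap_single, SkewRep.mon_mul_ι, map_mul, mul_assoc]⟩
  · rintro _ ⟨F, rfl⟩
    induction F using Finsupp.induction_linear with
    | zero => simp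
    | add F G hF hG => simpa only [map_add, add_mul] using add_mem hF hG
    | single p d =>
      rw [SkewRep.polyMap_single, mul_assoc]
      exact ⟨Finsupp.single (p.1 + 1, p.2) _, by
        rw [SkewRep.polyMap_single, SkewRep.mon_mul_X hη, ← mul_assoc, ← map_mul]⟩
  · rintro _ ⟨F, rfl⟩
    induction F using Finsupp.induction_linear with
    | zero => simp
    | add F G hF hG => simpa only [map_add, add_mul] using add_mem hF hG
    | single p d =>
      rw [SkewRep.polyMap_single, mul_assoc]
      exact ⟨Finsupp.single (p.1, p.2 + 1) d, by
        rw [SkewRep.polyMap_single, SkewRep.mon_mul_Y]⟩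

end

universe u

variable {K : Type u} [Field K] {m : ℕ} [NeZero m] (q : ZMod m → Kˣ)

/-- The coefficients and the two generators of degree one of the Ext algebra of `Λ_q`. -/
abbrev lamExtRep : SkewRep (cycShift K m) (ExtAlgebra (Lam q)) :=
  (lam_isExterior q).extRep (mem_jacobson_lam q)

/-- The homomorphism from the Koszul dual to the Ext algebra. -/
def dualToExt : LamDual q →ₐ[K] ExtAlgebra (Lam q) :=
  dualLift q (lamExtRep q) ((lam_isExterior q).extRep_Y_mul_X (mem_jacobson_lam q))

theorem dualToExt_ι (c : ZMod m → K) : dualToExt q ((dualRep q).ι c) = (lamExtRep q).ι c :=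
  (dualLift_mk ..).trans (pathLift_pathRep_ι _ c)

theorem dualToExt_X : dualToExt q (dualRep q).X = (lamExtRep q).X :=
  (dualLift_mk ..).trans (pathLift_pathRep_X _)

theorem dualToExt_Y : dualToExt q (dualRep q).Y = (lamExtRep q).Y :=
  (dualLift_mk ..).trans (pathLift_pathRep_Y _)

theorem dualToExt_polyMap (F : ℕ × ℕ →₀ (ZMod m → K)) :
    dualToExt q ((dualRep q).polyMap F) = (lamExtRep q).polyMap F := by
  induction F using Finsupp.induction_linear with
  | zero => simp
  | add F G hF hG => rw [map_add, map_add, hF, hG, map_add]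
  | single p c =>
    rw [SkewRep.polyMap_single, SkewRep.polyMap_single, map_mul, SkewRep.mon, SkewRep.mon, map_mul,
      map_pow, map_pow, dualToExt_ι, dualToExt_X, dualToExt_Y]

theorem extPart_eq (n : ℕ) : extPart K (Lam q) n =
    (Finsupp.supported (ZMod m → K) K {p : ℕ × ℕ | p.1 + p.2 = n}).map (lamExtRep q).polyMap :=
  (lam_isExterior q).range_lof_eq_map_polyMap (mem_jacobson_lam q) n

theorem dualToExt_bijective : Function.Bijective (dualToExt q) := by
  constructor
  · refine (injective_iff_map_eq_zero _).2 fun x hx => ?_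
    obtain ⟨F, rfl⟩ := dualRep_polyMap_surjective q x
    rw [dualToExt_polyMap] at hx
    have h := (lam_isExterior q).extRep_polyMap_injective (mem_jacobson_lam q)
    rw [(map_eq_zero_iff _ h).1 hx, map_zero]
  · intro x
    change x ∈ Set.range _
    rw [← AlgHom.coe_range, SetLike.mem_coe]
    induction x using DirectSum.induction_on with
    | zero => exact zero_mem _
    | add x y hx hy => exact add_mem hx hy
    | of n x =>
      have h1 : DirectSum.of (fun n : ℕ => Abelian.Ext.{u} (SkewRep.top (Lam q))
          (SkewRep.top (Lam q)) n) n x ∈ extPart K (Lam q) n := ⟨x, rfl⟩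
      rw [extPart_eq] at h1
      obtain ⟨F, -, hF⟩ := h1
      exact ⟨(dualRep q).polyMap F, (dualToExt_polyMap q F).trans hF⟩

/-- The Koszul dual is the Ext algebra. -/
def dualEquivExt : LamDual q ≃ₐ[K] ExtAlgebra (Lam q) :=
  AlgEquiv.ofBijective (dualToExt q) (dualToExt_bijective q)

theorem extPart_mul_mem {n k : ℕ} {x y : ExtAlgebra (Lam q)} (hx : x ∈ extPart K (Lam q) n)
    (hy : y ∈ extPart K (Lam q) k) : x * y ∈ extPart K (Lam q) (n + k) := by
  exact range_lof_mul_mem hx hy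

theorem lamExtRep_ι_mem (c : ZMod m → K) : (lamExtRep q).ι c ∈ extPart K (Lam q) 0 := ⟨_, rfl⟩

theorem lamExtRep_X_mem : (lamExtRep q).X ∈ extPart K (Lam q) 1 := ⟨_, rfl⟩

theorem lamExtRep_Y_mem : (lamExtRep q).Y ∈ extPart K (Lam q) 1 := ⟨_, rfl⟩

theorem dualEquivExt_ofPath_mem (i j : CycleVertex m) (p : Quiver.Path i j) :
    dualEquivExt q (RingQuot.mkAlgHom K (DualRel q) (PathAlgebra.ofPath K p)) ∈
      extPart K (Lam q) p.length := by
  have h : dualEquivExt q (RingQuot.mkAlgHom K (DualRel q) (PathAlgebra.ofPath K p)) =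
      pathLift (lamExtRep q) (PathAlgebra.ofPath K p) := dualLift_mk ..
  rw [h]
  exact pathLift_ofPath_mem (lamExtRep q) (extPart K (Lam q))
    (fun _ _ _ _ hx hy => extPart_mul_mem q hx hy) (lamExtRep_ι_mem q) (lamExtRep_X_mem q)
    (lamExtRep_Y_mem q) p

end SocleDeformation

/-! ### Presentations of a subalgebra by three commuting elements -/

section Presentation

universe u

variable {K A : Type u} [Field K] [Ring A] [Algebra K A]

/-- The evaluation of polynomials at three commuting elements. -/
def evalCommuting (x y w : A) (hxy : Commute x y) (hxw : Commute x w) (hyw : Commute y w) :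
    MvPolynomial (Fin 3) K →ₐ[K] A :=
  AddMonoidAlgebra.lift K A (Fin 3 →₀ ℕ)
    { toFun := fun v => x ^ v.toAdd 0 * y ^ v.toAdd 1 * w ^ v.toAdd 2
      map_one' := by simp
      map_mul' := fun v v' => by
        simp only [toAdd_mul, Finsupp.add_apply, pow_add]
        have h1 := hxy.pow_pow (v'.toAdd 0) (v.toAdd 1)
        have h2 := hxw.pow_pow (v'.toAdd 0) (v.toAdd 2)
        have h3 := hyw.pow_pow (v'.toAdd 1) (v.toAdd 2)
        generalize x ^ v'.toAdd 0 = x' at *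
        generalize y ^ v'.toAdd 1 = y' at *
        generalize w ^ v'.toAdd 2 = w' at *
        generalize x ^ v.toAdd 0 = x at *
        generalize y ^ v.toAdd 1 = y at *
        generalize w ^ v.toAdd 2 = w at *
        calc x * x' * (y * y') * (w * w') = x * (x' * y) * (y' * w) * w' := by
              simp only [mul_assoc]
          _ = x * y * (x' * w) * (y' * w') := by rw [h1.eq, h3.eq]; simp only [mul_assoc]
          _ = x * y * w * (x' * y' * w') := by rw [h2.eq]; simp only [mul_assoc] }

variable {x y w : A} (hxy : Commute x y) (hxw : Commute x w) (hyw : Commute y w)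

theorem evalCommuting_monomial (v : Fin 3 →₀ ℕ) (c : K) :
    evalCommuting x y w hxy hxw hyw (MvPolynomial.monomial v c) =
      c • (x ^ v 0 * y ^ v 1 * w ^ v 2) := by
  exact AddMonoidAlgebra.lift_single _ _ _

theorem evalCommuting_X_zero : evalCommuting (K := K) x y w hxy hxw hyw (MvPolynomial.X 0) = x := by
  rw [MvPolynomial.X, evalCommuting_monomial]
  simp

theorem evalCommuting_X_one : evalCommuting (K := K) x y w hxy hxw hyw (MvPolynomial.X 1) = y := by
  rw [MvPolynomial.X, evalCommuting_monomial]
  simp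

theorem evalCommuting_X_two : evalCommuting (K := K) x y w hxy hxw hyw (MvPolynomial.X 2) = w := by
  rw [MvPolynomial.X, evalCommuting_monomial]
  simp

variable (K) in
/-- The ideal of the relation `w ^ p = ε * x * y`. -/
abbrev relIdeal (p : ℕ) (ε : K) : Ideal (MvPolynomial (Fin 3) K) :=
  Ideal.span {(MvPolynomial.X 2 ^ p -
      MvPolynomial.C ε * (MvPolynomial.X 0 * MvPolynomial.X 1) : MvPolynomial (Fin 3) K)}

theorem span_reduced_monomials (p : ℕ) (hp : 0 < p) (ε : K) :
    Submodule.span K (Set.range fun v : ℕ × ℕ × Fin p =>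
      Ideal.Quotient.mk (relIdeal K p ε) (MvPolynomial.X 0 ^ v.1 * MvPolynomial.X 1 ^ v.2.1 *
        MvPolynomial.X 2 ^ (v.2.2 : ℕ))) = ⊤ := by
  set mk := Ideal.Quotient.mk (relIdeal K p ε)
  set N := Submodule.span K (Set.range fun v : ℕ × ℕ × Fin p =>
      mk (MvPolynomial.X 0 ^ v.1 * MvPolynomial.X 1 ^ v.2.1 * MvPolynomial.X 2 ^ (v.2.2 : ℕ)))
  have hrel : mk (MvPolynomial.X 2 ^ p) =
      mk (MvPolynomial.C ε * (MvPolynomial.X 0 * MvPolynomial.X 1)) :=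
    Ideal.Quotient.eq.2 (Ideal.subset_span rfl)
  have hmon : ∀ k i j : ℕ, mk (MvPolynomial.X 0 ^ i * MvPolynomial.X 1 ^ j *
      MvPolynomial.X 2 ^ k) ∈ N := by
    intro k
    induction k using Nat.strong_induction_on with
    | _ k ih =>
      intro i j
      by_cases hk : k < p
      · exact Submodule.subset_span ⟨(i, j, ⟨k, hk⟩), rfl⟩
      · obtain ⟨k, rfl⟩ := Nat.exists_eq_add_of_le (not_lt.1 hk)
        have h1 := N.smul_mem ε (ih k (by omega) (i + 1) (j + 1))
        convert h1 using 1
        rw [pow_add, map_mul, map_mul mk (MvPolynomial.X 2 ^ p), hrel]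
        have h2 : ∀ z, ε • mk z = mk (MvPolynomial.C ε * z) := by
          intro z
          rw [← MvPolynomial.smul_eq_C_mul]
          rfl
        rw [h2, ← map_mul, ← map_mul]
        congr 1
        ring
  refine eq_top_iff.2 fun z _ => ?_
  obtain ⟨f, rfl⟩ := Ideal.Quotient.mk_surjective z
  induction f using MvPolynomial.induction_on' with
  | monomial v c =>
    have h1 : MvPolynomial.monomial v c = c • (MvPolynomial.X 0 ^ v 0 * MvPolynomial.X 1 ^ v 1 *
        MvPolynomial.X 2 ^ v 2 : MvPolynomial (Fin 3) K) := by
      rw [MvPolynomial.monomial_eq, MvPolynomial.smul_eq_C_mul,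
        Finsupp.prod_fintype _ _ (by simp), Fin.prod_univ_three]
    rw [h1]
    exact N.smul_mem c (hmon _ _ _)
  | add f g hf hg =>
    rw [map_add]
    exact N.add_mem (hf trivial) (hg trivial)

include hxy hxw hyw in
theorem isPresentedBy_of_linearIndependent {Z : Subalgebra K A} {p : ℕ} {ε : K} (hp : 0 < p)
    (hZ : Z = Algebra.adjoin K {x, y, w}) (hrel : w ^ p = ε • (x * y))
    (hli : LinearIndependent K fun v : ℕ × ℕ × Fin p =>
      x ^ v.1 * y ^ v.2.1 * w ^ (v.2.2 : ℕ)) :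
    IsPresentedBy Z x y w p ε := by
  set F := evalCommuting (K := K) x y w hxy hxw hyw
  have hF0 : F (MvPolynomial.X 0) = x := evalCommuting_X_zero hxy hxw hyw
  have hF1 : F (MvPolynomial.X 1) = y := evalCommuting_X_one hxy hxw hyw
  have hF2 : F (MvPolynomial.X 2) = w := evalCommuting_X_two hxy hxw hyw
  have hker : ∀ a ∈ relIdeal K p ε, F a = 0 := by
    intro a ha
    have : relIdeal K p ε ≤ RingHom.ker F := by
      rw [Ideal.span_le, Set.singleton_subset_iff, SetLike.mem_coe, RingHom.mem_ker, map_sub,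
        map_pow, map_mul, map_mul, hF0, hF1, hF2, hrel, ← MvPolynomial.algebraMap_eq,
        AlgHom.commutes, Algebra.smul_def, sub_self]
    exact this ha
  let G := Ideal.Quotient.liftₐ (relIdeal K p ε) F hker
  have hG : ∀ a, G (Ideal.Quotient.mk _ a) = F a := fun a => rfl
  have hGinj : Function.Injective G := by
    refine LinearMap.injective_of_linearIndependent (f := G.toLinearMap)
      (span_reduced_monomials p hp ε) ?_
    have he : (G.toLinearMap ∘ fun v : ℕ × ℕ × Fin p => Ideal.Quotient.mk (relIdeal K p ε)
        (MvPolynomial.X 0 ^ v.1 * MvPolynomial.X 1 ^ v.2.1 * MvPolynomial.X 2 ^ (v.2.2 : ℕ))) =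
        fun v : ℕ × ℕ × Fin p => x ^ v.1 * y ^ v.2.1 * w ^ (v.2.2 : ℕ) := by
      funext v
      change F _ = _
      rw [map_mul, map_mul, map_pow, map_pow, map_pow, hF0, hF1, hF2]
    rw [he]
    exact hli
  have hrange : G.range = Z := by
    rw [hZ]
    apply le_antisymm
    · rintro _ ⟨a, rfl⟩
      obtain ⟨f, rfl⟩ := Ideal.Quotient.mk_surjective a
      change F f ∈ _
      induction f using MvPolynomial.induction_on with
      | C c =>
        rw [← MvPolynomial.algebraMap_eq, AlgHom.commutes]
        exact Subalgebra.algebraMap_mem _ _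
      | add f g hf hg =>
        rw [map_add]
        exact add_mem hf hg
      | mul_X f i hf =>
        rw [map_mul]
        refine mul_mem hf (Algebra.subset_adjoin ?_)
        fin_cases i <;> simp [hF0, hF1, hF2]
    · refine Algebra.adjoin_le ?_
      rintro z (rfl | rfl | rfl)
      · exact ⟨Ideal.Quotient.mk _ (MvPolynomial.X 0), hF0⟩
      · exact ⟨Ideal.Quotient.mk _ (MvPolynomial.X 1), hF1⟩
      · exact ⟨Ideal.Quotient.mk _ (MvPolynomial.X 2), hF2⟩
  subst hrange
  exact ⟨AlgEquiv.ofInjective G hGinj, hF0, hF1, hF2⟩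

include hxy hxw hyw in
theorem isPresentedBy_units_smul {Z : Subalgebra K A} {p : ℕ} {ε : K} (hp : 0 < p)
    (hZ : Z = Algebra.adjoin K {x, y, w}) (hrel : w ^ p = ε • (x * y))
    (hli : LinearIndependent K fun v : ℕ × ℕ × Fin p =>
      x ^ v.1 * y ^ v.2.1 * w ^ (v.2.2 : ℕ)) (c : Kˣ) :
    IsPresentedBy Z ((c : K) • x) y w p (↑c⁻¹ * ε) := by
  refine isPresentedBy_of_linearIndependent (hxy.smul_left _) (hxw.smul_left _) hyw hp ?_ ?_ ?_
  · rw [hZ]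
    apply le_antisymm <;> refine Algebra.adjoin_le ?_ <;> rintro z (rfl | rfl | rfl)
    · rw [← one_smul K z, ← c.inv_mul, mul_smul]
      exact Subalgebra.smul_mem _ (Algebra.subset_adjoin (by simp)) _
    · exact Algebra.subset_adjoin (by simp)
    · exact Algebra.subset_adjoin (by simp)
    · exact Subalgebra.smul_mem _ (Algebra.subset_adjoin (by simp)) _
    · exact Algebra.subset_adjoin (by simp)
    · exact Algebra.subset_adjoin (by simp)
  · rw [hrel, smul_mul_assoc, smul_smul, mul_right_comm, c.inv_mul, one_mul]
  · convert hli.units_smul fun v => c ^ v.1 using 1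
    funext v
    rw [Pi.smul_apply', smul_pow, smul_mul_assoc, smul_mul_assoc, Units.smul_def, Units.val_pow_eq_pow_val]

end Presentation

namespace SkewRep

variable {K R : Type*} [Field K] [CommRing R] [Algebra K R] {sh : R ≃ₐ[K] R}
  {T : Type*} [Ring T] [Algebra K T] (ρ : SkewRep sh T)

section Shifted

/-- If multiplication by monomials acts on the coefficients in a prescribed way, then so does
multiplication by polynomials. -/
theorem exists_polyMap_eq (φ : T →ₗ[K] T) (σ : ℕ × ℕ → ℕ × ℕ) (hσ : Function.Injective σ)
    (μ : ℕ × ℕ → R →ₗ[K] R) (h : ∀ p c, φ (ρ.ι c * ρ.mon p) = ρ.ι (μ p c) * ρ.mon (σ p))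
    (F : ℕ × ℕ →₀ R) :
    ∃ G, φ (ρ.polyMap F) = ρ.polyMap G ∧ ∀ p, G (σ p) = μ p (F p) := by
  induction F using Finsupp.induction_linear with
  | zero => exact ⟨0, by simp, by simp⟩
  | add F F' hF hF' =>
    obtain ⟨G, hG, hG2⟩ := hF
    obtain ⟨G', hG', hG2'⟩ := hF'
    exact ⟨G + G', by simp only [map_add, hG, hG'], fun p => by
      simp only [Finsupp.add_apply, map_add, hG2, hG2']⟩
  | single p c =>
    refine ⟨Finsupp.single (σ p) (μ p c), by simp only [polyMap_single, h], fun p' => ?_⟩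
    by_cases hp : p = p'
    · subst hp
      simp
    · rw [Finsupp.single_eq_of_ne (fun h => hp (hσ h.symm)),
        Finsupp.single_eq_of_ne (Ne.symm hp), map_zero]

/-- A linear relation between two operators on polynomials gives one between the coefficients. -/
theorem coeff_eq_of_operator_eq (hinj : Function.Injective ρ.polyMap) (φ ψ : T →ₗ[K] T)
    (σ : ℕ × ℕ → ℕ × ℕ) (hσ : Function.Injective σ) (μ ν : ℕ × ℕ → R →ₗ[K] R)
    (hφ : ∀ p c, φ (ρ.ι c * ρ.mon p) = ρ.ι (μ p c) * ρ.mon (σ p))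
    (hψ : ∀ p c, ψ (ρ.ι c * ρ.mon p) = ρ.ι (ν p c) * ρ.mon (σ p)) (F : ℕ × ℕ →₀ R) (r : K)
    (h : φ (ρ.polyMap F) = r • ψ (ρ.polyMap F)) (p : ℕ × ℕ) : μ p (F p) = r • ν p (F p) := by
  obtain ⟨G, hG, hG2⟩ := ρ.exists_polyMap_eq φ σ hσ μ hφ F
  obtain ⟨G', hG', hG2'⟩ := ρ.exists_polyMap_eq ψ σ hσ ν hψ F
  rw [hG, hG', ← map_smul] at h
  have := DFunLike.congr_fun (hinj h) (σ p)
  rwa [Finsupp.smul_apply, hG2, hG2'] at this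

end Shifted

theorem coeff_of_commute_ι (hinj : Function.Injective ρ.polyMap) (F : ℕ × ℕ →₀ R) (c : R)
    (h : ρ.polyMap F * ρ.ι c = ρ.ι c * ρ.polyMap F) (p : ℕ × ℕ) :
    F p * monShift sh p c = c * F p := by
  have := ρ.coeff_eq_of_operator_eq hinj (LinearMap.mulRight K (ρ.ι c))
    (LinearMap.mulLeft K (ρ.ι c)) id Function.injective_id
    (fun p => LinearMap.mulRight K (monShift sh p c)) (fun _ => LinearMap.mulLeft K c)
    (fun p d => by
      simp only [LinearMap.mulRight_apply, id, mul_assoc, mon_mul_ι, map_mul])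
    (fun p d => by simp only [LinearMap.mulLeft_apply, id, mul_assoc, map_mul])
    F 1 (by simpa using h) p
  simpa using this

theorem coeff_of_commute_X {η : R} (hη : ρ.Y * ρ.X = ρ.ι η * (ρ.X * ρ.Y))
    (hinj : Function.Injective ρ.polyMap) (F : ℕ × ℕ →₀ R) (r : K)
    (h : ρ.polyMap F * ρ.X = r • (ρ.X * ρ.polyMap F)) (p : ℕ × ℕ) :
    F p * (sh ^ p.1) (powX sh η p.2) = r • sh (F p) := by
  exact ρ.coeff_eq_of_operator_eq hinj (LinearMap.mulRight K ρ.X)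
    (LinearMap.mulLeft K ρ.X) (fun p => (p.1 + 1, p.2))
    (fun p p' h => by simpa [Prod.ext_iff] using h)
    (fun p => LinearMap.mulRight K ((sh ^ p.1) (powX sh η p.2))) (fun _ => sh.toLinearMap)
    (fun p d => by
      simp only [LinearMap.mulRight_apply, mul_assoc, mon_mul_X hη, map_mul])
    (fun p d => by
      simp only [LinearMap.mulLeft_apply, AlgEquiv.toLinearMap_apply]
      rw [← mul_assoc, X_mul_ι, mul_assoc, X_mul_mon])
    F r h p

theorem coeff_of_commute_Y {η : R} (hη : ρ.Y * ρ.X = ρ.ι η * (ρ.X * ρ.Y))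
    (hinj : Function.Injective ρ.polyMap) (F : ℕ × ℕ →₀ R) (r : K)
    (h : ρ.polyMap F * ρ.Y = r • (ρ.Y * ρ.polyMap F)) (p : ℕ × ℕ) :
    F p = r • (sh.symm (F p) * powY sh η p.1) := by
  exact ρ.coeff_eq_of_operator_eq hinj (LinearMap.mulRight K ρ.Y)
    (LinearMap.mulLeft K ρ.Y) (fun p => (p.1, p.2 + 1))
    (fun p p' h => by simpa [Prod.ext_iff] using h)
    (fun _ => LinearMap.id)
    (fun p => LinearMap.mulRight K (powY sh η p.1) ∘ₗ sh.symm.toLinearMap)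
    (fun p d => by
      simp only [LinearMap.mulRight_apply, mul_assoc, mon_mul_Y, LinearMap.id_apply])
    (fun p d => by
      simp only [LinearMap.mulLeft_apply, LinearMap.comp_apply, AlgEquiv.toLinearMap_apply,
        LinearMap.mulRight_apply]
      rw [← mul_assoc, Y_mul_ι, mul_assoc, Y_mul_mon hη, map_mul, mul_assoc])
    F r h p

/-- An element that commutes with the coefficients and the two variables commutes with all
polynomials. -/
theorem commute_polyMap {z : T} (hι : ∀ c, Commute z (ρ.ι c)) (hX : Commute z ρ.X)
    (hY : Commute z ρ.Y) (F : ℕ × ℕ →₀ R) : Commute z (ρ.polyMap F) := by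
  induction F using Finsupp.induction_linear with
  | zero => simp
  | add F F' hF hF' => simpa only [map_add] using hF.add_right hF'
  | single p c =>
    rw [polyMap_single, mon]
    exact (hι c).mul_right ((hX.pow_right _).mul_right (hY.pow_right _))

theorem linearIndependent_monomials (hinj : Function.Injective ρ.polyMap) {ι : Type*}
    (φ : ι → ℕ × ℕ) (hφ : Function.Injective φ) (u : ι → R) (hu : ∀ i, u i ≠ 0) :
    LinearIndependent K fun i => ρ.ι (u i) * ρ.mon (φ i) := by
  have h1 : LinearIndependent K fun i => Finsupp.single (φ i) (u i) := by
    rw [linearIndependent_iff']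
    intro s g hg i hi
    have h2 := DFunLike.congr_fun hg (φ i)
    rw [Finsupp.finsetSum_apply, Finset.sum_eq_single i] at h2
    · simpa [hu i] using h2
    · intro j _ hj
      rw [Finsupp.smul_apply, Finsupp.single_eq_of_ne (fun h => hj (hφ h.symm)), smul_zero]
    · exact fun h => absurd hi h
  have h3 := h1.map' ρ.polyMap (LinearMap.ker_eq_bot.2 hinj)
  simp only [← polyMap_single]
  exact h3

end SkewRep

namespace SocleDeformation

section Cyclic

variable {F : Type*} {m : ℕ} [NeZero m]

theorem eq_of_forall_succ_eq (f : ZMod m → F) (h : ∀ i, f (i + 1) = f i) (i : ZMod m) :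
    f i = f 0 := by
  have h1 : ∀ n : ℕ, f (n : ZMod m) = f 0 := by
    intro n
    induction n with
    | zero => simp
    | succ n ih => rw [Nat.cast_succ, h, ih]
  rw [← ZMod.natCast_zmod_val i, h1]

variable [Field F]

theorem ne_zero_of_recurrence (f g : ZMod m → F) (h : ∀ i, f (i + 1) = g i * f i) (hf : f ≠ 0)
    (i : ZMod m) : f i ≠ 0 := by
  intro h0
  refine hf (funext fun j => ?_)
  have h1 : ∀ n : ℕ, f (i + n) = 0 := by
    intro n
    induction n with
    | zero => simpa using h0
    | succ n ih => rw [Nat.cast_succ, ← add_assoc, h, ih, mul_zero]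
  have h2 := h1 (j - i).val
  rwa [ZMod.natCast_zmod_val, add_sub_cancel] at h2

theorem prod_eq_one_of_recurrence (f g : ZMod m → F) (h : ∀ i, f (i + 1) = g i * f i)
    (hf : f ≠ 0) : ∏ i, g i = 1 := by
  have h1 : ∏ i, f (i + 1) = ∏ i, f i := Equiv.prod_comp (Equiv.addRight (1 : ZMod m)) f
  simp only [h, Finset.prod_mul_distrib] at h1
  exact mul_eq_right₀ (Finset.prod_ne_zero_iff.2 fun i _ => ne_zero_of_recurrence f g h hf i)
    |>.1 h1

@[to_additive]
theorem prod_range_natCast {M : Type*} [CommMonoid M] (f : ZMod m → M) :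
    ∏ k ∈ Finset.range m, f (k : ZMod m) = ∏ i, f i := by
  refine Finset.prod_bij' (fun k _ => (k : ZMod m)) (fun i _ => i.val) ?_ ?_ ?_ ?_ ?_
  · intro k _
    exact Finset.mem_univ _
  · intro i _
    exact Finset.mem_range.2 (ZMod.val_lt i)
  · intro k hk
    exact ZMod.val_cast_of_lt (Finset.mem_range.1 hk)
  · intro i _
    exact ZMod.natCast_zmod_val i
  · intro k _
    rfl

theorem prod_range_add_natCast {M : Type*} [CommMonoid M] (f : ZMod m → M) (j : ZMod m) :
    ∏ k ∈ Finset.range m, f (j + k) = ∏ i, f i := by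
  rw [prod_range_natCast fun i => f (j + i)]
  exact Equiv.prod_comp (Equiv.addLeft j) f

end Cyclic

variable {K : Type*} [Field K] {m : ℕ} (q : ZMod m → Kˣ)

theorem cycShift_pow_apply (n : ℕ) (c : ZMod m → K) (i : ZMod m) :
    (cycShift K m ^ n) c i = c (i + n) := by
  induction n generalizing i with
  | zero => simp
  | succ n ih =>
    rw [pow_succ']
    change (cycShift K m ^ n) c (i + 1) = _
    rw [ih]
    congr 1
    push_cast
    ring

theorem cycShift_symm_pow_apply (n : ℕ) (c : ZMod m → K) (i : ZMod m) :
    ((cycShift K m).symm ^ n) c i = c (i - n) := by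
  induction n generalizing i with
  | zero => simp
  | succ n ih =>
    rw [pow_succ']
    change ((cycShift K m).symm ^ n) c (i - 1) = _
    rw [ih]
    congr 1
    push_cast
    ring

theorem monShift_apply (p : ℕ × ℕ) (c : ZMod m → K) (i : ZMod m) :
    SkewRep.monShift (cycShift K m) p c i = c (i + p.1 - p.2) := by
  change (cycShift K m ^ p.1) (((cycShift K m).symm ^ p.2) c) i = _
  rw [cycShift_pow_apply, cycShift_symm_pow_apply]

/-- The product of `n` consecutive parameters. -/
def qProd (n : ℕ) (i : ZMod m) : K := ∏ u ∈ Finset.range n, (q (i + u) : K)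

theorem qProd_ne_zero (n : ℕ) (i : ZMod m) : qProd q n i ≠ 0 :=
  Finset.prod_ne_zero_iff.2 fun _ _ => (q _).ne_zero

theorem qProd_succ (n : ℕ) (i : ZMod m) : qProd q (n + 1) i = qProd q n i * q (i + n) :=
  Finset.prod_range_succ ..

theorem qInv_eq (n k : ℕ) [NeZero m] : qInv q n k = (qProd q n (k : ZMod m))⁻¹ := by
  simp only [qInv, qProd, Nat.cast_add]

theorem qProd_add (n n' : ℕ) (i : ZMod m) :
    qProd q (n + n') i = qProd q n i * qProd q n' (i + n) := by
  simp only [qProd, Finset.prod_range_add, Nat.cast_add, add_assoc]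

theorem prod_qProd (r p : ℕ) (i : ZMod m) :
    ∏ j ∈ Finset.range p, qProd q r (i + (j * r : ℕ)) = qProd q (p * r) i := by
  induction p with
  | zero => simp [qProd]
  | succ p ih => rw [Finset.prod_range_succ, ih, add_mul, one_mul, qProd_add]

/-- The structure constant of the Koszul dual. -/
abbrev dualCoeff : ZMod m → K := -↑(theta q)⁻¹

theorem dualCoeff_apply (i : ZMod m) : dualCoeff q i = -(q i : K)⁻¹ := by
  change -((↑(theta q)⁻¹ : ZMod m → K) i) = _
  rw [theta_inv_apply]

theorem powY_apply (n : ℕ) (i : ZMod m) :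
    SkewRep.powY (cycShift K m) (dualCoeff q) n i = (-1) ^ n * (qProd q n i)⁻¹ := by
  induction n with
  | zero => simp [SkewRep.powY, qProd]
  | succ n ih =>
    rw [SkewRep.powY, Pi.mul_apply, ih, cycShift_pow_apply, dualCoeff_apply, qProd_succ, mul_inv,
      pow_succ]
    ring

theorem powX_apply (n : ℕ) (i : ZMod m) :
    SkewRep.powX (cycShift K m) (dualCoeff q) n i = (-1) ^ n * (qProd q n (i - n + 1))⁻¹ := by
  induction n generalizing i with
  | zero => simp [SkewRep.powX, qProd]
  | succ n ih =>
    rw [SkewRep.powX, Pi.mul_apply, cycShift_symm_apply, ih, dualCoeff_apply, qProd_succ, mul_inv,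
      pow_succ]
    have h1 : i - 1 - (n : ZMod m) + 1 = i - (n + 1 : ℕ) + 1 := by push_cast; ring
    have h2 : i - (n + 1 : ℕ) + 1 + (n : ZMod m) = i := by push_cast; ring
    rw [h1, h2]
    ring

section

variable [NeZero m]

theorem qProd_m (j : ZMod m) : qProd q m j = ∏ i, (q i : K) :=
  prod_range_add_natCast (fun i => (q i : K)) j

theorem qProd_add_mul_m (t k : ℕ) (j : ZMod m) :
    qProd q (t + k * m) j = qProd q t j * (∏ i, (q i : K)) ^ k := by
  induction k with
  | zero => simp
  | succ k ih =>
    have h : t + (k + 1) * m = (t + k * m) + m := by ring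
    rw [h, qProd, Finset.prod_range_add, ← qProd, ih, pow_succ, mul_assoc]
    congr 2
    rw [← qProd_m q (j + (t + k * m : ℕ)), qProd]
    refine Finset.prod_congr rfl fun u _ => ?_
    push_cast
    rw [add_assoc j]

theorem prod_qProd_succ (n : ℕ) : ∏ i, qProd q n (i + 1) = (∏ i, (q i : K)) ^ n := by
  simp only [qProd]
  rw [Finset.prod_comm]
  have h : ∀ u ∈ Finset.range n, ∏ i : ZMod m, (q (i + 1 + u) : K) = ∏ i, (q i : K) := by
    intro u _
    simp only [add_assoc]
    exact Equiv.prod_comp (Equiv.addRight (1 + u : ZMod m)) fun i => (q i : K)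
  rw [Finset.prod_congr rfl h, Finset.prod_const, Finset.card_range]

/-- The equations for the coefficients of the graded centre. -/
structure IsCentralCoeff (s t : ℕ) (c : ZMod m → K) : Prop where
  ι : ∀ d, c * SkewRep.monShift (cycShift K m) (s, t) d = d * c
  X : c * (cycShift K m ^ s) (SkewRep.powX (cycShift K m) (dualCoeff q) t) =
    (-1 : K) ^ (s + t) • cycShift K m c
  Y : c = (-1 : K) ^ (s + t) •
    ((cycShift K m).symm c * SkewRep.powY (cycShift K m) (dualCoeff q) s)

omit [NeZero m] in
variable {q} in
theorem isCentralCoeff_of_recurrence {s t : ℕ} {c : ZMod m → K} (hst : (s : ZMod m) = t)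
    (hX : ∀ i, c (i + 1) = (-1) ^ s * (qProd q t (i + 1))⁻¹ * c i)
    (hY : ∀ i, c (i + 1) = (-1) ^ t * (qProd q s (i + 1))⁻¹ * c i) : IsCentralCoeff q s t c where
  ι d := funext fun i => by
    rw [Pi.mul_apply, Pi.mul_apply, monShift_apply, hst, add_sub_cancel_right, mul_comm]
  X := funext fun i => by
    rw [Pi.smul_apply, Pi.mul_apply, cycShift_pow_apply, powX_apply, cycShift_apply, smul_eq_mul,
      hst, add_sub_cancel_right, hX, pow_add]
    have h : ((-1 : K) ^ s) * (-1) ^ s = 1 := by rw [← mul_pow]; simp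
    linear_combination (-(c i * (-1) ^ t * (qProd q t (i + 1))⁻¹)) * h
  Y := funext fun i => by
    have h1 := hY (i - 1)
    rw [sub_add_cancel] at h1
    rw [Pi.smul_apply, Pi.mul_apply, powY_apply, cycShift_symm_apply, smul_eq_mul, h1, pow_add]
    have h : ((-1 : K) ^ s) * (-1) ^ s = 1 := by rw [← mul_pow]; simp
    linear_combination (-(c (i - 1) * (-1) ^ t * (qProd q s i)⁻¹)) * h

namespace IsCentralCoeff

variable {q} {s t : ℕ} {c : ZMod m → K} (h : IsCentralCoeff q s t c) (hc : c ≠ 0)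
include h

omit [NeZero m] in
theorem succ_eq_of_Y (i : ZMod m) : c (i + 1) = (-1) ^ t * (qProd q s (i + 1))⁻¹ * c i := by
  have h1 := congrFun h.Y (i + 1)
  rw [Pi.smul_apply, Pi.mul_apply, powY_apply, cycShift_symm_apply, smul_eq_mul,
    add_sub_cancel_right] at h1
  have h2 : ((-1 : K) ^ s) * (-1) ^ s = 1 := by rw [← mul_pow]; simp
  rw [h1, pow_add]
  linear_combination ((-1) ^ t * (qProd q s (i + 1))⁻¹ * c i) * h2

include hc

omit [NeZero m] in
theorem natCast_eq : (s : ZMod m) = t := by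
  obtain ⟨i, hi⟩ := Function.ne_iff.1 hc
  have h1 := congrFun (h.ι (Pi.single i 1)) i
  rw [Pi.mul_apply, Pi.mul_apply, monShift_apply, Pi.single_eq_same, one_mul] at h1
  have h2 := mul_eq_left₀ hi |>.1 h1
  by_contra hst
  rw [Pi.single_eq_of_ne] at h2
  · exact zero_ne_one h2
  · intro h3
    rw [add_sub_assoc, add_eq_left, sub_eq_zero] at h3
    exact hst h3

omit [NeZero m] in
theorem succ_eq_of_X (i : ZMod m) : c (i + 1) = (-1) ^ s * (qProd q t (i + 1))⁻¹ * c i := by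
  have h1 := congrFun h.X i
  have h0 := h.natCast_eq hc
  rw [Pi.smul_apply, Pi.mul_apply, cycShift_pow_apply, powX_apply, cycShift_apply, smul_eq_mul, h0,
    add_sub_cancel_right] at h1
  rw [pow_add] at h1
  rcases neg_one_pow_eq_or K s with hs | hs <;> rcases neg_one_pow_eq_or K t with ht | ht <;>
    simp only [hs, ht] at h1 ⊢ <;> first | linear_combination h1 | linear_combination -h1

theorem ne_zero (i : ZMod m) : c i ≠ 0 :=
  ne_zero_of_recurrence c _ h.succ_eq_of_Y hc i

theorem pow_left : (∏ i, (q i : K)) ^ s = (-1) ^ (t * m) := by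
  have h1 := prod_eq_one_of_recurrence c _ h.succ_eq_of_Y hc
  rw [Finset.prod_mul_distrib, Finset.prod_inv_distrib, prod_qProd_succ, Finset.prod_const,
    Finset.card_univ, ZMod.card, ← pow_mul] at h1
  exact (mul_inv_eq_one₀ (pow_ne_zero _ (Finset.prod_ne_zero_iff.2 fun i _ => (q i).ne_zero))
    |>.1 h1).symm

theorem pow_right : (∏ i, (q i : K)) ^ t = (-1) ^ (s * m) := by
  have h1 := prod_eq_one_of_recurrence c _ (h.succ_eq_of_X hc) hc
  rw [Finset.prod_mul_distrib, Finset.prod_inv_distrib, prod_qProd_succ, Finset.prod_const,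
    Finset.card_univ, ZMod.card, ← pow_mul] at h1
  exact (mul_inv_eq_one₀ (pow_ne_zero _ (Finset.prod_ne_zero_iff.2 fun i _ => (q i).ne_zero))
    |>.1 h1).symm

theorem qProd_eq (i : ZMod m) : (-1) ^ t * qProd q t (i + 1) = (-1) ^ s * qProd q s (i + 1) := by
  have h1 := (h.succ_eq_of_X hc i).symm.trans (h.succ_eq_of_Y i)
  have h2 := mul_right_cancel₀ (h.ne_zero hc i) h1
  have h3 := qProd_ne_zero q t (i + 1)
  have h4 := qProd_ne_zero q s (i + 1)
  field_simp at h2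
  rcases neg_one_pow_eq_or K s with hs | hs <;> rcases neg_one_pow_eq_or K t with ht | ht <;>
    simp only [hs, ht] at h2 ⊢ <;> first | linear_combination h2 | linear_combination -h2

theorem pow_sub_left (k : ℕ) (hk : s = t + k * m) :
    (∏ i, (q i : K)) ^ k = (-1) ^ (k * m) := by
  have h1 := h.qProd_eq hc 0
  rw [hk, qProd_add_mul_m, pow_add] at h1
  have h2 : ((-1 : K) ^ (k * m)) * (-1) ^ (k * m) = 1 := by rw [← mul_pow]; simp
  have h3 : (-1 : K) ^ t * qProd q t (0 + 1) ≠ 0 := mul_ne_zero (by simp) (qProd_ne_zero q t _)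
  refine mul_left_cancel₀ h3 ?_
  linear_combination (-(-1 : K) ^ (k * m)) * h1 -
    (-1) ^ t * qProd q t (0 + 1) * (∏ i, (q i : K)) ^ k * h2

theorem pow_sub_right (k : ℕ) (hk : t = s + k * m) :
    (∏ i, (q i : K)) ^ k = (-1) ^ (k * m) := by
  have h1 := h.qProd_eq hc 0
  rw [hk, qProd_add_mul_m, pow_add] at h1
  have h2 : ((-1 : K) ^ (k * m)) * (-1) ^ (k * m) = 1 := by rw [← mul_pow]; simp
  have h3 : (-1 : K) ^ s * qProd q s (0 + 1) ≠ 0 := mul_ne_zero (by simp) (qProd_ne_zero q s _)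
  refine mul_left_cancel₀ h3 ?_
  linear_combination (-1 : K) ^ (k * m) * h1 -
    (-1) ^ s * qProd q s (0 + 1) * (∏ i, (q i : K)) ^ k * h2

end IsCentralCoeff

end

end SocleDeformation

namespace SocleDeformation

section Centre

universe u

variable {K T : Type u} [Field K] [Ring T] [Algebra K T] {m : ℕ}

theorem neg_one_pow_mul_eq_smul (n : ℕ) (z : T) : (-1 : T) ^ n * z = (-1 : K) ^ n • z := by
  rcases Nat.even_or_odd n with h | h <;> simp [h.neg_one_pow]

/-- A graded algebra whose elements are the polynomials in two variables that satisfy the relations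
of the Koszul dual. -/
structure IsPolynomialModel (q : ZMod m → Kˣ) (ρ : SkewRep (cycShift K m) T)
    (𝒜 : ℕ → Submodule K T) : Prop where
  Y_mul_X : ρ.Y * ρ.X = ρ.ι (dualCoeff q) * (ρ.X * ρ.Y)
  injective : Function.Injective ρ.polyMap
  part_eq (n : ℕ) :
    𝒜 n = (Finsupp.supported (ZMod m → K) K {p : ℕ × ℕ | p.1 + p.2 = n}).map ρ.polyMap

namespace IsPolynomialModel

variable {q : ZMod m → Kˣ} {ρ : SkewRep (cycShift K m) T} {𝒜 : ℕ → Submodule K T}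
  (h : IsPolynomialModel q ρ 𝒜)
include h

theorem ι_mul_mon_mem (c : ZMod m → K) (p : ℕ × ℕ) : ρ.ι c * ρ.mon p ∈ 𝒜 (p.1 + p.2) := by
  rw [h.part_eq, ← SkewRep.polyMap_single]
  exact Submodule.mem_map_of_mem (Finsupp.single_mem_supported K _ rfl)

theorem exists_isCentralCoeff {n : ℕ} {z : T} (hz : z ∈ 𝒜 n)
    (hc : ∀ k, ∀ g ∈ 𝒜 k, z * g = (-1) ^ (k * n) * (g * z)) :
    ∃ F, z = ρ.polyMap F ∧ ∀ p : ℕ × ℕ, IsCentralCoeff q p.1 p.2 (F p) := by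
  have hz' := hz
  rw [h.part_eq] at hz'
  obtain ⟨F, hF, rfl⟩ := hz'
  refine ⟨F, rfl, fun p => ?_⟩
  by_cases hp : p.1 + p.2 = n
  · have hι : ∀ d, ρ.ι d ∈ 𝒜 0 := fun d => by
      simpa [SkewRep.mon] using h.ι_mul_mon_mem d (0, 0)
    have hX : ρ.X ∈ 𝒜 1 := by simpa [SkewRep.mon] using h.ι_mul_mon_mem 1 (1, 0)
    have hY : ρ.Y ∈ 𝒜 1 := by simpa [SkewRep.mon] using h.ι_mul_mon_mem 1 (0, 1)
    refine ⟨fun d => ?_, ?_, ?_⟩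
    · exact ρ.coeff_of_commute_ι h.injective F d (by simpa using hc 0 _ (hι d)) p
    · rw [hp]
      refine ρ.coeff_of_commute_X h.Y_mul_X h.injective F _ ?_ p
      rw [hc 1 _ hX, neg_one_pow_mul_eq_smul (K := K), one_mul]
    · rw [hp]
      refine ρ.coeff_of_commute_Y h.Y_mul_X h.injective F _ ?_ p
      rw [hc 1 _ hY, neg_one_pow_mul_eq_smul (K := K), one_mul]
  · rw [Finsupp.notMem_support_iff.1 fun hp' => hp (hF hp')]
    exact ⟨by simp, by simp, by simp⟩

theorem gradedCentre_le {S : Subalgebra K T}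
    (hS : ∀ s t c, IsCentralCoeff q s t c → c ≠ 0 → ρ.ι c * ρ.mon (s, t) ∈ S) :
    gradedCentre 𝒜 ≤ S := by
  refine Algebra.adjoin_le ?_
  rintro z ⟨n, hz, hc⟩
  obtain ⟨F, rfl, hF⟩ := h.exists_isCentralCoeff hz hc
  change (F.sum fun p c => ρ.ι c * ρ.mon p) ∈ S
  exact S.sum_mem fun p hp => hS _ _ _ (hF p) (Finsupp.mem_support_iff.1 hp)

omit h in
theorem commute_ι {s t : ℕ} {c : ZMod m → K} (hc : IsCentralCoeff q s t c) (d : ZMod m → K) :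
    Commute (ρ.ι c * ρ.mon (s, t)) (ρ.ι d) := by
  rw [Commute, SemiconjBy, mul_assoc, SkewRep.mon_mul_ι, ← mul_assoc, ← mul_assoc, ← map_mul,
    ← map_mul, hc.ι]

theorem commute_X {s t : ℕ} {c : ZMod m → K} (hc : IsCentralCoeff q s t c)
    (hst : (-1 : K) ^ (s + t) = 1) : Commute (ρ.ι c * ρ.mon (s, t)) ρ.X := by
  have h1 := hc.X
  rw [hst, one_smul] at h1
  rw [Commute, SemiconjBy, mul_assoc, SkewRep.mon_mul_X h.Y_mul_X, ← mul_assoc, ← mul_assoc,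
    ← map_mul, h1, SkewRep.X_mul_ι, mul_assoc, SkewRep.X_mul_mon]

theorem commute_Y {s t : ℕ} {c : ZMod m → K} (hc : IsCentralCoeff q s t c)
    (hst : (-1 : K) ^ (s + t) = 1) : Commute (ρ.ι c * ρ.mon (s, t)) ρ.Y := by
  have h1 := hc.Y
  rw [hst, one_smul] at h1
  rw [Commute, SemiconjBy, mul_assoc, SkewRep.mon_mul_Y, ← mul_assoc, SkewRep.Y_mul_ι, mul_assoc,
    SkewRep.Y_mul_mon h.Y_mul_X, ← mul_assoc, ← map_mul, ← h1]

theorem mem_gradedCentre {s t : ℕ} {c : ZMod m → K} (hc : IsCentralCoeff q s t c)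
    (hst : (-1 : K) ^ (s + t) = 1) : ρ.ι c * ρ.mon (s, t) ∈ gradedCentre 𝒜 := by
  refine Algebra.subset_adjoin ⟨s + t, h.ι_mul_mon_mem c (s, t), fun k g hg => ?_⟩
  rw [h.part_eq] at hg
  obtain ⟨F, -, rfl⟩ := hg
  rw [neg_one_pow_mul_eq_smul (K := K), mul_comm k, pow_mul, hst, one_pow, one_smul]
  exact ρ.commute_polyMap (commute_ι hc) (h.commute_X hc hst) (h.commute_Y hc hst) F

theorem gradedCentre_eq_bot [NeZero m] (hζ : ∀ n : ℕ, 0 < n → (∏ i, (q i : K)) ^ n ≠ 1) :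
    gradedCentre 𝒜 = ⊥ := by
  refine eq_bot_iff.2 (h.gradedCentre_le fun s t c hc h0 => ?_)
  have key : ∀ n n' : ℕ, (∏ i, (q i : K)) ^ n = (-1) ^ n' → n = 0 := by
    intro n n' hn
    by_contra h1
    refine hζ (n * 2) (by omega) ?_
    rw [pow_mul, hn, ← pow_mul, mul_comm, pow_mul]
    simp
  obtain rfl := key _ _ (hc.pow_left h0)
  obtain rfl := key _ _ (hc.pow_right h0)
  have h1 : c = algebraMap K _ (c 0) := funext fun i =>
    eq_of_forall_succ_eq c (fun i => by rw [hc.succ_eq_of_Y]; simp [qProd]) i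
  rw [h1, AlgHom.commutes, SkewRep.mon]
  simp

theorem bijective_algebraMap [NeZero m] (hζ : ∀ n : ℕ, 0 < n → (∏ i, (q i : K)) ^ n ≠ 1) :
    Function.Bijective (algebraMap K (gradedCentre 𝒜)) := by
  have : Nontrivial T := h.injective.nontrivial
  refine ⟨(algebraMap K (gradedCentre 𝒜)).injective, fun z => ?_⟩
  obtain ⟨c, hc⟩ := Algebra.mem_bot.1 ((h.gradedCentre_eq_bot hζ).le z.2)
  exact ⟨c, Subtype.ext hc⟩

end IsPolynomialModel

end Centre

end SocleDeformation

namespace SocleDeformation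

section

variable {K : Type*} [Field K] {m : ℕ} [NeZero m] (q : ZMod m → Kˣ)

/-- The coefficients of the element `w`, indexed by the natural numbers. -/
def wCoeffNat (r j : ℕ) : K := (-1) ^ (j * r) * ∏ k ∈ Finset.Icc 1 j, qInv q r k

/-- The coefficients of the element `w`. -/
def wCoeff (r : ℕ) (i : ZMod m) : K := wCoeffNat q r i.val

omit [NeZero m] in
theorem wCoeffNat_zero (r : ℕ) : wCoeffNat q r 0 = 1 := by simp [wCoeffNat]

theorem wCoeffNat_succ (r j : ℕ) : wCoeffNat q r (j + 1) =
    (-1) ^ r * (qProd q r ((j : ZMod m) + 1))⁻¹ * wCoeffNat q r j := by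
  rw [wCoeffNat, Finset.prod_Icc_succ_top (by omega), wCoeffNat, qInv_eq, add_mul, pow_add, one_mul,
    Nat.cast_succ]
  ring

variable {q} in
theorem periodic_wCoeffNat {r : ℕ} (hr : (∏ i, (q i : K)) ^ r = (-1) ^ (r * m)) :
    Function.Periodic (wCoeffNat q r) m := by
  intro j
  induction j with
  | zero =>
    have h1 : ∀ n, wCoeffNat q r n =
        ∏ k ∈ Finset.range n, ((-1) ^ r * (qProd q r ((k : ZMod m) + 1))⁻¹) := by
      intro n
      induction n with
      | zero => simp [wCoeffNat]
      | succ n ih => rw [wCoeffNat_succ, ih, Finset.prod_range_succ, mul_comm]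
    rw [zero_add, wCoeffNat_zero, h1,
      prod_range_natCast fun i : ZMod m => (-1) ^ r * (qProd q r (i + 1))⁻¹,
      Finset.prod_mul_distrib, Finset.prod_inv_distrib, prod_qProd_succ, hr, Finset.prod_const,
      Finset.card_univ, ZMod.card, ← pow_mul]
    exact mul_inv_cancel₀ (by simp)
  | succ j ih =>
    rw [add_right_comm, wCoeffNat_succ, ih, wCoeffNat_succ]
    simp

variable {q} in
theorem wCoeff_natCast {r : ℕ} (hr : (∏ i, (q i : K)) ^ r = (-1) ^ (r * m)) (j : ℕ) :
    wCoeff q r (j : ZMod m) = wCoeffNat q r j := by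
  rw [wCoeff, ZMod.val_natCast, (periodic_wCoeffNat hr).map_mod_nat]

variable {q} in
theorem wCoeff_succ {r : ℕ} (hr : (∏ i, (q i : K)) ^ r = (-1) ^ (r * m)) (i : ZMod m) :
    wCoeff q r (i + 1) = (-1) ^ r * (qProd q r (i + 1))⁻¹ * wCoeff q r i := by
  have h1 := wCoeff_natCast hr (i.val + 1)
  rwa [Nat.cast_succ, ZMod.natCast_zmod_val, wCoeffNat_succ, ZMod.natCast_zmod_val] at h1

/-- The coefficients of the powers of `w`. -/
def wPowCoeff (r l : ℕ) (i : ZMod m) : K := ∏ j ∈ Finset.range l, wCoeff q r (i + (j * r : ℕ))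

variable {q} in
theorem wPowCoeff_succ {r : ℕ} (hr : (∏ i, (q i : K)) ^ r = (-1) ^ (r * m)) (l : ℕ) (i : ZMod m) :
    wPowCoeff q r l (i + 1) =
      (-1) ^ (l * r) * (qProd q (l * r) (i + 1))⁻¹ * wPowCoeff q r l i := by
  rw [← prod_qProd]
  simp only [wPowCoeff, add_right_comm i 1, wCoeff_succ hr, Finset.prod_mul_distrib,
    Finset.prod_inv_distrib, Finset.prod_const, Finset.card_range]
  ring

theorem wCoeffNat_ne_zero (r j : ℕ) : wCoeffNat q r j ≠ 0 := by
  refine mul_ne_zero (by simp) (Finset.prod_ne_zero_iff.2 fun k _ => ?_)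
  rw [qInv_eq]
  exact inv_ne_zero (qProd_ne_zero q _ _)

theorem wPowCoeff_ne_zero (r l : ℕ) (i : ZMod m) : wPowCoeff q r l i ≠ 0 :=
  Finset.prod_ne_zero_iff.2 fun _ _ => wCoeffNat_ne_zero q _ _

variable {q} in
theorem wPowCoeff_zero_apply {r : ℕ} (hr : (∏ i, (q i : K)) ^ r = (-1) ^ (r * m)) {p : ℕ}
    (hp : 0 < p) :
    wPowCoeff q r p 0 = (-1) ^ (r * r * (p * (p - 1) / 2)) * epsProd q p r r := by
  obtain ⟨p, rfl⟩ := Nat.exists_eq_succ_of_ne_zero hp.ne'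
  have h1 : ∀ n, ∏ l ∈ Finset.Icc 1 n, wCoeffNat q r (l * r) =
      ∏ l ∈ Finset.range n, wCoeffNat q r ((l + 1) * r) := by
    intro n
    induction n with
    | zero => simp
    | succ n ih => rw [Finset.prod_Icc_succ_top (by omega), ih, Finset.prod_range_succ]
  have h2 : wPowCoeff q r (p + 1) 0 = ∏ l ∈ Finset.Icc 1 p, wCoeffNat q r (l * r) := by
    rw [h1, wPowCoeff, Finset.prod_range_succ', zero_mul, zero_add, wCoeff_natCast hr,
      wCoeffNat_zero, mul_one]
    refine Finset.prod_congr rfl fun l _ => ?_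
    rw [zero_add, wCoeff_natCast hr]
  rw [Nat.succ_eq_add_one, h2]
  simp only [wCoeffNat, Finset.prod_mul_distrib, epsProd, Nat.add_sub_cancel]
  congr 1
  rw [Finset.prod_pow_eq_pow_sum]
  congr 1
  have h3 : ∀ n, ∑ l ∈ Finset.Icc 1 n, l * r * r = r * r * ∑ l ∈ Finset.range (n + 1), l := by
    intro n
    induction n with
    | zero => simp
    | succ n ih =>
      rw [Finset.sum_Icc_succ_top (by omega), ih, Finset.sum_range_succ _ (n + 1)]
      ring
  rw [h3, Finset.sum_range_id, Nat.add_sub_cancel]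

variable {q} in
theorem eq_smul_of_recurrence (f g h : ZMod m → K) (hf : ∀ i, f (i + 1) = h i * f i)
    (hg : ∀ i, g (i + 1) = h i * g i) (hg0 : ∀ i, g i ≠ 0) : f = (f 0 / g 0) • g := by
  funext i
  have h1 := eq_of_forall_succ_eq (fun i => f i / g i) (fun i => by
    have h2 := hg0 (i + 1)
    rw [hg] at h2
    rw [hf, hg, mul_div_mul_left _ _ (left_ne_zero_of_mul h2)]) i
  rw [Pi.smul_apply, smul_eq_mul, ← h1, div_mul_cancel₀ _ (hg0 i)]

/-- The numerical conditions under which the graded centre is generated by `X ^ (M * m)`,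
`Y ^ (M * m)` and an element of bidegree `(r, r)`. -/
structure IsCentreData (M r p : ℕ) : Prop where
  mul_eq : M * m = p * r
  r_pos : 0 < r
  p_pos : 0 < p
  neg_one_pow : (-1 : K) ^ (M * m) = 1
  pow_M : (∏ i, (q i : K)) ^ M = 1
  pow_r : (∏ i, (q i : K)) ^ r = (-1) ^ (r * m)
  complete (t k : ℕ) : (∏ i, (q i : K)) ^ t = (-1) ^ ((t + k * m) * m) →
    (∏ i, (q i : K)) ^ (t + k * m) = (-1) ^ (t * m) →
    (∏ i, (q i : K)) ^ k = (-1) ^ (k * m) → r ∣ t ∧ M ∣ k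

namespace IsCentreData

variable {q} {M r p : ℕ} (hd : IsCentreData q M r p)
include hd

theorem qProd_mul (a : ℕ) (i : ZMod m) : qProd q (a * (M * m)) i = 1 := by
  rw [← mul_assoc, ← zero_add (a * M * m), qProd_add_mul_m, mul_comm a, pow_mul, hd.pow_M]
  simp [qProd]

theorem neg_one_pow_mul (a : ℕ) : (-1 : K) ^ (a * (M * m)) = 1 := by
  rw [mul_comm, pow_mul, hd.neg_one_pow, one_pow]

theorem isCentralCoeff_x : IsCentralCoeff q (M * m) 0 (1 : ZMod m → K) :=
  isCentralCoeff_of_recurrence (by simp) (fun i => by simp [hd.neg_one_pow, qProd])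
    fun i => by simpa using hd.qProd_mul 1 (i + 1)

theorem isCentralCoeff_y : IsCentralCoeff q 0 (M * m) (1 : ZMod m → K) :=
  isCentralCoeff_of_recurrence (by simp) (fun i => by simpa using hd.qProd_mul 1 (i + 1))
    fun i => by simp [hd.neg_one_pow, qProd]

theorem isCentralCoeff_w : IsCentralCoeff q r r (wCoeff q r) :=
  isCentralCoeff_of_recurrence rfl (wCoeff_succ hd.pow_r) (wCoeff_succ hd.pow_r)

end IsCentreData

end

section Presentation

universe u

variable {K T : Type u} [Field K] [Ring T] [Algebra K T] {m : ℕ} [NeZero m] {q : ZMod m → Kˣ}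
  {ρ : SkewRep (cycShift K m) T} {𝒜 : ℕ → Submodule K T}
  {M r p : ℕ} (hd : IsCentreData q M r p) (h : IsPolynomialModel q ρ 𝒜)

variable (q ρ r) in
/-- The generator of bidegree `(r, r)` of the graded centre. -/
def centralW : T := ρ.ι (wCoeff q r) * ρ.mon (r, r)

omit [NeZero m] in
variable (ρ) in
theorem X_pow_eq (n : ℕ) : ρ.X ^ n = ρ.ι 1 * ρ.mon (n, 0) := by simp [SkewRep.mon]

omit [NeZero m] in
variable (ρ) in
theorem Y_pow_eq (n : ℕ) : ρ.Y ^ n = ρ.ι 1 * ρ.mon (0, n) := by simp [SkewRep.mon]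

include hd

theorem commute_X_pow_ι (c : ZMod m → K) : Commute (ρ.X ^ (M * m)) (ρ.ι c) := by
  rw [X_pow_eq]
  exact IsPolynomialModel.commute_ι hd.isCentralCoeff_x c

include h

theorem commute_X_pow_Y : Commute (ρ.X ^ (M * m)) ρ.Y := by
  rw [X_pow_eq]
  exact h.commute_Y hd.isCentralCoeff_x (by simpa using hd.neg_one_pow)

theorem commute_centralW_X : Commute (centralW q ρ r) ρ.X :=
  h.commute_X hd.isCentralCoeff_w (by rw [← two_mul, pow_mul]; simp)

theorem commute_centralW_Y : Commute (centralW q ρ r) ρ.Y :=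
  h.commute_Y hd.isCentralCoeff_w (by rw [← two_mul, pow_mul]; simp)

theorem centralW_pow (l : ℕ) :
    centralW q ρ r ^ l = ρ.ι (wPowCoeff q r l) * ρ.mon (l * r, l * r) := by
  induction l with
  | zero =>
    have h1 : wPowCoeff q r 0 = 1 := funext fun i => Finset.prod_range_zero _
    simp [h1, SkewRep.mon]
  | succ l ih =>
    have h1 : wPowCoeff q r (l + 1) = wCoeff q r * (cycShift K m ^ r) (wPowCoeff q r l) := by
      funext i
      rw [Pi.mul_apply, cycShift_pow_apply, wPowCoeff, Finset.prod_range_succ', mul_comm,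
        wPowCoeff]
      congr 1
      · simp
      · refine Finset.prod_congr rfl fun j _ => congrArg _ ?_
        push_cast
        ring
    have h2 := ((commute_centralW_X hd h).pow_pow l r)
    have h3 := ((commute_centralW_Y hd h).pow_pow l r)
    rw [h1, map_mul, pow_succ]
    nth_rewrite 2 [centralW]
    have h4 : Commute (centralW q ρ r ^ l) (ρ.ι (wCoeff q r)) :=
      (IsPolynomialModel.commute_ι hd.isCentralCoeff_w _).pow_left l
    rw [SkewRep.mon, ← mul_assoc, h4.eq, mul_assoc, ← mul_assoc _ (ρ.X ^ r), h2.eq, ih,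
      ← mul_assoc (ρ.X ^ r), SkewRep.X_pow_mul_ι, mul_assoc, mul_assoc, mul_assoc]
    congr 2
    rw [SkewRep.mon, SkewRep.mon, mul_assoc, ← pow_add, ← mul_assoc, ← pow_add, add_mul, one_mul,
      add_comm r]

theorem monomial_eq (a b k : ℕ) :
    (ρ.X ^ (M * m)) ^ a * (ρ.Y ^ (M * m)) ^ b * centralW q ρ r ^ k =
      ρ.ι (wPowCoeff q r k) * ρ.mon (M * m * a + k * r, M * m * b + k * r) := by
  have h1 := (((commute_centralW_Y hd h).pow_right (M * m)).pow_pow k b).eq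
  have h2 := ((commute_X_pow_ι hd (ρ := ρ) (wPowCoeff q r k)).pow_left a).eq
  rw [mul_assoc, ← h1, centralW_pow hd h, ← mul_assoc, ← mul_assoc, h2, SkewRep.mon, SkewRep.mon,
    pow_add, add_comm (M * m * b), pow_add, pow_mul _ (M * m) a, pow_mul ρ.Y (M * m)]
  simp only [mul_assoc]

theorem isPresentedBy_gradedCentre (c : Kˣ) :
    IsPresentedBy (gradedCentre 𝒜) ((c : K) • ρ.X ^ (M * m)) (ρ.Y ^ (M * m)) (centralW q ρ r) p
      (↑c⁻¹ * ((-1) ^ (r * r * (p * (p - 1) / 2)) * epsProd q p r r)) := by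
  have hm := NeZero.pos m
  have hM : 0 < M * m := by
    rw [hd.mul_eq]
    exact Nat.mul_pos hd.p_pos hd.r_pos
  refine isPresentedBy_units_smul ((commute_X_pow_Y hd h).pow_right _)
    ((commute_centralW_X hd h).symm.pow_left _) ((commute_centralW_Y hd h).symm.pow_left _)
    hd.p_pos ?_ ?_ ?_ c
  · set x := ρ.X ^ (M * m) with hx
    set y := ρ.Y ^ (M * m) with hy
    set w := centralW q ρ r with hw
    apply le_antisymm
    · have key : ∀ a b k c, (∀ i, c (i + 1) = (-1) ^ (k * r) * (qProd q (k * r) (i + 1))⁻¹ * c i) →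
          ρ.ι c * ρ.mon (M * m * a + k * r, M * m * b + k * r) ∈ Algebra.adjoin K {x, y, w} := by
        intro a b k c hc
        rw [eq_smul_of_recurrence c (wPowCoeff q r k) _ hc (wPowCoeff_succ hd.pow_r k)
          (wPowCoeff_ne_zero q r k), map_smul, smul_mul_assoc, ← monomial_eq hd h]
        refine Subalgebra.smul_mem _ (mul_mem (mul_mem (pow_mem ?_ _) (pow_mem ?_ _))
          (pow_mem ?_ _)) _ <;> exact Algebra.subset_adjoin (by simp [x, y, w])
      refine h.gradedCentre_le fun s t c hc h0 => ?_
      have hst := (ZMod.natCast_eq_natCast_iff _ _ _).1 (hc.natCast_eq h0)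
      rcases le_total t s with hts | hts
      · obtain ⟨k, hk⟩ := (Nat.modEq_iff_dvd' hts).1 hst.symm
        have hs : s = t + k * m := by rw [mul_comm]; omega
        obtain ⟨⟨b, rfl⟩, ⟨a, rfl⟩⟩ := hd.complete t k (hs ▸ hc.pow_right h0)
          (hs ▸ hc.pow_left h0) (hc.pow_sub_left h0 k hs)
        convert key a 0 b c fun i => ?_ using 4
        · rw [hs]; ring
        · ring
        · rw [hc.succ_eq_of_X h0, hs, mul_comm r b, mul_right_comm M a m, mul_comm (M * m) a,
            pow_add, hd.neg_one_pow_mul, mul_one]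
      · obtain ⟨k, hk⟩ := (Nat.modEq_iff_dvd' hts).1 hst
        have hs : t = s + k * m := by rw [mul_comm]; omega
        obtain ⟨⟨b, rfl⟩, ⟨a, rfl⟩⟩ := hd.complete s k (hs ▸ hc.pow_left h0)
          (hs ▸ hc.pow_right h0) (hc.pow_sub_right h0 k hs)
        convert key 0 a b c fun i => ?_ using 4
        · ring
        · rw [hs]; ring
        · rw [hc.succ_eq_of_Y, hs, mul_comm r b, mul_right_comm M a m, mul_comm (M * m) a,
            pow_add, hd.neg_one_pow_mul, mul_one]
    · refine Algebra.adjoin_le ?_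
      rintro z (rfl | rfl | rfl)
      · rw [hx, X_pow_eq]
        exact h.mem_gradedCentre hd.isCentralCoeff_x (by simpa using hd.neg_one_pow)
      · rw [hy, Y_pow_eq]
        exact h.mem_gradedCentre hd.isCentralCoeff_y (by simpa using hd.neg_one_pow)
      · exact h.mem_gradedCentre hd.isCentralCoeff_w (by rw [← two_mul, pow_mul]; simp)
  · have h1 : wPowCoeff q r p = wPowCoeff q r p 0 • (1 : ZMod m → K) := by
      have := eq_smul_of_recurrence (wPowCoeff q r p) 1 (fun _ => 1) (fun i => ?_) (by simp)
        (by simp)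
      · simpa using this
      · have h2 := hd.qProd_mul 1 (i + 1)
        rw [one_mul] at h2
        rw [wPowCoeff_succ hd.pow_r, ← hd.mul_eq, hd.neg_one_pow, h2]
        simp
    rw [centralW_pow hd h, h1, ← hd.mul_eq, map_smul, smul_mul_assoc, map_one, one_mul,
      ← wPowCoeff_zero_apply hd.pow_r hd.p_pos]
    rfl
  · simp only [monomial_eq hd h]
    refine ρ.linearIndependent_monomials h.injective
      (fun v : ℕ × ℕ × Fin p => (M * m * v.1 + v.2.2 * r, M * m * v.2.1 + v.2.2 * r)) ?_ _
      fun v hv => wPowCoeff_ne_zero q r v.2.2 0 (congrFun hv 0)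
    rintro ⟨a, b, k⟩ ⟨a', b', k'⟩ hv
    simp only [Prod.mk.injEq] at hv
    obtain ⟨hv1, hv2⟩ := hv
    have hlt : ∀ k : Fin p, (k : ℕ) * r < M * m := fun k => by
      rw [hd.mul_eq]
      exact Nat.mul_lt_mul_of_pos_right k.2 hd.r_pos
    have h1 : (k : ℕ) * r = k' * r := by
      have := congrArg (· % (M * m)) hv1
      simpa [Nat.mul_add_mod, Nat.mod_eq_of_lt (hlt k), Nat.mod_eq_of_lt (hlt k')] using this
    have h2 : k = k' := Fin.ext (Nat.eq_of_mul_eq_mul_right hd.r_pos h1)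
    subst h2
    have h3 := Nat.eq_of_mul_eq_mul_left hM (Nat.add_right_cancel hv1)
    have h4 := Nat.eq_of_mul_eq_mul_left hM (Nat.add_right_cancel hv2)
    rw [h3, h4]

end Presentation

end SocleDeformation

namespace SocleDeformation

section Elements

variable {K : Type*} [Field K] {m : ℕ} [NeZero m] (q : ZMod m → Kˣ)

theorem gam_eq (n : ℕ) (i : ZMod m) : gam K m n i = e K m i * (pathRep K m).X ^ n := by
  induction n generalizing i with
  | zero => simp [gam]
  | succ n ih =>
    rw [gam, ih, ← mul_assoc, a_mul_e, if_pos rfl, ← e_mul_pathRep_X, pow_succ', mul_assoc]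

theorem del_eq (n : ℕ) (i : ZMod m) : del K m n i = (pathRep K m).Y ^ n * e K m i := by
  induction n generalizing i with
  | zero => simp [del]
  | succ n ih =>
    have h : (pathRep K m).Y * e K m i = abar K m i := by
      simp [pathRep, Finset.sum_mul, abar_mul_e]
    rw [del, ih, mul_assoc, e_mul_abar, if_pos rfl, pow_succ, mul_assoc, h]

theorem xElt_eq (n : ℕ) : xElt q n = (dualRep q).X ^ n := by
  rw [xElt, sum_range_natCast]
  simp only [gam_eq]
  rw [← Finset.sum_mul, sum_e, one_mul, map_pow]
  rfl

theorem yElt_eq (n : ℕ) : yElt q n = (dualRep q).Y ^ n := by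
  rw [yElt, sum_range_natCast]
  simp only [del_eq]
  rw [← Finset.mul_sum, sum_e, mul_one, map_pow]
  rfl

theorem gam_mul_del (n : ℕ) (i : ZMod m) :
    gam K m n i * del K m n i = e K m i * (pathRep K m).mon (n, n) := by
  have h : SkewRep.monShift (cycShift K m) (n, n) (Pi.single i 1) = Pi.single i 1 := by
    funext j
    rw [monShift_apply, add_sub_cancel_right]
  have h2 := (pathRep K m).mon_mul_ι (n, n) (Pi.single i 1)
  rw [h, pathRep_ι_single] at h2
  rw [gam_eq, del_eq, mul_assoc, ← mul_assoc (_ ^ n), ← SkewRep.mon.eq_1 _ (n, n), h2, ← mul_assoc,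
    e_mul_e, if_pos rfl]

theorem wElt_eq (n : ℕ) : wElt q n = centralW q (dualRep q) n := by
  have h : ∀ i ∈ Finset.range m, ((-1 : K) ^ (i * n) * ∏ k ∈ Finset.Icc 1 i, qInv q n k) •
      (gam K m n (i : ZMod m) * del K m n (i : ZMod m)) =
      wCoeff q n (i : ZMod m) • (e K m (i : ZMod m) * (pathRep K m).mon (n, n)) := by
    intro i hi
    rw [gam_mul_del, wCoeff, ZMod.val_cast_of_lt (Finset.mem_range.1 hi)]
    rfl
  rw [wElt, Finset.sum_congr rfl h,
    sum_range_natCast fun i => wCoeff q n i • (e K m i * (pathRep K m).mon (n, n))]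
  simp only [← smul_mul_assoc]
  rw [← Finset.sum_mul, ← pathRep_ι_apply, map_mul, SkewRep.mon, map_mul, map_pow, map_pow]
  rfl

end Elements

section Model

universe u

variable {K : Type u} [Field K] {m : ℕ} [NeZero m] (q : ZMod m → Kˣ)

theorem isPolynomialModel_lamExtRep : IsPolynomialModel q (lamExtRep q) (extPart K (Lam q)) where
  Y_mul_X := by
    rw [map_neg, neg_mul]
    exact (lam_isExterior q).extRep_Y_mul_X (mem_jacobson_lam q)
  injective := (lam_isExterior q).extRep_polyMap_injective (mem_jacobson_lam q)
  part_eq := extPart_eq q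

theorem dualEquivExt_xElt (n : ℕ) : dualEquivExt q (xElt q n) = (lamExtRep q).X ^ n := by
  rw [xElt_eq, map_pow]
  exact congrArg (· ^ n) (dualToExt_X q)

theorem dualEquivExt_yElt (n : ℕ) : dualEquivExt q (yElt q n) = (lamExtRep q).Y ^ n := by
  rw [yElt_eq, map_pow]
  exact congrArg (· ^ n) (dualToExt_Y q)

theorem dualEquivExt_wElt (n : ℕ) : dualEquivExt q (wElt q n) = centralW q (lamExtRep q) n := by
  rw [wElt_eq, centralW, centralW, ← SkewRep.polyMap_single, ← SkewRep.polyMap_single]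
  exact dualToExt_polyMap q _

variable {q} in
theorem isPresentedBy_gradedCentreExt {M r p : ℕ} (hd : IsCentreData q M r p) (c : Kˣ) :
    IsPresentedBy (gradedCentreExt K (Lam q)) (dualEquivExt q ((c : K) • xElt q (M * m)))
      (dualEquivExt q (yElt q (M * m))) (dualEquivExt q (wElt q r)) p
      (↑c⁻¹ * ((-1) ^ (r * r * (p * (p - 1) / 2)) * epsProd q p r r)) := by
  rw [map_smul, dualEquivExt_xElt, dualEquivExt_yElt, dualEquivExt_wElt]
  exact isPresentedBy_gradedCentre hd (isPolynomialModel_lamExtRep q) c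

variable {q} in
theorem isPresentedBy_gradedCentreExt_one {M r p : ℕ} (hd : IsCentreData q M r p) :
    IsPresentedBy (gradedCentreExt K (Lam q)) (dualEquivExt q (xElt q (M * m)))
      (dualEquivExt q (yElt q (M * m))) (dualEquivExt q (wElt q r)) p
      ((-1) ^ (r * r * (p * (p - 1) / 2)) * epsProd q p r r) := by
  simpa only [Units.val_one, one_smul, inv_one, one_mul] using isPresentedBy_gradedCentreExt hd 1

end Model

section Arithmetic

variable {K : Type*} [Field K] {m : ℕ} [NeZero m] {q : ZMod m → Kˣ} {d : ℕ}

theorem epsProd_ne_zero (p s n : ℕ) : epsProd q p s n ≠ 0 := by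
  refine Finset.prod_ne_zero_iff.2 fun l _ => Finset.prod_ne_zero_iff.2 fun k _ => ?_
  rw [qInv_eq]
  exact inv_ne_zero (qProd_ne_zero q _ _)

variable (hζ : IsPrimitiveRoot (∏ i, (q i : K)) d) (hd : 0 < d)
include hζ hd

theorem isCentreData_of_neg_one_pow (hm : (-1 : K) ^ m = 1) : IsCentreData q d d m where
  mul_eq := mul_comm _ _
  r_pos := hd
  p_pos := NeZero.pos m
  neg_one_pow := by rw [mul_comm, pow_mul, hm, one_pow]
  pow_M := hζ.pow_eq_one
  pow_r := by rw [hζ.pow_eq_one, mul_comm, pow_mul, hm, one_pow]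
  complete t k h1 _ h3 := by
    rw [mul_comm, pow_mul, hm, one_pow] at h1 h3
    exact ⟨hζ.dvd_of_pow_eq_one _ h1, hζ.dvd_of_pow_eq_one _ h3⟩

omit hd in
theorem dvd_two_mul {n n' : ℕ} (h : (∏ i, (q i : K)) ^ n = (-1) ^ n') : d ∣ 2 * n := by
  apply hζ.dvd_of_pow_eq_one
  rw [mul_comm, pow_mul, h, ← pow_mul, mul_comm, pow_mul]
  simp

section OddLength

variable (hm : Odd m) (hK : ringChar K ≠ 2)

omit [NeZero m] hζ hd in
include hm in
theorem neg_one_pow_mul_odd (n : ℕ) : (-1 : K) ^ (n * m) = (-1) ^ n := by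
  rw [mul_comm, pow_mul, hm.neg_one_pow]

omit [NeZero m] hζ hd in
include hK in
theorem neg_one_pow_eq_one_iff {n : ℕ} : (-1 : K) ^ n = 1 ↔ Even n :=
  neg_one_pow_eq_one_iff_even (Ring.neg_one_ne_one_of_char_ne_two hK)

include hm

theorem isCentreData_of_four_dvd (hd4 : d % 4 = 0) : IsCentreData q d d m where
  mul_eq := mul_comm _ _
  r_pos := hd
  p_pos := NeZero.pos m
  neg_one_pow := by rw [neg_one_pow_mul_odd hm, (Nat.even_iff.2 (by omega)).neg_one_pow]
  pow_M := hζ.pow_eq_one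
  pow_r := by
    rw [hζ.pow_eq_one, neg_one_pow_mul_odd hm, (Nat.even_iff.2 (by omega)).neg_one_pow]
  complete t k h1 _ h3 := by
    have key : ∀ n n', (∏ i, (q i : K)) ^ n = (-1) ^ n' → Even n := by
      intro n n' h
      obtain ⟨c, hc⟩ := dvd_two_mul hζ h
      obtain ⟨e, rfl⟩ := Nat.dvd_of_mod_eq_zero hd4
      exact ⟨e * c, by linarith⟩
    have hk : Even k := key _ _ h3
    have ht : Even t := key _ _ h1
    rw [neg_one_pow_mul_odd hm, (ht.add (hk.mul_right m)).neg_one_pow] at h1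
    rw [neg_one_pow_mul_odd hm, hk.neg_one_pow] at h3
    exact ⟨hζ.dvd_of_pow_eq_one _ h1, hζ.dvd_of_pow_eq_one _ h3⟩

include hK

theorem isCentreData_of_odd (hd2 : Odd d) : IsCentreData q (2 * d) (2 * d) m where
  mul_eq := mul_comm _ _
  r_pos := by omega
  p_pos := NeZero.pos m
  neg_one_pow := by rw [neg_one_pow_mul_odd hm, (even_two_mul d).neg_one_pow]
  pow_M := by rw [mul_comm, pow_mul, hζ.pow_eq_one, one_pow]
  pow_r := by
    rw [neg_one_pow_mul_odd hm, (even_two_mul d).neg_one_pow, mul_comm, pow_mul, hζ.pow_eq_one,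
      one_pow]
  complete t k h1 _ h3 := by
    have key : ∀ n n', (∏ i, (q i : K)) ^ n = (-1) ^ n' → d ∣ n ∧ Even n' := by
      intro n n' h
      have hn := (Nat.Coprime.dvd_mul_left hd2.coprime_two_right).1 (dvd_two_mul hζ h)
      refine ⟨hn, (neg_one_pow_eq_one_iff hK).1 ?_⟩
      rw [← h, hζ.pow_eq_one_iff_dvd]
      exact hn
    have h2 : ∀ n, d ∣ n → Even n → 2 * d ∣ n := fun n hn hn2 =>
      hd2.coprime_two_left.mul_dvd_of_dvd_of_dvd hn2.two_dvd hn
    rw [neg_one_pow_mul_odd hm] at h1 h3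
    have hk := key _ _ h3
    have ht := key _ _ h1
    exact ⟨h2 t ht.1 ((Nat.even_add.1 ht.2).2 (hk.2.mul_right m)), h2 k hk.1 hk.2⟩

theorem isCentreData_of_mod_four (hd4 : d % 4 = 2) : IsCentreData q d (d / 2) (2 * m) where
  mul_eq := by
    obtain ⟨e, rfl⟩ : 2 ∣ d := by omega
    rw [Nat.mul_div_cancel_left _ two_pos]
    ring
  r_pos := by omega
  p_pos := Nat.mul_pos two_pos (NeZero.pos m)
  neg_one_pow := by rw [neg_one_pow_mul_odd hm, (Nat.even_iff.2 (by omega)).neg_one_pow]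
  pow_M := hζ.pow_eq_one
  pow_r := by
    rw [neg_one_pow_mul_odd hm, (Nat.odd_iff.2 (by omega : d / 2 % 2 = 1)).neg_one_pow]
    exact (hζ.pow hd (by omega : d = d / 2 * 2)).eq_neg_one_of_two_right
  complete t k h1 _ h3 := by
    obtain ⟨e, rfl⟩ : 2 ∣ d := by omega
    rw [Nat.mul_div_cancel_left _ two_pos]
    have he : Odd e := Nat.odd_iff.2 (by omega)
    have hζe : (∏ i, (q i : K)) ^ e = -1 :=
      (hζ.pow hd (mul_comm 2 e)).eq_neg_one_of_two_right
    have key : ∀ n n', (∏ i, (q i : K)) ^ n = (-1) ^ n' →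
        e ∣ n ∧ (∏ i, (q i : K)) ^ n = (-1) ^ n := by
      intro n n' h
      obtain ⟨c, rfl⟩ := Nat.dvd_of_mul_dvd_mul_left two_pos (dvd_two_mul hζ h)
      exact ⟨dvd_mul_right _ _, by rw [pow_mul, hζe, pow_mul, he.neg_one_pow]⟩
    have ht := key _ _ h1
    rw [ht.2, neg_one_pow_mul_odd hm, pow_add, neg_one_pow_mul_odd hm, eq_comm,
      mul_eq_left₀ (by simp), neg_one_pow_eq_one_iff hK] at h1
    rw [neg_one_pow_mul_odd hm, h1.neg_one_pow] at h3
    exact ⟨ht.1, hζ.dvd_of_pow_eq_one _ h3⟩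

end OddLength

end Arithmetic

end SocleDeformation

open SocleDeformation in
theorem mainTheorem2 {K : Type*} [Field K] (m : ℕ) [NeZero m] (q : ZMod m → Kˣ) :
    ∃ Φ : SocleDeformation.LamDual q ≃ₐ[K] ExtAlgebra (SocleDeformation.Lam q),
      (∀ (i j : CycleVertex m) (p : Quiver.Path i j),
        Φ (RingQuot.mkAlgHom K (SocleDeformation.DualRel q) (PathAlgebra.ofPath K p)) ∈
          extPart K (SocleDeformation.Lam q) p.length) ∧
      ((∀ n : ℕ, 0 < n → (∏ i, q i) ^ n ≠ 1) →
        Function.Bijective (algebraMap K (gradedCentreExt K (SocleDeformation.Lam q)))) ∧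
      ∀ d : ℕ, 0 < d → IsPrimitiveRoot (∏ i, q i) d →
        ((Even m ∨ ringChar K = 2) →
          IsPresentedBy (gradedCentreExt K (SocleDeformation.Lam q))
            (Φ (SocleDeformation.xElt q (d * m))) (Φ (SocleDeformation.yElt q (d * m)))
            (Φ (SocleDeformation.wElt q d)) m
            ((-1) ^ (m * d / 2) * SocleDeformation.epsProd q m d d)) ∧
        ((Odd m ∧ ringChar K ≠ 2) →
          (d % 4 = 0 →
            IsPresentedBy (gradedCentreExt K (SocleDeformation.Lam q))
              (Φ (SocleDeformation.xElt q (d * m))) (Φ (SocleDeformation.yElt q (d * m)))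
              (Φ (SocleDeformation.wElt q d)) m
              (SocleDeformation.epsProd q m d d)) ∧
          (Odd d →
            IsPresentedBy (gradedCentreExt K (SocleDeformation.Lam q))
              (Φ (SocleDeformation.xElt q (2 * d * m))) (Φ (SocleDeformation.yElt q (2 * d * m)))
              (Φ (SocleDeformation.wElt q (2 * d))) m
              (SocleDeformation.epsProd q m (2 * d) (2 * d))) ∧
          (d % 4 = 2 →
            IsPresentedBy (gradedCentreExt K (SocleDeformation.Lam q))
              (Φ (SocleDeformation.xElt q (d * m))) (Φ (SocleDeformation.yElt q (d * m)))
              (Φ (SocleDeformation.wElt q (d / 2))) (2 * m)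
              (-SocleDeformation.epsProd q (2 * m) (d / 2) (d / 2)) ∧
            ∃ c : Kˣ, IsPresentedBy (gradedCentreExt K (SocleDeformation.Lam q))
              (Φ ((c : K) • SocleDeformation.xElt q (d * m)))
              (Φ (SocleDeformation.yElt q (d * m)))
              (Φ (SocleDeformation.wElt q (d / 2))) (2 * m)
              (SocleDeformation.epsProd q (2 * m) (d / 2) d))) := by
  refine ⟨dualEquivExt q, dualEquivExt_ofPath_mem q, fun hζ => ?_, fun d hd hζ' => ?_⟩
  · refine (isPolynomialModel_lamExtRep q).bijective_algebraMap fun n hn h => hζ n hn ?_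
    exact Units.ext (by rw [Units.val_pow_eq_pow_val, Units.coe_prod, h, Units.val_one])
  have hζ : IsPrimitiveRoot (∏ i, (q i : K)) d := by
    rw [← Units.coe_prod]
    exact IsPrimitiveRoot.coe_units_iff.2 hζ'
  refine ⟨fun hm => ?_, fun ⟨hm, hK⟩ => ⟨fun hd4 => ?_, fun hd2 => ?_, fun hd4 => ?_⟩⟩
  · have hsign : (-1 : K) ^ m = 1 ∧
        (-1 : K) ^ (d * d * (m * (m - 1) / 2)) = (-1) ^ (m * d / 2) := by
      rcases hm with hm | hm
      · refine ⟨hm.neg_one_pow, ?_⟩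
        obtain ⟨n, rfl⟩ := hm.two_dvd
        rw [mul_assoc 2 n d, mul_assoc 2 n, Nat.mul_div_cancel_left _ two_pos,
          Nat.mul_div_cancel_left _ two_pos]
        refine neg_one_pow_congr ?_
        have hn : n ≠ 0 := by
          rintro rfl
          exact NeZero.ne (2 * 0) rfl
        have hodd : ¬ Even (2 * n - 1) := by
          rw [Nat.even_iff]
          omega
        simp only [Nat.even_mul, hodd]
        tauto
      · have h1 : (-1 : K) = 1 := by
          have : CharP K 2 := ringChar.of_eq hm
          exact CharTwo.neg_eq 1
        simp only [h1, one_pow, and_self]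
    rw [← hsign.2]
    exact isPresentedBy_gradedCentreExt_one (isCentreData_of_neg_one_pow hζ hd hsign.1)
  · have h := isPresentedBy_gradedCentreExt_one (isCentreData_of_four_dvd hζ hd hm hd4)
    have hd2 : Even d := Nat.even_iff.2 (by omega)
    rwa [((hd2.mul_right d).mul_right _).neg_one_pow, one_mul] at h
  · have h := isPresentedBy_gradedCentreExt_one (isCentreData_of_odd hζ hd hm hK hd2)
    rwa [(((even_two_mul d).mul_right (2 * d)).mul_right _).neg_one_pow, one_mul] at h
  · have hdata := isCentreData_of_mod_four hζ hd hm hK hd4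
    have hodd : Odd (d / 2 * (d / 2) * (2 * m * (2 * m - 1) / 2)) := by
      have h1 : Odd (d / 2) := Nat.odd_iff.2 (by omega)
      have h2 : Odd (2 * m - 1) := Nat.odd_iff.2 (by have := NeZero.pos m; omega)
      rw [mul_assoc 2 m, Nat.mul_div_cancel_left _ two_pos]
      exact (h1.mul h1).mul (hm.mul h2)
    constructor
    · have h := isPresentedBy_gradedCentreExt_one hdata
      rwa [hodd.neg_one_pow, neg_one_mul] at h
    · have h1 : -epsProd q (2 * m) (d / 2) (d / 2) / epsProd q (2 * m) (d / 2) d ≠ 0 :=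
        div_ne_zero (neg_ne_zero.2 (epsProd_ne_zero _ _ _)) (epsProd_ne_zero _ _ _)
      refine ⟨Units.mk0 _ h1, ?_⟩
      have h := isPresentedBy_gradedCentreExt hdata (Units.mk0 _ h1)
      rwa [hodd.neg_one_pow, neg_one_mul, Units.val_inv_eq_inv_val, Units.val_mk0, inv_div,
        div_mul_cancel₀ _ (neg_ne_zero.2 (epsProd_ne_zero _ _ _))] at h

end
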